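/- Let $n\ge 2$ be an integer, $r\in[1,\infty)$ and $s\in(n/2,n)$ with $\frac1{2r}+\frac n{2s}>1$. A pair $(p,q)$ is called admissible if $\frac1p+\frac n{2q}=\frac n4$, $p,q\in[2,\infty]$ and $(n,p,q)\ne(2,2,\infty)$. Then there exist a real-valued potential $V\in L^r(0,1;L^s(\mathbb R^n))$ and a complex-valued function $u\in C([0,1];L^2(\mathbb R^n))$ which solves $$ i\,\partial_t u-\Delta u+V(t,x)\,u=0 $$ on $[0,1]$ in the integral sense $$ u(t)=e^{-it\Delta}u(0)+i\int_0^t e^{-i(t-\tau)\Delta}\,V(\tau)u(\tau)\,d\tau\qquad (0\le t\le 1), $$ such that for every admissible pair $(p,q)$ with $p<\infty$ one has $$ u\in L^p(0,T;L^q(\mathbb R^n))\ \text{ for all } 0<T<1,\qquad\text{but}\qquad u\notin L^p(0,1;L^q(\mathbb R^n)). $$ Here the integral identity is understood between tempered distributions: for every $t\in[0,1]$ and every Schwartz function $\varphi$, the function $(\tau,x)\mapsto V(\tau,x)\,u(\tau,x)\,(e^{-i(t-\tau)\Delta}\varphi)(x)$ is integrable on $(0,t)\times\mathbb R^n$ and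 $$ \int u(t)\,\varphi\,dx=\int u(0)\,e^{-it\Delta}\varphi\,dx+i\int_0^t\!\!\int V(\tau)u(\tau)\,e^{-i(t-\tau)\Delta}\varphi\,dx\,d\tau, $$ where $e^{-it\Delta}$ is the Fourier multiplier with symbol $e^{it|\xi|^2}$ (with $\xi$ the angular frequency, so that $-\Delta$ has symbol $|\xi|^2$). -/

import Mathlib

open MeasureTheory Set Filter Topology
open scoped ENNReal SchwartzMap FourierTransform

/-- The pair `(p, q)` is Schrödinger admissible in dimension `n`:
`1/p + n/(2q) = n/4`, `p, q ∈ [2, ∞]` and `(n, p, q) ≠ (2, 2, ∞)` (with `1/∞ = 0`). -/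
def SchrodingerAdmissible (n : ℕ) (p q : ℝ≥0∞) : Prop :=
  p⁻¹ + (n : ℝ≥0∞) / 2 * q⁻¹ = (n : ℝ≥0∞) / 4 ∧ 2 ≤ p ∧ 2 ≤ q ∧
    ¬ (n = 2 ∧ p = 2 ∧ q = ∞)

/-- The mixed space-time norm of `f` in `L^p(I; L^q(ℝⁿ))`: the `L^p(I)` norm of
`t ↦ ‖f(t, ·)‖_{L^q}`, as an element of `[0, ∞]`. -/
noncomputable def mixedNorm {n : ℕ} {F : Type*} [NormedAddCommGroup F] (I : Set ℝ)
    (p q : ℝ≥0∞) (f : ℝ → EuclideanSpace ℝ (Fin n) → F) : ℝ≥0∞ :=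
  eLpNorm (fun t => eLpNorm (f t) q volume) p (volume.restrict I)

/-- `f ∈ L^p(I; L^q(ℝⁿ))`: `f` is measurable on `I × ℝⁿ` and has finite mixed norm. -/
def MemMixed {n : ℕ} {F : Type*} [NormedAddCommGroup F] (I : Set ℝ)
    (p q : ℝ≥0∞) (f : ℝ → EuclideanSpace ℝ (Fin n) → F) : Prop :=
  AEStronglyMeasurable (Function.uncurry f) ((volume.restrict I).prod volume) ∧
    mixedNorm I p q f < ∞

/-- `u ∈ C(I; L²(ℝⁿ))`, for a (jointly measurable) function `u` on `I × ℝⁿ`: the slices `u(t, ·)`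
are the values of a continuous curve in the Banach space `L²`. -/
def MemContL2 {n : ℕ} (I : Set ℝ) (u : ℝ → EuclideanSpace ℝ (Fin n) → ℂ) : Prop :=
  AEStronglyMeasurable (Function.uncurry u) ((volume.restrict I).prod volume) ∧
    ∃ U : ℝ → Lp ℂ 2 (volume : Measure (EuclideanSpace ℝ (Fin n))),
      ContinuousOn U I ∧ ∀ t ∈ I, U t =ᵐ[volume] u t

/-- The free evolution `e^{-itΔ} φ` of a Schwartz function: the Fourier multiplier with symbol
`e^{it(2π|ξ|)²}`. The function `w(t) = e^{-itΔ} φ` solves `i w_t - Δ w = 0`, `w(0) = φ`. -/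
noncomputable def freeEvolution {n : ℕ} (t : ℝ) (φ : 𝓢(EuclideanSpace ℝ (Fin n), ℂ)) :
    EuclideanSpace ℝ (Fin n) → ℂ :=
  𝓕⁻ (fun ξ : EuclideanSpace ℝ (Fin n) =>
    Complex.exp (Complex.I * (((2 * Real.pi * ‖ξ‖) ^ 2 * t : ℝ) : ℂ)) *
      𝓕 (φ : EuclideanSpace ℝ (Fin n) → ℂ) ξ)

/-- `u` solves `i u_t - Δ u + V(t,x) u = 0` on the time interval `[0, T]`, in integral form:
`u(t) = e^{-itΔ} u(0) + i ∫₀ᵗ e^{-i(t-τ)Δ} V(τ) u(τ) dτ` for every `t ∈ [0, T]`.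
As `V(τ) u(τ)` need not lie in `L²`, the identity is read between tempered distributions, that is,
after pairing with an arbitrary Schwartz function `φ`; the operators `e^{-itΔ}` are moved to `φ`,
since they are symmetric for the pairing `∫ f φ dx`. The pairing in the integral term is required
to converge absolutely. -/
def IsIntegralSolution {n : ℕ} (T : ℝ) (V : ℝ → EuclideanSpace ℝ (Fin n) → ℝ)
    (u : ℝ → EuclideanSpace ℝ (Fin n) → ℂ) : Prop :=
  ∀ t ∈ Icc (0 : ℝ) T, ∀ φ : 𝓢(EuclideanSpace ℝ (Fin n), ℂ),
    Integrable (fun z : ℝ × EuclideanSpace ℝ (Fin n) =>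
        (V z.1 z.2 : ℂ) * u z.1 z.2 * freeEvolution (t - z.1) φ z.2)
      ((volume.restrict (Ioo 0 t)).prod volume) ∧
    ∫ x, u t x * φ x = (∫ x, u 0 x * freeEvolution t φ x) +
      Complex.I * ∫ τ in Ioo 0 t, ∫ x, (V τ x : ℂ) * u τ x * freeEvolution (t - τ) φ x

/-! ### Profile functions -/

/-! The solution is written down explicitly and the potential is read off from it. With `y = |x|²`,
put `u = A exp(iθ)`, where `A` and `θ` are real functions of `(t, y)`. The equation then says two
things. Its imaginary part is conservation of mass, in which `V` does not appear; its real part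
determines `V` as a real function. So any pair `(A, θ)` satisfying the continuity equation solves
the equation for some real `V`, and what remains is to choose a concentrating profile whose `V` is
small enough.

Let `τ(t) = (1 - t)^(5/4)`, `z = y/τ`, `L = 1 - log τ`, `κ = (n + 2)/4`, and `A = (τ E(z))^(1/2)
Q^(-κ)`, `Q = y L + τ Ψ(z) + P(y)`, with `Ψ - zΨ' = E`. On `y ≤ 1`, where `P = 0`, this relation
gives `Q - y ∂_y Q = τE`, so `∂_y (y/Q) = τE/Q²`. The choice of `κ` then makes the mass in `|x|² <
y` a constant multiple of `(y/Q)^(n/2)`. Since also `∂_τ Q = E - z`, the flow transporting this mass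
is explicit and is generated by `θ = (τ'/8) B(z)` with `B' = z/E - 1` (`continuity_equation`). For
`z ≥ 1` one has `E = z` and `Ψ = -z log z`: the dependence on `τ` cancels and `B = 0`. Thus `u` is
frozen outside the ball `|x|² < τ`, and the limit at `t = 1` behaves near `0` like `|x|^(-n/2)`
times the power `-κ` of a logarithm, which is just inside `L²`.

All terms of `V` scale like `1/(|x|² + τ)`, with a loss of `L²` (`abs_radV_le`). Hence `‖V(t)‖_s ≲
L² τ^(n/(2s) - 1)`, and the hypothesis `r (1 - n/(2s)) < 1/2` makes its `r`-th power integrable in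
time. On the core `|x|² < τ` one has `|u| ≳ τ^(-n/4) L^(-κ)`, so for admissible pairs `‖u(t)‖_q^p ≳
τ^(-1) L^(-κp)`, which is not integrable because `5/4 > 1` beats the logarithms
(`not_memMixed_sol`). Any exponent strictly between `1` and `2` would meet these two demands.

Mass does not escape at `t = 1`: the core carries mass `O(L^(-1/2))` (`lintegral_sq_sol_le`), which
gives continuity in `L²`. The integral equation is checked frequency by frequency: `V u` is
integrable on space-time, the plane wave coefficients of `u` satisfy a linear ODE in time, and
Fubini returns to the pairing with Schwartz functions (`isIntegralSolution_of_wave`). -/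

theorem hasDerivAt_ite_le {f g f' g' : ℝ → ℝ} (a : ℝ) (hf : ∀ x ≤ a, HasDerivAt f (f' x) x)
    (hg : ∀ x, a ≤ x → HasDerivAt g (g' x) x) (h0 : f a = g a) (h1 : f' a = g' a) (x : ℝ) :
    HasDerivAt (fun x => if x ≤ a then f x else g x) (if x ≤ a then f' x else g' x) x := by
  rcases lt_trichotomy x a with h | rfl | h
  · rw [if_pos h.le]
    refine (hf x h.le).congr_of_eventuallyEq ?_
    filter_upwards [Iio_mem_nhds h] with y hy using if_pos (le_of_lt hy)
  · rw [if_pos le_rfl, ← hasDerivWithinAt_univ, ← Iic_union_Ici (a := x)]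
    refine HasDerivWithinAt.union ?_ ?_
    · refine (hf x le_rfl).hasDerivWithinAt.congr (fun y hy => if_pos hy) (if_pos le_rfl)
    · rw [h1]
      refine (hg x le_rfl).hasDerivWithinAt.congr (fun y hy => ?_) ?_
      · rcases eq_or_lt_of_le (show x ≤ y from hy) with rfl | hy
        · simpa using h0
        · exact if_neg (not_le.2 hy)
      · simpa using h0
  · rw [if_neg (not_le.2 h)]
    refine (hg x h.le).congr_of_eventuallyEq ?_
    filter_upwards [Ioi_mem_nhds h] with y hy using if_neg (not_le.2 hy)

/-- The core profile: a `C²` function with `coreE z = z` for `z ≥ 1`, positive on `z ≥ 0`. -/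
noncomputable def coreE (z : ℝ) : ℝ := if z ≤ 1 then 3 / 8 + 3 / 4 * z ^ 2 - z ^ 4 / 8 else z

/-- First derivative of `coreE`. -/
noncomputable def coreE₁ (z : ℝ) : ℝ := if z ≤ 1 then 3 / 2 * z - z ^ 3 / 2 else 1

/-- Second derivative of `coreE`. -/
noncomputable def coreE₂ (z : ℝ) : ℝ := if z ≤ 1 then 3 / 2 - 3 / 2 * z ^ 2 else 0

/-- The solution of `Ψ - z Ψ' = coreE` with `Ψ z = -z log z` for `z ≥ 1`. -/
noncomputable def corePsi (z : ℝ) : ℝ :=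
  if z ≤ 1 then 3 / 8 + z / 3 - 3 / 4 * z ^ 2 + z ^ 4 / 24 else -(z * Real.log z)

/-- First derivative of `corePsi`. -/
noncomputable def corePsi₁ (z : ℝ) : ℝ :=
  if z ≤ 1 then 1 / 3 - 3 / 2 * z + z ^ 3 / 6 else -Real.log z - 1

/-- Second derivative of `corePsi`. -/
noncomputable def corePsi₂ (z : ℝ) : ℝ := if z ≤ 1 then -(3 / 2) + z ^ 2 / 2 else -z⁻¹

/-- The far-field correction, vanishing for `y ≤ 1`. -/
noncomputable def farP (y : ℝ) : ℝ := if y ≤ 1 then 0 else y * (y - 1) ^ 3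

/-- First derivative of `farP`. -/
noncomputable def farP₁ (y : ℝ) : ℝ := if y ≤ 1 then 0 else (y - 1) ^ 2 * (4 * y - 1)

/-- Second derivative of `farP`. -/
noncomputable def farP₂ (y : ℝ) : ℝ := if y ≤ 1 then 0 else (y - 1) * (12 * y - 6)

/-- The quartic is the only even one with value `1`, slope `1` and second derivative `0` at `z = 1`,
so it joins the line `z` to second order. -/
theorem hasDerivAt_coreE (z : ℝ) : HasDerivAt coreE (coreE₁ z) z := by
  refine hasDerivAt_ite_le (f' := fun z => 3 / 2 * z - z ^ 3 / 2) (g' := fun _ => 1) 1 ?_ ?_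
    (by norm_num) (by norm_num) z
  · intro x _
    refine HasDerivAt.congr_deriv ((((hasDerivAt_pow 2 x).const_mul (3 / 4)).const_add (3 / 8)).sub
      ((hasDerivAt_pow 4 x).div_const 8)) ?_
    norm_num; ring
  · intro x _; exact hasDerivAt_id x

theorem hasDerivAt_coreE₁ (z : ℝ) : HasDerivAt coreE₁ (coreE₂ z) z := by
  refine hasDerivAt_ite_le (f' := fun z => 3 / 2 - 3 / 2 * z ^ 2) (g' := fun _ => 0) 1 ?_ ?_
    (by norm_num) (by norm_num) z
  · intro x _
    refine HasDerivAt.congr_deriv (((hasDerivAt_id x).const_mul (3 / 2)).sub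
      ((hasDerivAt_pow 3 x).div_const 2)) ?_
    norm_num; ring
  · intro x _; exact hasDerivAt_const x _

theorem hasDerivAt_corePsi (z : ℝ) : HasDerivAt corePsi (corePsi₁ z) z := by
  refine hasDerivAt_ite_le (f' := fun z => 1 / 3 - 3 / 2 * z + z ^ 3 / 6)
    (g' := fun z => -Real.log z - 1) 1 ?_ ?_ (by norm_num) (by norm_num) z
  · intro x _
    refine HasDerivAt.congr_deriv (((((hasDerivAt_id x).div_const 3).const_add (3 / 8)).sub
      ((hasDerivAt_pow 2 x).const_mul (3 / 4))).add ((hasDerivAt_pow 4 x).div_const 24)) ?_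
    norm_num; ring
  · intro x hx
    have hx0 : x ≠ 0 := by linarith
    refine HasDerivAt.congr_deriv (((hasDerivAt_id x).mul (Real.hasDerivAt_log hx0)).neg) ?_
    simp [hx0]; ring

theorem hasDerivAt_corePsi₁ (z : ℝ) : HasDerivAt corePsi₁ (corePsi₂ z) z := by
  refine hasDerivAt_ite_le (f' := fun z => -(3 / 2) + z ^ 2 / 2)
    (g' := fun z => -z⁻¹) 1 ?_ ?_ (by norm_num) (by norm_num) z
  · intro x _
    refine HasDerivAt.congr_deriv ((((hasDerivAt_id x).const_mul (3 / 2)).const_sub (1 / 3)).add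
      ((hasDerivAt_pow 3 x).div_const 6)) ?_
    norm_num; ring
  · intro x hx
    have hx0 : x ≠ 0 := by linarith
    exact ((Real.hasDerivAt_log hx0).neg).sub_const 1

theorem hasDerivAt_farP (y : ℝ) : HasDerivAt farP (farP₁ y) y := by
  refine hasDerivAt_ite_le (f' := fun _ => 0)
    (g' := fun y => (y - 1) ^ 2 * (4 * y - 1)) 1 ?_ ?_ (by norm_num) (by norm_num) y
  · intro x _; exact hasDerivAt_const x _
  · intro x hx
    refine HasDerivAt.congr_deriv ((hasDerivAt_id x).mul (((hasDerivAt_id x).sub_const 1).pow 3)) ?_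
    simp; ring

theorem hasDerivAt_farP₁ (y : ℝ) : HasDerivAt farP₁ (farP₂ y) y := by
  refine hasDerivAt_ite_le (f' := fun _ => 0)
    (g' := fun y => (y - 1) * (12 * y - 6)) 1 ?_ ?_ (by norm_num) (by norm_num) y
  · intro x _; exact hasDerivAt_const x _
  · intro x hx
    refine HasDerivAt.congr_deriv ((((hasDerivAt_id x).sub_const 1).pow 2).mul
      (((hasDerivAt_id x).const_mul 4).sub_const 1)) ?_
    simp; ring

/-- This ODE drives the construction: it yields both `y ∂_y Q = Q - τE` and `∂_τ Q = E - z`. Its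
homogeneous solutions are the multiples of `z`; the term `z / 3` is the multiple that makes `Ψ`
vanish at `1`, as joining `-z log z` requires. -/
theorem corePsi_sub_mul (z : ℝ) : corePsi z - z * corePsi₁ z = coreE z := by
  unfold corePsi corePsi₁ coreE; split_ifs <;> ring

theorem coreE_pos {z : ℝ} (hz : 0 ≤ z) : 3 / 8 ≤ coreE z := by
  unfold coreE; split_ifs with h
  · have : z ^ 2 ≤ 1 := by nlinarith
    nlinarith [sq_nonneg z]
  · linarith

theorem le_coreE (z : ℝ) (hz : 0 ≤ z) : z ≤ coreE z := by
  unfold coreE; split_ifs with h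
  · have : 0 ≤ (1 - z) ^ 3 * (3 + z) := by
      have := sub_nonneg.2 h; positivity
    nlinarith
  · rfl

theorem coreE_le_one {z : ℝ} (hz : 0 ≤ z) (h : z ≤ 1) : coreE z ≤ 1 := by
  unfold coreE; rw [if_pos h]
  -- This is `8 (1 - E)`.
  have : 0 ≤ (1 - z ^ 2) * (5 - z ^ 2) := by apply mul_nonneg <;> nlinarith
  nlinarith

theorem abs_coreE₁_le {z : ℝ} (hz : 0 ≤ z) : |coreE₁ z| ≤ 1 := by
  unfold coreE₁; split_ifs with h
  · have h3 : 0 ≤ z * (1 - z ^ 2) := mul_nonneg hz (by nlinarith)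
    have : 0 ≤ (1 - z) ^ 2 * (2 + z) := by positivity
    rw [abs_le]; constructor <;> nlinarith
  · simp

theorem abs_coreE₂_le {z : ℝ} (hz : 0 ≤ z) : |coreE₂ z| ≤ 3 / 2 := by
  unfold coreE₂; split_ifs with h
  · rw [abs_le]; constructor <;> nlinarith
  · norm_num

theorem abs_corePsi₁_le {z : ℝ} (hz : 0 ≤ z) (h : z ≤ 1) : |corePsi₁ z| ≤ 1 := by
  unfold corePsi₁; rw [if_pos h]
  have h3 : 0 ≤ z * (1 - z ^ 2) := mul_nonneg hz (by nlinarith)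
  -- This is `6 (Ψ' + 1)`, the lower bound; the upper bound is immediate.
  have : 0 ≤ (1 - z) * (8 - z - z ^ 2) := mul_nonneg (by linarith) (by nlinarith)
  rw [abs_le]; constructor <;> nlinarith

theorem abs_corePsi₂_le {z : ℝ} (hz : 0 ≤ z) (h : z ≤ 1) : |corePsi₂ z| ≤ 3 / 2 := by
  unfold corePsi₂; rw [if_pos h]
  rw [abs_le]; constructor <;> nlinarith

/-- For `y ≤ τ` one has `Q/τ = -(log τ) z + (z + Ψ)`, so this is what keeps `Q` away from zero in
the core, including at `y = 0`. -/
theorem add_corePsi_ge {z : ℝ} (hz : 0 ≤ z) (h : z ≤ 1) :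
    3 / 8 * (1 + z) ≤ z + corePsi z := by
  unfold corePsi; rw [if_pos h]
  have : 0 ≤ z * (1 - z) := mul_nonneg hz (by linarith)
  have : 0 ≤ z ^ 4 := by positivity
  nlinarith

theorem add_corePsi_le {z : ℝ} (hz : 0 ≤ z) (h : z ≤ 1) : z + corePsi z ≤ 2 := by
  unfold corePsi; rw [if_pos h]
  have : z ^ 4 ≤ z := by
    have := pow_le_pow_of_le_one hz h (show 1 ≤ 4 by norm_num); simpa using this
  have : 0 ≤ z ^ 2 := by positivity
  nlinarith

theorem continuous_coreE : Continuous coreE :=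
  continuous_iff_continuousAt.2 fun z => (hasDerivAt_coreE z).continuousAt

theorem continuous_coreE₁ : Continuous coreE₁ :=
  continuous_iff_continuousAt.2 fun z => (hasDerivAt_coreE₁ z).continuousAt

theorem continuous_corePsi : Continuous corePsi :=
  continuous_iff_continuousAt.2 fun z => (hasDerivAt_corePsi z).continuousAt

theorem continuous_corePsi₁ : Continuous corePsi₁ :=
  continuous_iff_continuousAt.2 fun z => (hasDerivAt_corePsi₁ z).continuousAt

theorem continuous_farP : Continuous farP :=
  continuous_iff_continuousAt.2 fun z => (hasDerivAt_farP z).continuousAt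

theorem continuous_farP₁ : Continuous farP₁ :=
  continuous_iff_continuousAt.2 fun z => (hasDerivAt_farP₁ z).continuousAt

/-! ### The self-similar phase profile -/

/-- The derivative of the self-similar phase profile; it is `z / coreE z - 1` for `z ≥ 0`. -/
noncomputable def flowB₁ (z : ℝ) : ℝ := z / max (coreE z) (1 / 4) - 1

/-- The self-similar phase profile. -/
noncomputable def flowB (z : ℝ) : ℝ := ∫ x in (1 : ℝ)..z, flowB₁ x

/-- The second derivative of the self-similar phase profile. -/
noncomputable def flowB₂ (z : ℝ) : ℝ := (coreE z - z * coreE₁ z) / coreE z ^ 2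

/-- The truncation by `1/4` is inactive for `z ≥ 0`, where `E ≥ 3/8`. It only keeps the denominator
positive at negative `z`, so that the primitive is differentiable on the whole line. -/
theorem continuous_flowB₁ : Continuous flowB₁ := by
  refine (continuous_id.div (continuous_coreE.max continuous_const) fun z => ?_).sub
    continuous_const
  have : (1 / 4 : ℝ) ≤ max (coreE z) (1 / 4) := le_max_right _ _
  exact ne_of_gt (by linarith)

theorem hasDerivAt_flowB (z : ℝ) : HasDerivAt flowB (flowB₁ z) z :=
  (continuous_flowB₁.integral_hasStrictDerivAt 1 z).hasDerivAt

theorem continuous_flowB : Continuous flowB :=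
  continuous_iff_continuousAt.2 fun z => (hasDerivAt_flowB z).continuousAt

theorem flowB₁_eq {z : ℝ} (hz : 0 ≤ z) : flowB₁ z = z / coreE z - 1 := by
  have := coreE_pos hz
  rw [flowB₁, max_eq_left (by linarith)]

theorem flowB₁_eq_zero {z : ℝ} (hz : 1 ≤ z) : flowB₁ z = 0 := by
  rw [flowB₁_eq (by linarith)]
  have : coreE z = z := by
    unfold coreE; split_ifs with h
    · obtain rfl : z = 1 := le_antisymm h hz
      norm_num
    · rfl
  rw [this, div_self (by linarith), sub_self]

theorem coreE_of_ge {z : ℝ} (hz : 1 ≤ z) : coreE z = z := by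
  unfold coreE; split_ifs with h
  · obtain rfl : z = 1 := le_antisymm h hz
    norm_num
  · rfl

theorem coreE₁_of_ge {z : ℝ} (hz : 1 ≤ z) : coreE₁ z = 1 := by
  unfold coreE₁; split_ifs with h
  · obtain rfl : z = 1 := le_antisymm h hz
    norm_num
  · rfl

theorem coreE₂_of_ge {z : ℝ} (hz : 1 ≤ z) : coreE₂ z = 0 := by
  unfold coreE₂; split_ifs with h
  · obtain rfl : z = 1 := le_antisymm h hz
    norm_num
  · rfl

theorem corePsi_of_ge {z : ℝ} (hz : 1 ≤ z) : corePsi z = -(z * Real.log z) := by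
  unfold corePsi; split_ifs with h
  · obtain rfl : z = 1 := le_antisymm h hz
    norm_num
  · rfl

theorem corePsi₁_of_ge {z : ℝ} (hz : 1 ≤ z) : corePsi₁ z = -Real.log z - 1 := by
  unfold corePsi₁; split_ifs with h
  · obtain rfl : z = 1 := le_antisymm h hz
    norm_num
  · rfl

theorem corePsi₂_of_ge {z : ℝ} (hz : 1 ≤ z) : corePsi₂ z = -z⁻¹ := by
  unfold corePsi₂; split_ifs with h
  · obtain rfl : z = 1 := le_antisymm h hz
    norm_num
  · rfl

theorem flowB₂_of_ge {z : ℝ} (hz : 1 ≤ z) : flowB₂ z = 0 := by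
  rw [flowB₂, coreE_of_ge hz, coreE₁_of_ge hz]; simp

theorem abs_flowB₁_le {z : ℝ} (hz : 0 ≤ z) : |flowB₁ z| ≤ 1 := by
  rw [flowB₁_eq hz]
  have h1 := coreE_pos hz
  have h2 : z / coreE z ≤ 1 := (div_le_one (by linarith)).2 (le_coreE z hz)
  have h3 : 0 ≤ z / coreE z := by positivity
  rw [abs_le]; constructor <;> linarith

theorem flowB_of_ge {z : ℝ} (hz : 1 ≤ z) : flowB z = 0 := by
  unfold flowB
  rw [intervalIntegral.integral_congr (g := fun _ => (0 : ℝ))]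
  · simp
  · intro x hx
    rw [uIcc_of_le hz] at hx
    exact flowB₁_eq_zero hx.1

theorem abs_flowB_le {z : ℝ} (hz : 0 ≤ z) : |flowB z| ≤ 1 := by
  rcases le_total 1 z with h | h
  · simp [flowB_of_ge h]
  · have := intervalIntegral.norm_integral_le_of_norm_le_const (a := 1) (b := z) (f := flowB₁)
      (C := 1) (fun x hx => by
        rw [uIoc_of_ge h] at hx
        exact abs_flowB₁_le (hz.trans hx.1.le))
    rw [Real.norm_eq_abs] at this
    refine this.trans ?_
    rw [one_mul, abs_le]; constructor <;> linarith

theorem hasDerivAt_flowB₁ {z : ℝ} (hz : 0 ≤ z) : HasDerivAt flowB₁ (flowB₂ z) z := by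
  have h1 := coreE_pos hz
  have h0 : coreE z ≠ 0 := by linarith
  have hd : HasDerivAt (fun x => x / coreE x - 1) (flowB₂ z) z := by
    refine HasDerivAt.congr_deriv (((hasDerivAt_id z).div (hasDerivAt_coreE z) h0).sub_const 1) ?_
    simp [flowB₂]
  refine hd.congr_of_eventuallyEq ?_
  -- At `z = 0` the neighbourhood contains negative points; the gap between `3/8` and `1/4` covers
  -- them.
  have : ∀ᶠ x in 𝓝 z, 1 / 4 < coreE x :=
    continuous_coreE.continuousAt.eventually (lt_mem_nhds (by linarith))
  filter_upwards [this] with x hx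
  rw [flowB₁, max_eq_left hx.le]

theorem abs_flowB₂_le {z : ℝ} (hz : 0 ≤ z) : |flowB₂ z| ≤ 15 := by
  rcases le_total 1 z with h | h
  · simp [flowB₂_of_ge h]
  · have h1 := coreE_pos hz
    have h2 := coreE_le_one hz h
    have h3 := abs_le.1 (abs_coreE₁_le hz)
    have h4 : |z * coreE₁ z| ≤ 1 := by
      rw [abs_mul, abs_of_nonneg hz]
      exact mul_le_one₀ h (abs_nonneg _) (abs_coreE₁_le hz)
    have h5 := abs_le.1 h4
    rw [flowB₂, abs_div, div_le_iff₀ (by positivity), abs_of_nonneg (sq_nonneg (coreE z))]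
    rw [abs_le]; constructor <;> nlinarith

/-! ### The amplitude -/

/-- The denominator of the amplitude. -/
noncomputable def denQ (τ y : ℝ) : ℝ := y * (1 - Real.log τ) + τ * corePsi (y / τ) + farP y

/-- `∂_y denQ`. -/
noncomputable def denQ₁ (τ y : ℝ) : ℝ := 1 - Real.log τ + corePsi₁ (y / τ) + farP₁ y

/-- `∂_y² denQ`. -/
noncomputable def denQ₂ (τ y : ℝ) : ℝ := corePsi₂ (y / τ) / τ + farP₂ y

/-- The static denominator, the value of `denQ τ y` for `y ≥ τ`. -/
noncomputable def statQ (y : ℝ) : ℝ := y * (1 - Real.log y) + farP y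

theorem hasDerivAt_div_const {τ : ℝ} (y : ℝ) : HasDerivAt (fun y => y / τ) (1 / τ) y :=
  (hasDerivAt_id y).div_const τ

theorem hasDerivAt_denQ {τ : ℝ} (hτ : 0 < τ) (y : ℝ) :
    HasDerivAt (denQ τ) (denQ₁ τ y) y := by
  have hc : HasDerivAt (fun y => corePsi (y / τ)) (corePsi₁ (y / τ) * (1 / τ)) y :=
    HasDerivAt.comp (h₂ := corePsi) (h := fun y => y / τ) y (hasDerivAt_corePsi (y / τ))
      (hasDerivAt_div_const y)
  refine HasDerivAt.congr_deriv ((((hasDerivAt_id y).mul_const (1 - Real.log τ)).add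
    (hc.const_mul τ)).add (hasDerivAt_farP y)) ?_
  unfold denQ₁; field_simp

theorem hasDerivAt_denQ₁ {τ : ℝ} (y : ℝ) :
    HasDerivAt (denQ₁ τ) (denQ₂ τ y) y := by
  refine HasDerivAt.congr_deriv ((((hasDerivAt_corePsi₁ (y / τ)).comp y
    (hasDerivAt_div_const y)).const_add (1 - Real.log τ)).add (hasDerivAt_farP₁ y)) ?_
  unfold denQ₂; ring

/-- The term `y (1 - log τ)` contributes `-z`, and `τ Ψ(y/τ)` contributes `Ψ - zΨ' = E`. -/
theorem hasDerivAt_denQ_param {τ : ℝ} (hτ : 0 < τ) (y : ℝ) :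
    HasDerivAt (fun τ => denQ τ y) (coreE (y / τ) - y / τ) τ := by
  have hτ' := hτ.ne'
  have hdiv : HasDerivAt (fun τ => y / τ) (-y / τ ^ 2) τ := by
    refine HasDerivAt.congr_deriv ((hasDerivAt_const τ y).div (hasDerivAt_id τ) hτ') ?_
    simp
  refine HasDerivAt.congr_deriv (((((Real.hasDerivAt_log hτ').const_sub 1).const_mul y).add
    ((hasDerivAt_id τ).mul ((hasDerivAt_corePsi (y / τ)).comp τ hdiv))).add_const (farP y)) ?_
  rw [← corePsi_sub_mul]; simp; field_simp; ring

/-- The logarithms cancel: `y (1 - log τ) - y log (y/τ) = y (1 - log y)`. This is why `Q` carries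
the coefficient `1 - log τ`, and why the solution is stationary outside the core. -/
theorem denQ_eq_statQ {τ y : ℝ} (hτ : 0 < τ) (h : τ ≤ y) : denQ τ y = statQ y := by
  have hy : 0 < y := hτ.trans_le h
  rw [denQ, corePsi_of_ge ((one_le_div hτ).2 h), Real.log_div hy.ne' hτ.ne', statQ]
  field_simp; ring

theorem denQ₁_eq {τ y : ℝ} (hτ : 0 < τ) (h : τ ≤ y) :
    denQ₁ τ y = -Real.log y + farP₁ y := by
  have hy : 0 < y := hτ.trans_le h
  rw [denQ₁, corePsi₁_of_ge ((one_le_div hτ).2 h), Real.log_div hy.ne' hτ.ne']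
  ring

theorem denQ₂_eq {τ y : ℝ} (hτ : 0 < τ) (h : τ ≤ y) :
    denQ₂ τ y = -y⁻¹ + farP₂ y := by
  have hy : 0 < y := hτ.trans_le h
  rw [denQ₂, corePsi₂_of_ge ((one_le_div hτ).2 h)]
  field_simp

/-- Without `farP` the function `y (1 - log y)` would vanish at `y = e`. The correction keeps `Q`
positive and makes it grow like `y⁴`, so the amplitude decays at infinity. -/
theorem le_statQ {y : ℝ} (hy : 0 < y) : y * (1 + y) ^ 3 / 64 ≤ statQ y := by
  unfold statQ farP
  split_ifs with h
  · have h1 : Real.log y ≤ 0 := Real.log_nonpos hy.le h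
    have h2 : (1 + y) ^ 3 ≤ 2 ^ 3 := by gcongr; linarith
    nlinarith
  · have h1 := Real.log_le_sub_one_of_pos hy
    obtain ⟨v, rfl⟩ : ∃ v, y = 1 + v := ⟨y - 1, by ring⟩
    have hv : 0 < v := by linarith
    have : (1 + (1 + v)) ^ 3 / 64 ≤ 1 - v + v ^ 3 := by
      nlinarith [mul_nonneg hv.le (sq_nonneg (v - 2 / 3)), sq_nonneg (v - 2 / 3)]
    have h3 : (1 + (1 + v)) ^ 3 / 64 ≤ 1 - Real.log (1 + v) + (1 + v - 1) ^ 3 := by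
      have : (1 + v - 1) ^ 3 = v ^ 3 := by ring
      linarith
    nlinarith

theorem denQ_ge_of_le {τ y : ℝ} (hτ : 0 < τ) (hτ1 : τ ≤ 1) (hy : 0 ≤ y) (h : y ≤ τ) :
    3 / 8 * τ * (1 + (1 - Real.log τ) * (y / τ)) ≤ denQ τ y := by
  have h1 : Real.log τ ≤ 0 := Real.log_nonpos hτ.le hτ1
  have hz : 0 ≤ y / τ := by positivity
  have h2 := add_corePsi_ge hz ((div_le_one hτ).2 h)
  have h3 : denQ τ y = τ * (-Real.log τ * (y / τ) + (y / τ + corePsi (y / τ))) := by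
    rw [denQ, farP, if_pos (h.trans hτ1)]; field_simp; ring
  rw [h3, mul_comm (3 / 8) τ, mul_assoc]
  have h4 : 0 ≤ -Real.log τ * (y / τ) := mul_nonneg (by linarith) hz
  gcongr
  nlinarith

theorem denQ_le_of_le {τ y : ℝ} (hτ : 0 < τ) (hτ1 : τ ≤ 1) (hy : 0 ≤ y) (h : y ≤ τ) :
    denQ τ y ≤ 2 * τ * (1 - Real.log τ) := by
  have h1 : Real.log τ ≤ 0 := Real.log_nonpos hτ.le hτ1
  have hz : 0 ≤ y / τ := by positivity
  have hz1 := (div_le_one hτ).2 h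
  have h2 := add_corePsi_le hz hz1
  have h3 : denQ τ y = τ * (-Real.log τ * (y / τ) + (y / τ + corePsi (y / τ))) := by
    rw [denQ, farP, if_pos (h.trans hτ1)]; field_simp; ring
  rw [h3, mul_comm 2 τ, mul_assoc]
  have h4 : -Real.log τ * (y / τ) ≤ -Real.log τ * 1 := by gcongr; linarith
  gcongr
  nlinarith

theorem one_le_one_sub_log {τ : ℝ} (hτ : 0 < τ) (hτ1 : τ ≤ 1) : 1 ≤ 1 - Real.log τ := by
  have h1 : Real.log τ ≤ 0 := Real.log_nonpos hτ.le hτ1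
  linarith

theorem denQ_ge_add {τ y : ℝ} (hτ : 0 < τ) (hτ1 : τ ≤ 1) (hy : 0 ≤ y) :
    (y + τ) / 128 ≤ denQ τ y := by
  rcases le_total y τ with h | h
  · refine le_trans ?_ (denQ_ge_of_le hτ hτ1 hy h)
    have := one_le_one_sub_log hτ hτ1
    have : 0 ≤ (1 - Real.log τ) * (y / τ) := by positivity
    nlinarith
  · rw [denQ_eq_statQ hτ h]
    have hy0 : 0 < y := hτ.trans_le h
    refine le_trans ?_ (le_statQ hy0)
    have : 1 ≤ (1 + y) ^ 3 := one_le_pow₀ (by linarith)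
    nlinarith

theorem denQ_pos {τ y : ℝ} (hτ : 0 < τ) (hτ1 : τ ≤ 1) (hy : 0 ≤ y) : 0 < denQ τ y :=
  lt_of_lt_of_le (by positivity) (denQ_ge_add hτ hτ1 hy)

/-- Outside the core `y |∂_y Q| ≲ Q` holds with no logarithm. Inside, `|∂_y Q| ≤ 2 (1 - log τ)`
while only `Q ≥ 3τ/8` is available near `y = 0`; this is the source of the logarithmic losses in the
potential. -/
theorem abs_denQ₁_le {τ y : ℝ} (hτ : 0 < τ) (hτ1 : τ ≤ 1) (hy : 0 ≤ y) :
    |denQ₁ τ y| * (y + τ) ≤ 20 * (1 - Real.log τ) * denQ τ y := by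
  have hL := one_le_one_sub_log hτ hτ1
  have hQ := denQ_pos hτ hτ1 hy
  rcases le_total y τ with h | h
  · have hz : 0 ≤ y / τ := by positivity
    have h1 := abs_corePsi₁_le hz ((div_le_one hτ).2 h)
    have h2 : |denQ₁ τ y| ≤ 2 * (1 - Real.log τ) := by
      rw [denQ₁, farP₁, if_pos (h.trans hτ1)]
      rw [abs_le] at h1 ⊢; constructor <;> linarith
    have h3 := denQ_ge_of_le hτ hτ1 hy h
    have h4 : 0 ≤ (1 - Real.log τ) * (y / τ) := by positivity
    have h5 : 3 / 8 * τ ≤ denQ τ y := le_trans (by nlinarith) h3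
    calc |denQ₁ τ y| * (y + τ) ≤ 2 * (1 - Real.log τ) * (2 * τ) := by
          gcongr; linarith
      _ ≤ 20 * (1 - Real.log τ) * (3 / 8 * τ) := by nlinarith [mul_pos (by linarith : 0 < 1 - Real.log τ) hτ]
      _ ≤ _ := by gcongr
  · have hy0 : 0 < y := hτ.trans_le h
    have key : |denQ₁ τ y| * y ≤ 10 * denQ τ y := by
      rw [denQ_eq_statQ hτ h, denQ₁_eq hτ h, statQ, farP, farP₁]
      split_ifs with h1
      · have := Real.log_nonpos hy0.le h1
        rw [add_zero, abs_of_nonneg (by linarith)]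
        nlinarith
      · have h2 := Real.log_le_sub_one_of_pos hy0
        have h3 : 0 ≤ Real.log y := Real.log_nonneg (by linarith)
        obtain ⟨v, rfl⟩ : ∃ v, y = 1 + v := ⟨y - 1, by ring⟩
        have hv : 0 < v := by linarith
        have h4 : |-Real.log (1 + v) + (1 + v - 1) ^ 2 * (4 * (1 + v) - 1)|
            ≤ 10 * (1 - Real.log (1 + v) + v ^ 3) := by
          have e : (1 + v - 1) ^ 2 * (4 * (1 + v) - 1) = v ^ 2 * (3 + 4 * v) := by ring
          have : 0 ≤ v ^ 2 * (3 + 4 * v) := by positivity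
          rw [e, abs_le]; constructor
          · nlinarith [mul_nonneg hv.le (sq_nonneg (v - 1)), sq_nonneg (v - 1 / 2)]
          · nlinarith [mul_nonneg hv.le (sq_nonneg (v - 1)), sq_nonneg (v - 1)]
        have h5 : 10 * ((1 + v) * (1 - Real.log (1 + v)) + (1 + v) * (1 + v - 1) ^ 3) =
            10 * (1 - Real.log (1 + v) + v ^ 3) * (1 + v) := by ring
        rw [h5]; gcongr
    calc |denQ₁ τ y| * (y + τ) ≤ |denQ₁ τ y| * (2 * y) := by gcongr; linarith
      _ ≤ 20 * 1 * denQ τ y := by linarith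
      _ ≤ _ := by gcongr

theorem abs_denQ₂_le {τ y : ℝ} (hτ : 0 < τ) (hτ1 : τ ≤ 1) (hy : 0 ≤ y) :
    |denQ₂ τ y| * (y + τ) ^ 2 ≤ 200 * denQ τ y := by
  have hL := one_le_one_sub_log hτ hτ1
  have hQ := denQ_pos hτ hτ1 hy
  rcases le_total y τ with h | h
  · have hz : 0 ≤ y / τ := by positivity
    have h1 := abs_corePsi₂_le hz ((div_le_one hτ).2 h)
    have h2 : |denQ₂ τ y| ≤ 3 / 2 / τ := by
      rw [denQ₂, farP₂, if_pos (h.trans hτ1), add_zero, abs_div, abs_of_pos hτ]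
      gcongr
    have h3 := denQ_ge_of_le hτ hτ1 hy h
    have h4 : 0 ≤ (1 - Real.log τ) * (y / τ) := by positivity
    have h5 : 3 / 8 * τ ≤ denQ τ y := le_trans (by nlinarith) h3
    calc |denQ₂ τ y| * (y + τ) ^ 2 ≤ 3 / 2 / τ * (2 * τ) ^ 2 := by
          gcongr; linarith
      _ = 6 * τ := by field_simp; norm_num
      _ ≤ _ := by linarith
  · have hy0 : 0 < y := hτ.trans_le h
    -- For `y > 1` put `y = 1 + v`; a factor `1 + v` cancels and `log (1 + v) ≤ v` leaves a
    -- polynomial inequality in `v ≥ 0`.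
    have key : |denQ₂ τ y| * y ^ 2 ≤ 50 * denQ τ y := by
      rw [denQ_eq_statQ hτ h, denQ₂_eq hτ h, statQ, farP, farP₂]
      split_ifs with h1
      · have := Real.log_nonpos hy0.le h1
        rw [add_zero, abs_neg, abs_of_nonneg (by positivity), sq, ← mul_assoc,
          inv_mul_cancel₀ hy0.ne']
        nlinarith
      · have h2 := Real.log_le_sub_one_of_pos hy0
        have h3 : 0 ≤ Real.log y := Real.log_nonneg (by linarith)
        obtain ⟨v, rfl⟩ : ∃ v, y = 1 + v := ⟨y - 1, by ring⟩
        have hv : 0 < v := by linarith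
        have h4 : |-(1 + v)⁻¹ + (1 + v - 1) * (12 * (1 + v) - 6)| * (1 + v)
            ≤ 50 * (1 - Real.log (1 + v) + v ^ 3) := by
          rw [← abs_of_pos hy0, ← abs_mul, abs_of_pos hy0, add_mul, neg_mul,
            inv_mul_cancel₀ hy0.ne']
          have e : -1 + (1 + v - 1) * (12 * (1 + v) - 6) * (1 + v) =
            -1 + 6 * v + 18 * v ^ 2 + 12 * v ^ 3 := by ring
          rw [e, abs_le]; constructor
          · nlinarith [mul_nonneg hv.le (sq_nonneg (v - 1)), sq_nonneg (v - 1 / 2)]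
          · nlinarith [mul_nonneg hv.le (sq_nonneg (v - 1)), sq_nonneg (v - 1)]
        have h5 : 50 * ((1 + v) * (1 - Real.log (1 + v)) + (1 + v) * (1 + v - 1) ^ 3) =
            50 * (1 - Real.log (1 + v) + v ^ 3) * (1 + v) := by ring
        rw [h5, sq, ← mul_assoc]; gcongr
    calc |denQ₂ τ y| * (y + τ) ^ 2 ≤ |denQ₂ τ y| * (2 * y) ^ 2 := by gcongr; linarith
      _ ≤ 200 * denQ τ y := by nlinarith

/-! ### Derivatives and bounds of the logarithmic amplitude -/

/-- The logarithm of the amplitude. -/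
noncomputable def logAmp (κ τ y : ℝ) : ℝ :=
  1 / 2 * Real.log (τ * coreE (y / τ)) - κ * Real.log (denQ τ y)

/-- `∂_y logAmp`. -/
noncomputable def logAmp₁ (κ τ y : ℝ) : ℝ :=
  coreE₁ (y / τ) / (2 * (τ * coreE (y / τ))) - κ * (denQ₁ τ y / denQ τ y)

/-- `∂_y² logAmp`. -/
noncomputable def logAmp₂ (κ τ y : ℝ) : ℝ :=
  coreE₂ (y / τ) / τ / (2 * (τ * coreE (y / τ))) -
    coreE₁ (y / τ) ^ 2 / (2 * (τ * coreE (y / τ)) ^ 2) -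
    κ * (denQ₂ τ y / denQ τ y - (denQ₁ τ y / denQ τ y) ^ 2)

/-- `∂_τ logAmp`. -/
noncomputable def logAmpParam (κ τ y : ℝ) : ℝ :=
  (coreE (y / τ) - y / τ * coreE₁ (y / τ)) / (2 * (τ * coreE (y / τ))) -
    κ * ((coreE (y / τ) - y / τ) / denQ τ y)

theorem hasDerivAt_comp_div {f : ℝ → ℝ} {f' τ y : ℝ} (h : HasDerivAt f f' (y / τ)) :
    HasDerivAt (fun y => f (y / τ)) (f' * (1 / τ)) y :=
  HasDerivAt.comp (h₂ := f) (h := fun y => y / τ) y h (hasDerivAt_div_const y)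

theorem hasDerivAt_comp_div_param {f : ℝ → ℝ} {f' τ y : ℝ} (hτ : 0 < τ)
    (h : HasDerivAt f f' (y / τ)) :
    HasDerivAt (fun τ => f (y / τ)) (f' * (-y / τ ^ 2)) τ := by
  have hdiv : HasDerivAt (fun τ => y / τ) (-y / τ ^ 2) τ := by
    refine HasDerivAt.congr_deriv ((hasDerivAt_const τ y).div (hasDerivAt_id τ) hτ.ne') ?_
    simp
  exact HasDerivAt.comp (h₂ := f) (h := fun τ => y / τ) τ h hdiv

section
variable {κ τ y : ℝ}

/-- Average the two lower bounds `τE ≥ 3τ/8` and `τE ≥ y`. -/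
theorem coreE_scaled_ge (hτ : 0 < τ) (hy : 0 ≤ y) :
    3 / 16 * (y + τ) ≤ τ * coreE (y / τ) := by
  have hz : 0 ≤ y / τ := by positivity
  have h1 := coreE_pos hz
  have h2 := le_coreE _ hz
  have h3 : y ≤ τ * coreE (y / τ) := by
    calc y = τ * (y / τ) := by field_simp
      _ ≤ _ := by gcongr
  have h4 : τ * (3 / 8) ≤ τ * coreE (y / τ) := by gcongr
  linarith

theorem hasDerivAt_logAmp (hτ : 0 < τ) (hτ1 : τ ≤ 1) (hy : 0 ≤ y) :
    HasDerivAt (logAmp κ τ) (logAmp₁ κ τ y) y := by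
  have hE := coreE_scaled_ge hτ hy
  have hE0 : τ * coreE (y / τ) ≠ 0 := by nlinarith
  have hQ := (denQ_pos hτ hτ1 hy).ne'
  refine HasDerivAt.congr_deriv (((((hasDerivAt_comp_div (hasDerivAt_coreE (y / τ))).const_mul τ).log
    hE0).const_mul (1 / 2)).sub (((hasDerivAt_denQ hτ y).log hQ).const_mul κ)) ?_
  have : coreE (y / τ) ≠ 0 := right_ne_zero_of_mul hE0
  unfold logAmp₁; field_simp

theorem hasDerivAt_logAmp₁ (hτ : 0 < τ) (hτ1 : τ ≤ 1) (hy : 0 ≤ y) :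
    HasDerivAt (logAmp₁ κ τ) (logAmp₂ κ τ y) y := by
  have hE := coreE_scaled_ge hτ hy
  have hE0 : τ * coreE (y / τ) ≠ 0 := by nlinarith
  have hE2 : 2 * (τ * coreE (y / τ)) ≠ 0 := by simpa using hE0
  have hQ := (denQ_pos hτ hτ1 hy).ne'
  refine HasDerivAt.congr_deriv (((hasDerivAt_comp_div (hasDerivAt_coreE₁ (y / τ))).div
    (((hasDerivAt_comp_div (hasDerivAt_coreE (y / τ))).const_mul τ).const_mul 2) hE2).sub
    (((hasDerivAt_denQ₁ y).div (hasDerivAt_denQ hτ y) hQ).const_mul κ)) ?_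
  have : coreE (y / τ) ≠ 0 := right_ne_zero_of_mul hE0
  unfold logAmp₂; field_simp

theorem hasDerivAt_logAmp_param (hτ : 0 < τ) (hτ1 : τ ≤ 1) (hy : 0 ≤ y) :
    HasDerivAt (fun τ => logAmp κ τ y) (logAmpParam κ τ y) τ := by
  have hE := coreE_scaled_ge hτ hy
  have hE0 : τ * coreE (y / τ) ≠ 0 := by nlinarith
  have hQ := (denQ_pos hτ hτ1 hy).ne'
  refine HasDerivAt.congr_deriv (((((hasDerivAt_id τ).mul (hasDerivAt_comp_div_param hτ
    (hasDerivAt_coreE (y / τ)))).log hE0).const_mul (1 / 2)).sub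
    (((hasDerivAt_denQ_param hτ y).log hQ).const_mul κ)) ?_
  have : coreE (y / τ) ≠ 0 := right_ne_zero_of_mul hE0
  simp only [logAmpParam, id, Pi.mul_apply]; field_simp; ring

theorem abs_logAmp₁_le (hκ : 0 ≤ κ) (hτ : 0 < τ) (hτ1 : τ ≤ 1) (hy : 0 ≤ y) :
    |logAmp₁ κ τ y| ≤ (3 + 20 * κ) * (1 - Real.log τ) / (y + τ) := by
  have hE := coreE_scaled_ge hτ hy
  have hS : 0 < y + τ := by linarith
  have hL := one_le_one_sub_log hτ hτ1
  have hQ := denQ_pos hτ hτ1 hy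
  have h1 : |coreE₁ (y / τ) / (2 * (τ * coreE (y / τ)))| ≤ 3 / (y + τ) := by
    rw [abs_div, abs_of_pos (by nlinarith : 0 < 2 * (τ * coreE (y / τ))), div_le_div_iff₀ (by nlinarith) hS]
    have := abs_coreE₁_le (show 0 ≤ y / τ by positivity)
    nlinarith
  have h2 : |denQ₁ τ y / denQ τ y| ≤ 20 * (1 - Real.log τ) / (y + τ) := by
    rw [abs_div, abs_of_pos hQ, div_le_div_iff₀ hQ hS]
    exact abs_denQ₁_le hτ hτ1 hy
  calc |logAmp₁ κ τ y| ≤ |coreE₁ (y / τ) / (2 * (τ * coreE (y / τ)))| +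
        |κ * (denQ₁ τ y / denQ τ y)| := abs_sub _ _
    _ ≤ 3 / (y + τ) + κ * (20 * (1 - Real.log τ) / (y + τ)) := by
        rw [abs_mul, abs_of_nonneg hκ]; gcongr
    _ ≤ (3 * (1 - Real.log τ)) / (y + τ) + κ * (20 * (1 - Real.log τ) / (y + τ)) := by
        gcongr; linarith
    _ = _ := by ring

theorem one_div_le_of_le (hτ : 0 < τ) (hy : 0 ≤ y) (h : y ≤ τ) : 1 / τ ≤ 2 / (y + τ) := by
  rw [div_le_div_iff₀ hτ (by linarith)]; linarith

theorem abs_logAmp₂_le (hκ : 0 ≤ κ) (hτ : 0 < τ) (hτ1 : τ ≤ 1) (hy : 0 ≤ y) :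
    |logAmp₂ κ τ y| ≤ (30 + 600 * κ) * (1 - Real.log τ) ^ 2 / (y + τ) ^ 2 := by
  have hE := coreE_scaled_ge hτ hy
  have hz : 0 ≤ y / τ := by positivity
  have hS : 0 < y + τ := by linarith
  have hL := one_le_one_sub_log hτ hτ1
  have hQ := denQ_pos hτ hτ1 hy
  have hEp : 0 < τ * coreE (y / τ) := by nlinarith
  have h1 : |coreE₂ (y / τ) / τ / (2 * (τ * coreE (y / τ)))| ≤ 10 / (y + τ) ^ 2 := by
    have h : |coreE₂ (y / τ) / τ| ≤ 3 / (y + τ) := by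
      rcases le_total y τ with h | h
      · rw [abs_div, abs_of_pos hτ]
        have := abs_coreE₂_le hz
        calc |coreE₂ (y / τ)| / τ ≤ 3 / 2 / τ := by gcongr
          _ = 3 / 2 * (1 / τ) := by ring
          _ ≤ 3 / 2 * (2 / (y + τ)) := mul_le_mul_of_nonneg_left (one_div_le_of_le hτ hy h) (by norm_num)
          _ = _ := by ring
      · rw [coreE₂_of_ge ((one_le_div hτ).2 h)]; simp; positivity
    rw [abs_div, abs_of_pos (by linarith : 0 < 2 * (τ * coreE (y / τ)))]
    calc |coreE₂ (y / τ) / τ| / (2 * (τ * coreE (y / τ))) ≤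
        3 / (y + τ) / (2 * (3 / 16 * (y + τ))) := by gcongr
      _ = 8 / (y + τ) ^ 2 := by field_simp; norm_num
      _ ≤ _ := by gcongr; norm_num
  have h2 : |coreE₁ (y / τ) ^ 2 / (2 * (τ * coreE (y / τ)) ^ 2)| ≤ 20 / (y + τ) ^ 2 := by
    rw [abs_div, abs_of_pos (by positivity : 0 < 2 * (τ * coreE (y / τ)) ^ 2), abs_pow]
    calc |coreE₁ (y / τ)| ^ 2 / (2 * (τ * coreE (y / τ)) ^ 2) ≤
        1 ^ 2 / (2 * (3 / 16 * (y + τ)) ^ 2) := by gcongr; exact abs_coreE₁_le hz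
      _ = 128 / 9 / (y + τ) ^ 2 := by field_simp; norm_num
      _ ≤ _ := by gcongr; norm_num
  have h3 : |denQ₁ τ y / denQ τ y| ≤ 20 * (1 - Real.log τ) / (y + τ) := by
    rw [abs_div, abs_of_pos hQ, div_le_div_iff₀ hQ hS]
    exact abs_denQ₁_le hτ hτ1 hy
  have h4 : |denQ₂ τ y / denQ τ y| ≤ 200 / (y + τ) ^ 2 := by
    rw [abs_div, abs_of_pos hQ, div_le_div_iff₀ hQ (by positivity)]
    exact abs_denQ₂_le hτ hτ1 hy
  have h5 : |denQ₂ τ y / denQ τ y - (denQ₁ τ y / denQ τ y) ^ 2| ≤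
      200 / (y + τ) ^ 2 + (20 * (1 - Real.log τ) / (y + τ)) ^ 2 := by
    refine (abs_sub _ _).trans ?_
    rw [abs_pow]; gcongr
  have hL2 : 1 ≤ (1 - Real.log τ) ^ 2 := one_le_pow₀ hL
  calc |logAmp₂ κ τ y| ≤ 10 / (y + τ) ^ 2 + 20 / (y + τ) ^ 2 +
        κ * (200 / (y + τ) ^ 2 + (20 * (1 - Real.log τ) / (y + τ)) ^ 2) := by
        refine (abs_sub _ _).trans (add_le_add ((abs_sub _ _).trans (add_le_add h1 h2)) ?_)
        rw [abs_mul, abs_of_nonneg hκ]; gcongr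
    _ = (30 * 1 + κ * (200 * 1 + 400 * (1 - Real.log τ) ^ 2)) / (y + τ) ^ 2 := by
        field_simp; ring
    _ ≤ (30 * (1 - Real.log τ) ^ 2 + κ * (200 * (1 - Real.log τ) ^ 2 +
          400 * (1 - Real.log τ) ^ 2)) / (y + τ) ^ 2 := by gcongr
    _ = _ := by ring

end

/-! ### The phase -/

/-- The phase; `a` stands for the time derivative of `τ`. -/
noncomputable def phase (τ a y : ℝ) : ℝ := a / 8 * flowB (y / τ)

/-- `∂_y phase`. -/
noncomputable def phase₁ (τ a y : ℝ) : ℝ := a / (8 * τ) * flowB₁ (y / τ)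

/-- `∂_y² phase`. -/
noncomputable def phase₂ (τ a y : ℝ) : ℝ := a / (8 * τ ^ 2) * flowB₂ (y / τ)

/-- The time derivative of the phase, when `a`, `a'` are the first two time derivatives of `τ`. -/
noncomputable def phaseTime (τ a a' y : ℝ) : ℝ :=
  a' / 8 * flowB (y / τ) - a ^ 2 * y / (8 * τ ^ 2) * flowB₁ (y / τ)

/-- The potential, as a function of `y = |x|²`. -/
noncomputable def radV (n κ τ a a' y : ℝ) : ℝ :=
  4 * y * (logAmp₂ κ τ y + logAmp₁ κ τ y ^ 2 - phase₁ τ a y ^ 2) + 2 * n * logAmp₁ κ τ y +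
    phaseTime τ a a' y

section
variable {n κ τ a a' y : ℝ}

theorem hasDerivAt_phase (hτ : 0 < τ) : HasDerivAt (phase τ a) (phase₁ τ a y) y := by
  refine HasDerivAt.congr_deriv
    ((hasDerivAt_comp_div (hasDerivAt_flowB (y / τ))).const_mul (a / 8)) ?_
  unfold phase₁; field_simp

theorem hasDerivAt_phase₁ (hτ : 0 < τ) (hy : 0 ≤ y) :
    HasDerivAt (phase₁ τ a) (phase₂ τ a y) y := by
  refine HasDerivAt.congr_deriv ((hasDerivAt_comp_div (hasDerivAt_flowB₁
    (show 0 ≤ y / τ by positivity))).const_mul (a / (8 * τ))) ?_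
  unfold phase₂; field_simp

theorem hasDerivAt_phase_time {τ a : ℝ → ℝ} {a' t : ℝ} (hτ : 0 < τ t)
    (h1 : HasDerivAt τ (a t) t) (h2 : HasDerivAt a a' t) :
    HasDerivAt (fun t => phase (τ t) (a t) y) (phaseTime (τ t) (a t) a' y) t := by
  have hc : HasDerivAt (fun t => flowB (y / τ t)) (flowB₁ (y / τ t) * (-y / τ t ^ 2) * a t) t :=
    HasDerivAt.comp (h₂ := fun τ => flowB (y / τ)) (h := τ) t
      (hasDerivAt_comp_div_param hτ (hasDerivAt_flowB (y / τ t))) h1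
  refine HasDerivAt.congr_deriv ((h2.div_const 8).mul hc) ?_
  unfold phaseTime; field_simp; ring

theorem hasDerivAt_logAmp_time {τ : ℝ → ℝ} {a t : ℝ} (hτ : 0 < τ t) (hτ1 : τ t ≤ 1)
    (hy : 0 ≤ y) (h1 : HasDerivAt τ a t) :
    HasDerivAt (fun t => logAmp κ (τ t) y) (logAmpParam κ (τ t) y * a) t :=
  HasDerivAt.comp (h₂ := fun τ => logAmp κ τ y) (h := τ) t (hasDerivAt_logAmp_param hτ hτ1 hy) h1

/-- Conservation of mass along the flow generated by the phase. -/
theorem continuity_equation (hκ : κ = (n + 2) / 4) (hτ : 0 < τ) (hτ1 : τ ≤ 1) (hy : 0 ≤ y) :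
    logAmpParam κ τ y * a =
      4 * y * (phase₂ τ a y + 2 * logAmp₁ κ τ y * phase₁ τ a y) + 2 * n * phase₁ τ a y := by
  rcases le_total y τ with h | h
  · have hz : 0 ≤ y / τ := by positivity
    have hE0 : coreE (y / τ) ≠ 0 := by have := coreE_pos hz; linarith
    have hQ := (denQ_pos hτ hτ1 hy).ne'
    -- The ODE for `Ψ`; `y ≤ τ ≤ 1` switches off `farP`.
    have hrel : y * denQ₁ τ y = denQ τ y - τ * coreE (y / τ) := by
      rw [← corePsi_sub_mul, denQ, denQ₁, farP, farP₁, if_pos (h.trans hτ1), if_pos (h.trans hτ1)]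
      field_simp; ring
    obtain ⟨z, hzy⟩ : ∃ z, z = y / τ := ⟨_, rfl⟩
    have hyz : y = τ * z := by rw [hzy]; field_simp
    unfold logAmpParam logAmp₁ phase₁ phase₂ flowB₂
    rw [flowB₁_eq hz]
    rw [← hzy] at hE0 hrel ⊢
    generalize denQ τ y = Q at *
    generalize denQ₁ τ y = Q₁ at *
    generalize coreE z = E at *
    generalize coreE₁ z = E₁ at *
    subst hκ
    -- The right-hand side contains `Q₁` only through `z Q₁`. Once this is eliminated, the claim is
    -- a rational identity in `z`, `E`, `E₁`, `Q` and `τ`, and it holds for `κ = (n + 2)/4`.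
    have hQ₁ : z * Q₁ = Q / τ - E := by
      field_simp; rw [hyz] at hrel; linarith
    rw [hyz]
    have e1 : 4 * (τ * z) * (a / (8 * τ ^ 2) * ((E - z * E₁) / E ^ 2) +
        2 * (E₁ / (2 * (τ * E)) - (n + 2) / 4 * (Q₁ / Q)) * (a / (8 * τ) * (z / E - 1))) =
        4 * (τ * z) * (a / (8 * τ ^ 2) * ((E - z * E₁) / E ^ 2) +
        2 * (E₁ / (2 * (τ * E))) * (a / (8 * τ) * (z / E - 1))) -
        2 * τ * (n + 2) / Q * (a / (8 * τ) * (z / E - 1)) * (z * Q₁) := by ring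
    rw [e1, hQ₁]
    field_simp
    ring
  -- Outside the core nothing moves: `E - z`, `E - z E'`, `B'` and `B''` all vanish.
  · have h1 := (one_le_div hτ).2 h
    rw [phase₁, phase₂, flowB₁_eq_zero h1, flowB₂_of_ge h1, logAmpParam, coreE_of_ge h1,
      coreE₁_of_ge h1]
    simp

theorem abs_phase₁_le (hτ : 0 < τ) (hy : 0 ≤ y) (ha : |a| ≤ 2) :
    |phase₁ τ a y| ≤ 1 / (y + τ) := by
  rcases le_total y τ with h | h
  · have := abs_flowB₁_le (show 0 ≤ y / τ by positivity)
    rw [phase₁, abs_mul, abs_div, abs_of_pos (by positivity : 0 < 8 * τ)]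
    calc |a| / (8 * τ) * |flowB₁ (y / τ)| ≤ 2 / (8 * τ) * 1 := by gcongr
      _ = 1 / 4 * (1 / τ) := by ring
      _ ≤ 1 / 4 * (2 / (y + τ)) := mul_le_mul_of_nonneg_left (one_div_le_of_le hτ hy h) (by norm_num)
      _ = 1 / 2 / (y + τ) := by ring
      _ ≤ _ := by gcongr; norm_num
  · rw [phase₁, flowB₁_eq_zero ((one_le_div hτ).2 h)]; simp; positivity

theorem abs_phase₂_le (hτ : 0 < τ) (hy : 0 ≤ y) (ha : |a| ≤ 2) :
    |phase₂ τ a y| ≤ 16 / (y + τ) ^ 2 := by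
  rcases le_total y τ with h | h
  · have := abs_flowB₂_le (show 0 ≤ y / τ by positivity)
    rw [phase₂, abs_mul, abs_div, abs_of_pos (by positivity : 0 < 8 * τ ^ 2)]
    calc |a| / (8 * τ ^ 2) * |flowB₂ (y / τ)| ≤ 2 / (8 * τ ^ 2) * 15 := by gcongr
      _ = 15 / 4 * (1 / τ) ^ 2 := by field_simp; norm_num
      _ ≤ 15 / 4 * (2 / (y + τ)) ^ 2 :=
          mul_le_mul_of_nonneg_left (pow_le_pow_left₀ (by positivity) (one_div_le_of_le hτ hy h) 2)
            (by norm_num)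
      _ = 15 / (y + τ) ^ 2 := by rw [div_pow]; ring
      _ ≤ _ := by gcongr; norm_num
  · rw [phase₂, flowB₂_of_ge ((one_le_div hτ).2 h)]; simp; positivity

/-- The bound on `|a'| τ` lets the acceleration of the scale be counted as `1/τ`, the same size as
the transport term; both live in `y ≤ τ`, where `1/τ ≤ 2/(y + τ)`. -/
theorem abs_phaseTime_le (hτ : 0 < τ) (hy : 0 ≤ y) (ha : |a| ≤ 2)
    (ha' : |a'| * τ ≤ 1) : |phaseTime τ a a' y| ≤ 2 / (y + τ) := by
  rcases le_total y τ with h | h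
  · have h1 := abs_flowB₁_le (show 0 ≤ y / τ by positivity)
    have h2 := abs_flowB_le (show 0 ≤ y / τ by positivity)
    have h3 : |a'| ≤ 1 / τ := (le_div_iff₀ hτ).2 ha'
    calc |phaseTime τ a a' y| ≤ |a' / 8 * flowB (y / τ)| +
          |a ^ 2 * y / (8 * τ ^ 2) * flowB₁ (y / τ)| := abs_sub _ _
      _ = |a'| / 8 * |flowB (y / τ)| + |a| ^ 2 * y / (8 * τ ^ 2) * |flowB₁ (y / τ)| := by
          rw [abs_mul, abs_mul, abs_div, abs_div, abs_mul, abs_pow, abs_of_nonneg hy,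
            abs_of_pos (by positivity : 0 < 8 * τ ^ 2)]
          norm_num
      _ ≤ 1 / τ / 8 * 1 + 2 ^ 2 * τ / (8 * τ ^ 2) * 1 := by gcongr
      _ = 5 / 8 * (1 / τ) := by field_simp; norm_num
      _ ≤ 5 / 8 * (2 / (y + τ)) := mul_le_mul_of_nonneg_left (one_div_le_of_le hτ hy h) (by norm_num)
      _ = 10 / 8 / (y + τ) := by ring
      _ ≤ _ := by gcongr; norm_num
  · have h1 := (one_le_div hτ).2 h
    rw [phaseTime, flowB₁_eq_zero h1, flowB_of_ge h1]; simp; positivity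

/-- Each `y`-derivative of the logarithmic amplitude costs `(1 - log τ)/(y + τ)` and the phase costs
no logarithm; the factor `4y` restores one power of `y + τ`. -/
theorem abs_radV_le (hn : 0 ≤ n) (hκ : 0 ≤ κ) (hτ : 0 < τ) (hτ1 : τ ≤ 1) (hy : 0 ≤ y)
    (ha : |a| ≤ 2) (ha' : |a'| * τ ≤ 1) :
    |radV n κ τ a a' y| ≤ (4 * ((30 + 600 * κ) + (3 + 20 * κ) ^ 2 + 1) + 2 * n * (3 + 20 * κ) + 2) *
      (1 - Real.log τ) ^ 2 / (y + τ) := by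
  have hS : 0 < y + τ := by linarith
  have hL := one_le_one_sub_log hτ hτ1
  have hLL : 1 - Real.log τ ≤ (1 - Real.log τ) ^ 2 := by nlinarith
  have hL2 : 1 ≤ (1 - Real.log τ) ^ 2 := one_le_pow₀ hL
  have h1 := abs_logAmp₁_le hκ hτ hτ1 hy
  have h2 := abs_logAmp₂_le hκ hτ hτ1 hy
  have h3 := abs_phase₁_le hτ hy ha
  have h4 := abs_phaseTime_le hτ hy ha ha'
  generalize 1 - Real.log τ = L at *
  have h5 : |logAmp₂ κ τ y + logAmp₁ κ τ y ^ 2 - phase₁ τ a y ^ 2| ≤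
      (30 + 600 * κ) * L ^ 2 / (y + τ) ^ 2 + ((3 + 20 * κ) * L / (y + τ)) ^ 2 +
        (1 / (y + τ)) ^ 2 := by
    refine (abs_sub _ _).trans (add_le_add ((abs_add_le _ _).trans (add_le_add h2 ?_)) ?_)
    · rw [abs_pow]; gcongr
    · rw [abs_pow]; gcongr
  calc |radV n κ τ a a' y| ≤ 4 * (y + τ) * ((30 + 600 * κ) * L ^ 2 / (y + τ) ^ 2 +
        ((3 + 20 * κ) * L / (y + τ)) ^ 2 + (1 / (y + τ)) ^ 2) +
        2 * n * ((3 + 20 * κ) * L / (y + τ)) + 2 / (y + τ) := by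
        refine (abs_add_le _ _).trans (add_le_add ((abs_add_le _ _).trans (add_le_add ?_ ?_)) h4)
        · rw [abs_mul, abs_of_nonneg (by positivity : 0 ≤ 4 * y)]; gcongr; linarith
        · rw [abs_mul, abs_of_nonneg (by positivity : 0 ≤ 2 * n)]; gcongr
    _ = (4 * ((30 + 600 * κ) * L ^ 2 + (3 + 20 * κ) ^ 2 * L ^ 2 + 1) +
          2 * n * ((3 + 20 * κ) * L) + 2 * 1) / (y + τ) := by field_simp
    _ ≤ (4 * ((30 + 600 * κ) * L ^ 2 + (3 + 20 * κ) ^ 2 * L ^ 2 + L ^ 2) +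
          2 * n * ((3 + 20 * κ) * L ^ 2) + 2 * L ^ 2) / (y + τ) := by gcongr
    _ = _ := by ring

end

/-! ### The time scale -/

/-- The square `τ` of the concentration scale at time `t`. -/
noncomputable def scale (t : ℝ) : ℝ := (1 - t) ^ (5 / 4 : ℝ)

/-- First time derivative of `scale`. -/
noncomputable def scale₁ (t : ℝ) : ℝ := -(5 / 4 * (1 - t) ^ (1 / 4 : ℝ))

/-- Second time derivative of `scale`. -/
noncomputable def scale₂ (t : ℝ) : ℝ := 5 / 16 * (1 - t) ^ (-(3 / 4) : ℝ)

section
variable {t : ℝ}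

theorem scale_pos (h : t < 1) : 0 < scale t := Real.rpow_pos_of_pos (by linarith) _

theorem scale_le_one (h0 : 0 ≤ t) (h : t < 1) : scale t ≤ 1 :=
  Real.rpow_le_one (by linarith) (by linarith) (by norm_num)

theorem scale_anti {t' : ℝ} (h : t ≤ t') (h' : t' < 1) : scale t' ≤ scale t :=
  Real.rpow_le_rpow (by linarith) (by linarith) (by norm_num)

theorem hasDerivAt_scale (h : t < 1) : HasDerivAt scale (scale₁ t) t := by
  refine HasDerivAt.congr_deriv (((hasDerivAt_id t).const_sub 1).rpow_const (p := 5 / 4)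
    (Or.inl (by simp; linarith))) ?_
  simp only [scale₁, id]; norm_num

theorem hasDerivAt_scale₁ (h : t < 1) : HasDerivAt scale₁ (scale₂ t) t := by
  refine HasDerivAt.congr_deriv ((((hasDerivAt_id t).const_sub 1).rpow_const (p := 1 / 4)
    (Or.inl (by simp; linarith))).const_mul (5 / 4)).neg ?_
  simp only [scale₂, id]; norm_num; ring

theorem abs_scale₁_le (h0 : 0 ≤ t) (h : t < 1) : |scale₁ t| ≤ 2 := by
  have h1 : (1 - t) ^ (1 / 4 : ℝ) ≤ 1 :=
    Real.rpow_le_one (by linarith) (by linarith) (by norm_num)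
  have h2 : 0 ≤ (1 - t) ^ (1 / 4 : ℝ) := Real.rpow_nonneg (by linarith) _
  rw [scale₁, abs_neg, abs_of_nonneg (by positivity)]; linarith

/-- The product is `(5/16) (1 - t)^(1/2)`; it stays bounded because the exponent of the scale is at
least `1`. -/
theorem abs_scale₂_mul_le (h0 : 0 ≤ t) (h : t < 1) : |scale₂ t| * scale t ≤ 1 := by
  have h1 : 0 < 1 - t := by linarith
  rw [scale₂, scale, abs_of_nonneg (by positivity), mul_assoc, ← Real.rpow_add h1]
  have := Real.rpow_le_one h1.le (by linarith) (show (0 : ℝ) ≤ -(3 / 4) + 5 / 4 by norm_num)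
  linarith

end

theorem continuous_scale : Continuous scale := by
  unfold scale
  exact (continuous_const.sub continuous_id).rpow_const fun _ => Or.inr (by norm_num)

/-! ### Bounds for the amplitude -/

section
variable {κ τ y : ℝ}

theorem exp_logAmp_eq (hτ : 0 < τ) (hτ1 : τ ≤ 1) (hy : 0 ≤ y) :
    Real.exp (logAmp κ τ y) = (τ * coreE (y / τ)) ^ (1 / 2 : ℝ) * denQ τ y ^ (-κ) := by
  have hE := coreE_scaled_ge hτ hy
  rw [Real.rpow_def_of_pos (by nlinarith), Real.rpow_def_of_pos (denQ_pos hτ hτ1 hy), ← Real.exp_add,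
    logAmp]
  congr 1; ring

theorem statQ_pos (hy : 0 < y) : 0 < statQ y := lt_of_lt_of_le (by positivity) (le_statQ hy)

/-- The logarithm of the static amplitude. -/
noncomputable def logStat (κ y : ℝ) : ℝ := 1 / 2 * Real.log y - κ * Real.log (statQ y)

theorem logAmp_eq_logStat (hτ : 0 < τ) (h : τ ≤ y) : logAmp κ τ y = logStat κ y := by
  rw [logAmp, logStat, denQ_eq_statQ hτ h, coreE_of_ge ((one_le_div hτ).2 h)]
  congr 3; field_simp

theorem exp_logStat_le {m : ℝ} (hκ : 0 ≤ κ) (hm : m = κ - 1 / 2) (hy : 0 < y) :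
    Real.exp (logStat κ y) ≤ 64 ^ κ * (y ^ (-m) * (1 + y) ^ (-(3 * κ))) := by
  have h1 : Real.exp (logStat κ y) = y ^ (1 / 2 : ℝ) * statQ y ^ (-κ) := by
    rw [Real.rpow_def_of_pos hy, Real.rpow_def_of_pos (statQ_pos hy), ← Real.exp_add, logStat]
    congr 1; ring
  have h2 : statQ y ^ (-κ) ≤ (y * (1 + y) ^ 3 / 64) ^ (-κ) :=
    Real.rpow_le_rpow_of_nonpos (by positivity) (le_statQ hy) (by linarith)
  have h3 : (y * (1 + y) ^ 3 / 64) ^ (-κ) = 64 ^ κ * (y ^ (-κ) * (1 + y) ^ (-(3 * κ))) := by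
    rw [Real.div_rpow (by positivity) (by norm_num), Real.mul_rpow hy.le (by positivity),
      ← Real.rpow_natCast, ← Real.rpow_mul (by positivity), Real.rpow_neg (by norm_num : (0:ℝ) ≤ 64)]
    simp only [div_inv_eq_mul]
    push_cast
    rw [mul_neg]; ring
  rw [h1]
  calc y ^ (1 / 2 : ℝ) * statQ y ^ (-κ) ≤
      y ^ (1 / 2 : ℝ) * (64 ^ κ * (y ^ (-κ) * (1 + y) ^ (-(3 * κ)))) := by
        rw [← h3]; gcongr
    _ = 64 ^ κ * ((y ^ (1 / 2 : ℝ) * y ^ (-κ)) * (1 + y) ^ (-(3 * κ))) := by ring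
    _ = _ := by rw [← Real.rpow_add hy, hm]; congr 3; ring_nf

/-- The factor with exponent `-κ` is kept because it alone makes the core mass tend to zero; the
scaling `τ^(-m)` by itself would only keep the mass bounded. -/
theorem exp_logAmp_le_inner {m : ℝ} (hκ : 0 ≤ κ) (hm : m = κ - 1 / 2) (hτ : 0 < τ) (hτ1 : τ ≤ 1)
    (hy : 0 ≤ y) (h : y ≤ τ) :
    Real.exp (logAmp κ τ y) ≤
      (8 / 3) ^ κ * (τ ^ (-m) * (1 + (1 - Real.log τ) * (y / τ)) ^ (-κ)) := by
  have hL := one_le_one_sub_log hτ hτ1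
  have hz : 0 ≤ y / τ := by positivity
  have hB : 0 < 1 + (1 - Real.log τ) * (y / τ) := by positivity
  have h1 : τ * coreE (y / τ) ≤ τ := by
    have := coreE_le_one hz ((div_le_one hτ).2 h); nlinarith
  have hE := coreE_scaled_ge hτ hy
  have h2 : denQ τ y ^ (-κ) ≤ (3 / 8 * τ * (1 + (1 - Real.log τ) * (y / τ))) ^ (-κ) :=
    Real.rpow_le_rpow_of_nonpos (by positivity) (denQ_ge_of_le hτ hτ1 hy h) (by linarith)
  have h4 : ((3 : ℝ) / 8) ^ (-κ) = (8 / 3) ^ κ := by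
    rw [Real.rpow_neg (by norm_num), ← Real.inv_rpow (by norm_num)]; norm_num
  rw [exp_logAmp_eq hτ hτ1 hy]
  calc (τ * coreE (y / τ)) ^ (1 / 2 : ℝ) * denQ τ y ^ (-κ) ≤
      τ ^ (1 / 2 : ℝ) * (3 / 8 * τ * (1 + (1 - Real.log τ) * (y / τ))) ^ (-κ) := by
        have h0 : 0 ≤ τ * coreE (y / τ) := le_trans (by positivity) hE
        have h3 : 0 ≤ denQ τ y ^ (-κ) := Real.rpow_nonneg (denQ_pos hτ hτ1 hy).le _
        gcongr
    _ = (8 / 3) ^ κ * ((τ ^ (1 / 2 : ℝ) * τ ^ (-κ)) *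
          (1 + (1 - Real.log τ) * (y / τ)) ^ (-κ)) := by
        rw [Real.mul_rpow (by positivity) hB.le, Real.mul_rpow (by norm_num) hτ.le, h4]; ring
    _ = _ := by rw [← Real.rpow_add hτ, hm]; congr 3; ring_nf

theorem exp_logAmp_ge_inner {m : ℝ} (hκ : 0 ≤ κ) (hm : m = κ - 1 / 2) (hτ : 0 < τ) (hτ1 : τ ≤ 1)
    (hy : 0 ≤ y) (h : y ≤ τ) :
    (3 / 16) ^ (1 / 2 : ℝ) * 2 ^ (-κ) * (τ ^ (-m) * (1 - Real.log τ) ^ (-κ)) ≤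
      Real.exp (logAmp κ τ y) := by
  have hL := one_le_one_sub_log hτ hτ1
  have hE := coreE_scaled_ge hτ hy
  have h2 : (2 * τ * (1 - Real.log τ)) ^ (-κ) ≤ denQ τ y ^ (-κ) :=
    Real.rpow_le_rpow_of_nonpos (denQ_pos hτ hτ1 hy) (denQ_le_of_le hτ hτ1 hy h) (by linarith)
  rw [exp_logAmp_eq hτ hτ1 hy]
  calc (3 / 16) ^ (1 / 2 : ℝ) * 2 ^ (-κ) * (τ ^ (-m) * (1 - Real.log τ) ^ (-κ))
      = (3 / 16) ^ (1 / 2 : ℝ) * 2 ^ (-κ) *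
        ((τ ^ (1 / 2 : ℝ) * τ ^ (-κ)) * (1 - Real.log τ) ^ (-κ)) := by
        rw [← Real.rpow_add hτ, hm]; congr 3; ring_nf
    _ = (3 / 16 * τ) ^ (1 / 2 : ℝ) * (2 * τ * (1 - Real.log τ)) ^ (-κ) := by
        rw [Real.mul_rpow (by norm_num) hτ.le, Real.mul_rpow (by positivity) (by linarith),
          Real.mul_rpow (by norm_num) hτ.le]; ring
    _ ≤ _ := by
        have h0 : 3 / 16 * τ ≤ τ * coreE (y / τ) := le_trans (by linarith) hE
        exact mul_le_mul (Real.rpow_le_rpow (by positivity) h0 (by norm_num)) h2 (by positivity)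
          (Real.rpow_nonneg (le_trans (by positivity) h0) _)

theorem rpow_add_one_ge (hκ : 0 ≤ κ) (hy : 0 ≤ y) (h : y ≤ 1) :
    1 ≤ 8 ^ κ * (1 + y) ^ (-(3 * κ)) := by
  have h1 : (1 + y) ^ (3 * κ) ≤ 8 ^ κ := by
    rw [Real.rpow_mul (by positivity)]
    refine Real.rpow_le_rpow (by positivity) ?_ hκ
    have : (1 + y) ^ (3 : ℝ) = (1 + y) ^ (3 : ℕ) := by
      rw [← Real.rpow_natCast]; norm_num
    rw [this]
    calc (1 + y) ^ 3 ≤ 2 ^ 3 := by gcongr; linarith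
      _ = 8 := by norm_num
  rw [Real.rpow_neg (by positivity), ← div_eq_mul_inv, one_le_div (by positivity)]
  exact h1

/-- The free parameter `w` gives two bounds at once: `w = τ` is uniform in `y` before the final
time, and `w = y` is uniform in time away from the origin. -/
theorem exp_logAmp_le_min {m : ℝ} (hm0 : 0 ≤ m) (hm : m = κ - 1 / 2) (hτ : 0 < τ) (hτ1 : τ ≤ 1)
    (hy : 0 ≤ y) {w : ℝ} (hw : 0 < w) (hwτ : w ≤ max y τ) :
    Real.exp (logAmp κ τ y) ≤ 64 ^ κ * (w ^ (-m) * (1 + y) ^ (-(3 * κ))) := by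
  have hκ : 0 ≤ κ := by linarith
  rcases le_total y τ with h | h
  · have hL := one_le_one_sub_log hτ hτ1
    rw [max_eq_right h] at hwτ
    have hB : (1 + (1 - Real.log τ) * (y / τ)) ^ (-κ) ≤ 1 :=
      Real.rpow_le_one_of_one_le_of_nonpos (le_add_of_nonneg_right (by positivity)) (by linarith)
    have h1 : τ ^ (-m) ≤ w ^ (-m) := Real.rpow_le_rpow_of_nonpos hw hwτ (by linarith)
    have h8 : ((8 : ℝ) / 3) ^ κ * 8 ^ κ ≤ 64 ^ κ := by
      rw [← Real.mul_rpow (by norm_num) (by norm_num)]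
      exact Real.rpow_le_rpow (by norm_num) (by norm_num) hκ
    calc Real.exp (logAmp κ τ y) ≤
        (8 / 3) ^ κ * (τ ^ (-m) * (1 + (1 - Real.log τ) * (y / τ)) ^ (-κ)) :=
          exp_logAmp_le_inner hκ hm hτ hτ1 hy h
      _ ≤ (8 / 3) ^ κ * (w ^ (-m) * 1) := by gcongr
      _ ≤ (8 / 3) ^ κ * (w ^ (-m) * (8 ^ κ * (1 + y) ^ (-(3 * κ)))) := by
          gcongr; exact rpow_add_one_ge hκ hy (h.trans hτ1)
      _ = ((8 / 3) ^ κ * 8 ^ κ) * (w ^ (-m) * (1 + y) ^ (-(3 * κ))) := by ring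
      _ ≤ _ := by gcongr
  · rw [max_eq_left h] at hwτ
    rw [logAmp_eq_logStat hτ h]
    have h1 : y ^ (-m) ≤ w ^ (-m) := Real.rpow_le_rpow_of_nonpos hw hwτ (by linarith)
    refine (exp_logStat_le hκ hm (hτ.trans_le h)).trans ?_
    gcongr

end

/-! ### The radial solution -/

/-- The exponent `κ` in dimension `n`. -/
noncomputable def kap (n : ℕ) : ℝ := (n + 2) / 4

/-- The radial profile of the solution, as a function of time and `y = |x|²`. -/
noncomputable def solRad (n : ℕ) (t y : ℝ) : ℂ :=
  if t < 1 then
    Complex.exp ((logAmp (kap n) (scale t) y : ℂ) + Complex.I * phase (scale t) (scale₁ t) y)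
  else Complex.exp (logStat (kap n) y : ℂ)

/-- The logarithmic derivative `∂_y log solRad`. -/
noncomputable def solLog₁ (n : ℕ) (t y : ℝ) : ℂ :=
  (logAmp₁ (kap n) (scale t) y : ℂ) + Complex.I * phase₁ (scale t) (scale₁ t) y

/-- The second logarithmic derivative `∂_y² log solRad`. -/
noncomputable def solLog₂ (n : ℕ) (t y : ℝ) : ℂ :=
  (logAmp₂ (kap n) (scale t) y : ℂ) + Complex.I * phase₂ (scale t) (scale₁ t) y

/-- The logarithmic time derivative `∂_t log solRad`. -/
noncomputable def solLogTime (n : ℕ) (t y : ℝ) : ℂ :=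
  ((logAmpParam (kap n) (scale t) y * scale₁ t : ℝ) : ℂ) +
    Complex.I * phaseTime (scale t) (scale₁ t) (scale₂ t) y

/-- The radial profile of the potential. -/
noncomputable def potRad (n : ℕ) (t y : ℝ) : ℝ :=
  radV n (kap n) (scale t) (scale₁ t) (scale₂ t) y

section
variable {n : ℕ} {t y : ℝ}

theorem kap_pos : 0 < kap n := by unfold kap; positivity

theorem hasDerivAt_solRad (h0 : 0 ≤ t) (h : t < 1) (hy : 0 ≤ y) :
    HasDerivAt (solRad n t) (solLog₁ n t y * solRad n t y) y := by
  have h1 := ((hasDerivAt_logAmp (κ := kap n) (scale_pos h) (scale_le_one h0 h) hy).ofReal_comp.add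
    ((hasDerivAt_phase (a := scale₁ t) (y := y) (scale_pos h)).ofReal_comp.const_mul
      Complex.I)).cexp
  have e : solRad n t = fun y => Complex.exp ((logAmp (kap n) (scale t) y : ℂ) +
      Complex.I * phase (scale t) (scale₁ t) y) := by
    funext y; rw [solRad, if_pos h]
  rw [e, mul_comm]
  exact h1

theorem hasDerivAt_solLog₁ (h0 : 0 ≤ t) (h : t < 1) (hy : 0 ≤ y) :
    HasDerivAt (solLog₁ n t) (solLog₂ n t y) y :=
  (hasDerivAt_logAmp₁ (κ := kap n) (scale_pos h) (scale_le_one h0 h) hy).ofReal_comp.add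
    ((hasDerivAt_phase₁ (a := scale₁ t) (scale_pos h) hy).ofReal_comp.const_mul Complex.I)

theorem hasDerivAt_solRad₁ (h0 : 0 ≤ t) (h : t < 1) (hy : 0 ≤ y) :
    HasDerivAt (fun y => solLog₁ n t y * solRad n t y)
      ((solLog₂ n t y + solLog₁ n t y ^ 2) * solRad n t y) y := by
  have := (hasDerivAt_solLog₁ (n := n) h0 h hy).mul (hasDerivAt_solRad (n := n) h0 h hy)
  have e : (solLog₂ n t y + solLog₁ n t y ^ 2) * solRad n t y = solLog₂ n t y * solRad n t y +
      solLog₁ n t y * (solLog₁ n t y * solRad n t y) := by ring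
  rw [e]; exact this

theorem hasDerivAt_solRad_time (h0 : 0 ≤ t) (h : t < 1) (hy : 0 ≤ y) :
    HasDerivAt (fun t => solRad n t y) (solLogTime n t y * solRad n t y) t := by
  have h1 := ((hasDerivAt_logAmp_time (κ := kap n) (scale_pos h) (scale_le_one h0 h) hy
    (hasDerivAt_scale h)).ofReal_comp.add
    ((hasDerivAt_phase_time (y := y) (scale_pos h) (hasDerivAt_scale h)
      (hasDerivAt_scale₁ h)).ofReal_comp.const_mul Complex.I)).cexp
  have e : (fun t => solRad n t y) =ᶠ[𝓝 t] fun t => Complex.exp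
      ((logAmp (kap n) (scale t) y : ℂ) + Complex.I * phase (scale t) (scale₁ t) y) := by
    filter_upwards [Iio_mem_nhds h] with s hs
    rw [solRad, if_pos (mem_Iio.1 hs)]
  refine HasDerivAt.congr_of_eventuallyEq ?_ e
  have e' : solLogTime n t y * solRad n t y = Complex.exp ((logAmp (kap n) (scale t) y : ℂ) +
      Complex.I * phase (scale t) (scale₁ t) y) * solLogTime n t y := by
    rw [mul_comm, solRad, if_pos h]
  rw [e']; exact h1

/-- The Schrödinger equation in radial coordinates. -/
theorem solLogTime_eq (h0 : 0 ≤ t) (h : t < 1) (hy : 0 ≤ y) :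
    solLogTime n t y = -Complex.I * (4 * y * (solLog₂ n t y + solLog₁ n t y ^ 2) +
      2 * n * solLog₁ n t y) + Complex.I * potRad n t y := by
  have hc := continuity_equation (n := n) (κ := kap n) (a := scale₁ t) rfl (scale_pos h)
    (scale_le_one h0 h) hy
  unfold solLogTime
  -- The real part of the logarithmic time derivative is replaced by the continuity equation; the
  -- imaginary part agrees by the definition of `radV`.
  rw [hc, solLog₁, solLog₂, potRad, radV]
  push_cast
  ring_nf
  simp only [Complex.I_sq, Complex.I_pow_three]
  ring

theorem norm_solRad (h : t < 1) : ‖solRad n t y‖ = Real.exp (logAmp (kap n) (scale t) y) := by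
  rw [solRad, if_pos h, Complex.norm_exp]; simp

theorem solRad_of_scale_le (h : t < 1) (hy : scale t ≤ y) :
    solRad n t y = Complex.exp (logStat (kap n) y : ℂ) := by
  rw [solRad, if_pos h, logAmp_eq_logStat (scale_pos h) hy, phase,
    flowB_of_ge ((one_le_div (scale_pos h)).2 hy)]
  simp

theorem solRad_one : solRad n 1 y = Complex.exp (logStat (kap n) y : ℂ) := by
  rw [solRad, if_neg (lt_irrefl _)]

theorem norm_solRad_le (h0 : 0 ≤ t) (h : t < 1) (hy : 0 ≤ y) :
    ‖solRad n t y‖ ≤ 64 ^ kap n * (scale t ^ (-(n / 4 : ℝ)) * (1 + y) ^ (-(3 * kap n))) := by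
  rw [norm_solRad h]
  refine exp_logAmp_le_min (by positivity) (by unfold kap; ring) (scale_pos h) (scale_le_one h0 h)
    hy (scale_pos h) (le_max_right _ _)

theorem norm_solRad_le' (h0 : 0 ≤ t) (h : t ≤ 1) (hy : 0 < y) :
    ‖solRad n t y‖ ≤ 64 ^ kap n * (y ^ (-(n / 4 : ℝ)) * (1 + y) ^ (-(3 * kap n))) := by
  rcases h.lt_or_eq with h | rfl
  · rw [norm_solRad h]
    exact exp_logAmp_le_min (by positivity) (by unfold kap; ring) (scale_pos h)
      (scale_le_one h0 h) hy.le hy (le_max_left _ _)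
  · rw [solRad_one, Complex.norm_exp, Complex.ofReal_re]
    exact exp_logStat_le kap_pos.le (by unfold kap; ring) hy

theorem abs_potRad_le : ∃ C : ℝ, 0 < C ∧ ∀ t y : ℝ, 0 ≤ t → t < 1 → 0 ≤ y →
    |potRad n t y| ≤ C * (1 - Real.log (scale t)) ^ 2 / (y + scale t) := by
  refine ⟨_, ?_, fun t y h0 h hy => abs_radV_le (Nat.cast_nonneg n) kap_pos.le (scale_pos h)
    (scale_le_one h0 h) hy (abs_scale₁_le h0 h) (abs_scale₂_mul_le h0 h)⟩
  have := kap_pos (n := n)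
  positivity

theorem norm_solLog₁_le : ∃ C : ℝ, 0 < C ∧ ∀ t y : ℝ, 0 ≤ t → t < 1 → 0 ≤ y →
    ‖solLog₁ n t y‖ ≤ C * (1 - Real.log (scale t)) / (y + scale t) := by
  have hκ := kap_pos (n := n)
  refine ⟨(3 + 20 * kap n) + 1, by positivity, fun t y h0 h hy => ?_⟩
  have hτ := scale_pos h
  have hL := one_le_one_sub_log hτ (scale_le_one h0 h)
  have h1 := abs_logAmp₁_le hκ.le hτ (scale_le_one h0 h) hy
  have h2 := abs_phase₁_le hτ hy (abs_scale₁_le h0 h)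
  calc ‖solLog₁ n t y‖ ≤ |logAmp₁ (kap n) (scale t) y| + |phase₁ (scale t) (scale₁ t) y| := by
        refine (norm_add_le _ _).trans ?_
        rw [norm_mul, Complex.norm_I, one_mul, Complex.norm_real, Complex.norm_real]; rfl
    _ ≤ (3 + 20 * kap n) * (1 - Real.log (scale t)) / (y + scale t) + 1 / (y + scale t) :=
        add_le_add h1 h2
    _ ≤ (3 + 20 * kap n) * (1 - Real.log (scale t)) / (y + scale t) +
        1 * (1 - Real.log (scale t)) / (y + scale t) := by rw [one_mul]; gcongr
    _ = _ := by ring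

theorem norm_solLog₂_le : ∃ C : ℝ, 0 < C ∧ ∀ t y : ℝ, 0 ≤ t → t < 1 → 0 ≤ y →
    ‖solLog₂ n t y‖ ≤ C * (1 - Real.log (scale t)) ^ 2 / (y + scale t) ^ 2 := by
  have hκ := kap_pos (n := n)
  refine ⟨(30 + 600 * kap n) + 16, by positivity, fun t y h0 h hy => ?_⟩
  have hτ := scale_pos h
  have hL := one_le_one_sub_log hτ (scale_le_one h0 h)
  have hL2 : 1 ≤ (1 - Real.log (scale t)) ^ 2 := one_le_pow₀ hL
  have h1 := abs_logAmp₂_le hκ.le hτ (scale_le_one h0 h) hy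
  have h2 := abs_phase₂_le hτ hy (abs_scale₁_le h0 h)
  calc ‖solLog₂ n t y‖ ≤ |logAmp₂ (kap n) (scale t) y| + |phase₂ (scale t) (scale₁ t) y| := by
        refine (norm_add_le _ _).trans ?_
        rw [norm_mul, Complex.norm_I, one_mul, Complex.norm_real, Complex.norm_real]; rfl
    _ ≤ (30 + 600 * kap n) * (1 - Real.log (scale t)) ^ 2 / (y + scale t) ^ 2 +
        16 * 1 / (y + scale t) ^ 2 := by rw [mul_one]; exact add_le_add h1 h2
    _ ≤ (30 + 600 * kap n) * (1 - Real.log (scale t)) ^ 2 / (y + scale t) ^ 2 +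
        16 * (1 - Real.log (scale t)) ^ 2 / (y + scale t) ^ 2 := by gcongr
    _ = _ := by ring

/-- The equation itself expresses the time derivative through quantities already bounded, so
`logAmpParam` needs no separate estimate. -/
theorem norm_solLogTime_le : ∃ C : ℝ, 0 < C ∧ ∀ t y : ℝ, 0 ≤ t → t < 1 → 0 ≤ y →
    ‖solLogTime n t y‖ ≤ C * (1 - Real.log (scale t)) ^ 2 / (y + scale t) := by
  obtain ⟨C₁, hC₁, h₁⟩ := norm_solLog₁_le (n := n)
  obtain ⟨C₂, hC₂, h₂⟩ := norm_solLog₂_le (n := n)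
  obtain ⟨C₃, hC₃, h₃⟩ := abs_potRad_le (n := n)
  refine ⟨4 * (C₂ + C₁ ^ 2) + 2 * n * C₁ + C₃, by positivity, fun t y h0 h hy => ?_⟩
  have hτ := scale_pos h
  have hL := one_le_one_sub_log hτ (scale_le_one h0 h)
  have hS : 0 < y + scale t := by linarith
  have b1 := h₁ t y h0 h hy
  have b2 := h₂ t y h0 h hy
  have b3 := h₃ t y h0 h hy
  rw [solLogTime_eq h0 h hy]
  generalize 1 - Real.log (scale t) = L at *
  generalize scale t = τ at *
  have hLL : L ≤ L ^ 2 := by nlinarith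
  calc _ ≤ 4 * y * (‖solLog₂ n t y‖ + ‖solLog₁ n t y‖ ^ 2) + 2 * n * ‖solLog₁ n t y‖ +
        |potRad n t y| := by
        refine (norm_add_le _ _).trans (add_le_add ?_ ?_)
        · rw [norm_mul, norm_neg, Complex.norm_I, one_mul]
          refine (norm_add_le _ _).trans (add_le_add ?_ ?_)
          · rw [norm_mul, norm_mul, Complex.norm_real, Real.norm_of_nonneg hy]
            simp only [Complex.norm_ofNat]
            gcongr
            refine (norm_add_le _ _).trans (by rw [norm_pow])
          · rw [norm_mul, norm_mul]; simp
        · rw [norm_mul, Complex.norm_I, one_mul, Complex.norm_real]; rfl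
    _ ≤ 4 * (y + τ) * (C₂ * L ^ 2 / (y + τ) ^ 2 + (C₁ * L / (y + τ)) ^ 2) +
        2 * n * (C₁ * L ^ 2 / (y + τ)) + C₃ * L ^ 2 / (y + τ) := by
        gcongr
        · linarith
        · exact b1.trans (by gcongr)
    _ = _ := by field_simp

end

/-! ### Integrability of radial functions -/

section
variable {n : ℕ}

/-- The function is dominated by `‖x‖^(-a)` on the unit ball plus the decaying factor everywhere; `a
< n` handles the first and `2b > n` the second. -/
theorem integrable_norm_rpow_mul (hn : 2 ≤ n) {a b : ℝ} (ha0 : 0 ≤ a) (ha : a < n)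
    (hb : (n : ℝ) / 2 < b) :
    Integrable (fun x : EuclideanSpace ℝ (Fin n) => ‖x‖ ^ (-a) * (1 + ‖x‖ ^ 2) ^ (-b)) := by
  have : Nontrivial (EuclideanSpace ℝ (Fin n)) := by
    apply Module.nontrivial_of_finrank_pos (R := ℝ); rw [finrank_euclideanSpace_fin]; omega
  have h1 : Integrable (fun x : EuclideanSpace ℝ (Fin n) => (1 + ‖x‖ ^ 2) ^ (-b)) := by
    have := integrable_rpow_neg_one_add_norm_sq (E := EuclideanSpace ℝ (Fin n)) (μ := volume)
      (r := 2 * b) (by rw [finrank_euclideanSpace_fin]; linarith)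
    refine this.congr (Eventually.of_forall fun x => ?_)
    dsimp only; congr 1; ring
  have h2 : IntegrableOn (fun x : EuclideanSpace ℝ (Fin n) => ‖x‖ ^ (-a)) (Metric.ball 0 1) := by
    rw [integrableOn_fun_norm_addHaar volume (f := fun r => r ^ (-a))]
    have h3 : IntegrableOn (fun r : ℝ => r ^ ((n : ℝ) - 1 - a)) (Ioo 0 1) :=
      (intervalIntegral.integrableOn_Ioo_rpow_iff zero_lt_one).2 (by linarith)
    refine h3.congr_fun (fun r hr => ?_) measurableSet_Ioo
    have e : ((n : ℝ) - 1 - a) = ((n - 1 : ℕ) : ℝ) + (-a) := by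
      rw [Nat.cast_sub (by omega)]; push_cast; ring
    simp only [finrank_euclideanSpace_fin, smul_eq_mul]
    rw [e, Real.rpow_add hr.1, Real.rpow_natCast]
  refine Integrable.mono' ((h2.integrable_indicator measurableSet_ball).add h1) ?_ ?_
  · apply Measurable.aestronglyMeasurable; fun_prop
  · refine Eventually.of_forall fun x => ?_
    have hx2 : 0 ≤ ‖x‖ ^ 2 := by positivity
    have p1 : (1 + ‖x‖ ^ 2) ^ (-b) ≤ 1 :=
      Real.rpow_le_one_of_one_le_of_nonpos (by linarith)
        (by have : (0 : ℝ) ≤ n := Nat.cast_nonneg n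
            linarith)
    have p2 : 0 ≤ ‖x‖ ^ (-a) := by positivity
    have p3 : 0 ≤ (1 + ‖x‖ ^ 2) ^ (-b) := by positivity
    rw [Real.norm_of_nonneg (by positivity)]
    simp only [Pi.add_apply]
    by_cases hx : x ∈ Metric.ball (0 : EuclideanSpace ℝ (Fin n)) 1
    · rw [indicator_of_mem hx]; nlinarith
    · rw [indicator_of_notMem hx, zero_add]
      have : 1 ≤ ‖x‖ := by simpa using hx
      have p4 : ‖x‖ ^ (-a) ≤ 1 := Real.rpow_le_one_of_one_le_of_nonpos this (by linarith)
      nlinarith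

theorem integrableOn_inv_mul_log :
    IntegrableOn (fun r : ℝ => r⁻¹ * (1 - 2 * Real.log r) ^ (-2 : ℝ)) (Ioo 0 1) := by
  -- An explicit primitive. Since `Real.log 0 = 0`, the bare formula would take the value `1/2` at
  -- `0`; the case split restores the limit `0` and hence continuity on `[0, 1]`.
  set g : ℝ → ℝ := fun r => if r ≤ 0 then 0 else (2 * (1 - 2 * Real.log r))⁻¹ with hg
  have hder : ∀ x ∈ Ioo (0 : ℝ) 1, HasDerivAt g (x⁻¹ * (1 - 2 * Real.log x) ^ (-2 : ℝ)) x := by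
    intro x hx
    have hl : Real.log x < 0 := Real.log_neg hx.1 hx.2
    have hpos : 0 < 1 - 2 * Real.log x := by linarith
    have h1 : HasDerivAt (fun r => (2 * (1 - 2 * Real.log r))⁻¹)
        (x⁻¹ * (1 - 2 * Real.log x) ^ (-2 : ℝ)) x := by
      have h2 : HasDerivAt (fun r => 2 * (1 - 2 * Real.log r)) (2 * (-(2 * x⁻¹))) x :=
        (((Real.hasDerivAt_log hx.1.ne').const_mul 2).const_sub 1).const_mul 2
      have h3 := h2.fun_inv (by linarith : 2 * (1 - 2 * Real.log x) ≠ 0)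
      refine HasDerivAt.congr_deriv h3 ?_
      rw [show (-2 : ℝ) = ((-2 : ℤ) : ℝ) by norm_num, Real.rpow_intCast, zpow_neg]
      have := hx.1.ne'
      norm_cast
      field_simp
    refine h1.congr_of_eventuallyEq ?_
    filter_upwards [Ioi_mem_nhds hx.1] with r hr
    rw [hg]; exact if_neg (not_le.2 hr)
  have hcont : ContinuousOn g (Icc 0 1) := by
    intro x hx
    rcases hx.1.eq_or_lt with rfl | hx0
    · have hlim : Tendsto (fun r : ℝ => (2 * (1 - 2 * Real.log r))⁻¹) (𝓝[>] 0) (𝓝 0) := by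
        refine Tendsto.inv_tendsto_atTop ?_
        refine Tendsto.const_mul_atTop (by norm_num) ?_
        simp only [sub_eq_add_neg]
        refine tendsto_atTop_add_const_left _ _ ?_
        refine tendsto_neg_atBot_atTop.comp ?_
        exact Tendsto.const_mul_atBot (by norm_num) Real.tendsto_log_nhdsGT_zero
      have h0 : g 0 = 0 := by simp [hg]
      have h1 : ContinuousWithinAt g (Ioi 0) 0 := by
        rw [ContinuousWithinAt, h0]
        refine hlim.congr' ?_
        filter_upwards [self_mem_nhdsWithin] with r hr
        rw [hg]; exact (if_neg (not_le.2 hr)).symm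
      have h2 : ContinuousWithinAt g (Ici 0) 0 := by
        rw [← Ioi_insert]; exact h1.insert
      exact h2.mono Icc_subset_Ici_self
    · have hl : Real.log x ≤ 0 := Real.log_nonpos hx0.le hx.2
      have h1 : ContinuousAt (fun r => (2 * (1 - 2 * Real.log r))⁻¹) x := by
        refine ContinuousAt.inv₀ ?_ (by linarith)
        exact continuousAt_const.mul (continuousAt_const.sub
          (continuousAt_const.mul (Real.continuousAt_log hx0.ne')))
      refine (h1.congr ?_).continuousWithinAt
      filter_upwards [Ioi_mem_nhds hx0] with r hr
      rw [hg]; exact (if_neg (not_le.2 hr)).symm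
  have := intervalIntegral.integrableOn_deriv_of_nonneg hcont hder fun x hx => by
    have hl : Real.log x < 0 := Real.log_neg hx.1 hx.2
    have hpos : 0 < 1 - 2 * Real.log x := by linarith
    have := hx.1
    positivity
  exact this.mono_set Ioo_subset_Ioc_self

theorem measurable_statQ : Measurable statQ := by
  unfold statQ
  have := continuous_farP.measurable
  fun_prop

theorem measurable_logStat (κ : ℝ) : Measurable (logStat κ) := by
  unfold logStat
  have := measurable_statQ
  fun_prop

/-- In the unit ball the square equals `‖x‖^(-n) (1 - 2 log ‖x‖)^(-2κ)`. The power is borderline,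
and the logarithm saves it: `2κ = (n + 2)/2 ≥ 2`, so the radial integral is dominated by that of
`r⁻¹ (1 - 2 log r)^(-2)`. -/
theorem integrable_exp_logStat_sq (hn : 2 ≤ n) :
    Integrable (fun x : EuclideanSpace ℝ (Fin n) =>
      Real.exp (logStat (kap n) (‖x‖ ^ 2)) ^ 2) := by
  have hnt : Nontrivial (EuclideanSpace ℝ (Fin n)) := by
    apply Module.nontrivial_of_finrank_pos (R := ℝ); rw [finrank_euclideanSpace_fin]; omega
  have hn' : (2 : ℝ) ≤ n := by exact_mod_cast hn
  have hκ := kap_pos (n := n)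
  have h2 : IntegrableOn (fun x : EuclideanSpace ℝ (Fin n) =>
      ‖x‖ ^ (-(n : ℝ)) * (1 - 2 * Real.log ‖x‖) ^ (-2 : ℝ)) (Metric.ball 0 1) := by
    rw [integrableOn_fun_norm_addHaar volume
      (f := fun r => r ^ (-(n : ℝ)) * (1 - 2 * Real.log r) ^ (-2 : ℝ))]
    refine integrableOn_inv_mul_log.congr_fun (fun r hr => ?_) measurableSet_Ioo
    simp only [finrank_euclideanSpace_fin, smul_eq_mul]
    rw [← mul_assoc, ← Real.rpow_natCast, ← Real.rpow_add hr.1, Nat.cast_sub (by omega),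
      ← Real.rpow_neg_one]
    congr 2; push_cast; ring
  have h1 : Integrable (fun x : EuclideanSpace ℝ (Fin n) =>
      (64 ^ kap n) ^ 2 * (‖x‖ ^ (-(0 : ℝ)) * (1 + ‖x‖ ^ 2) ^ (-(6 * kap n)))) := by
    refine (integrable_norm_rpow_mul hn le_rfl (by linarith) ?_).const_mul _
    unfold kap; linarith
  refine Integrable.mono' ((h2.integrable_indicator measurableSet_ball).add h1) ?_ ?_
  · have := measurable_logStat (kap n)
    apply Measurable.aestronglyMeasurable; fun_prop
  · have hae : ∀ᵐ x : EuclideanSpace ℝ (Fin n), x ≠ 0 := by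
      simp [ae_iff, measure_singleton]
    filter_upwards [hae] with x hx0
    have hx : 0 < ‖x‖ := norm_pos_iff.2 hx0
    have hy : 0 < ‖x‖ ^ 2 := by positivity
    have p0 : 0 ≤ (64 ^ kap n) ^ 2 * (‖x‖ ^ (-(0 : ℝ)) * (1 + ‖x‖ ^ 2) ^ (-(6 * kap n))) := by
      positivity
    rw [Real.norm_of_nonneg (by positivity)]
    simp only [Pi.add_apply]
    by_cases hxb : x ∈ Metric.ball (0 : EuclideanSpace ℝ (Fin n)) 1
    · rw [indicator_of_mem hxb]
      have hx1 : ‖x‖ < 1 := by simpa using hxb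
      have hl : Real.log ‖x‖ < 0 := Real.log_neg hx hx1
      have hsq : Real.log (‖x‖ ^ 2) = 2 * Real.log ‖x‖ := by
        rw [Real.log_pow]; norm_num
      have hk : 1 ≤ 1 - 2 * Real.log ‖x‖ := by linarith
      have e1 : statQ (‖x‖ ^ 2) = ‖x‖ ^ 2 * (1 - 2 * Real.log ‖x‖) := by
        rw [statQ, farP, if_pos (by nlinarith), hsq, add_zero]
      have e2 : Real.exp (logStat (kap n) (‖x‖ ^ 2)) ^ 2 =
          ‖x‖ ^ (-(n : ℝ)) * (1 - 2 * Real.log ‖x‖) ^ (-(2 * kap n)) := by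
        rw [Real.rpow_def_of_pos hx, Real.rpow_def_of_pos (by linarith), ← Real.exp_add,
          ← Real.exp_nat_mul, logStat, e1, Real.log_mul (by positivity) (by linarith), hsq]
        congr 1; unfold kap; push_cast; ring
      have e3 : (1 - 2 * Real.log ‖x‖) ^ (-(2 * kap n)) ≤ (1 - 2 * Real.log ‖x‖) ^ (-2 : ℝ) :=
        Real.rpow_le_rpow_of_exponent_le hk (by unfold kap; linarith)
      rw [e2]
      have : ‖x‖ ^ (-(n : ℝ)) * (1 - 2 * Real.log ‖x‖) ^ (-(2 * kap n)) ≤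
        ‖x‖ ^ (-(n : ℝ)) * (1 - 2 * Real.log ‖x‖) ^ (-2 : ℝ) := by gcongr
      linarith
    · rw [indicator_of_notMem hxb, zero_add]
      have hx1 : 1 ≤ ‖x‖ := by simpa using hxb
      have hy1 : 1 ≤ ‖x‖ ^ 2 := one_le_pow₀ hx1
      have b := exp_logStat_le (κ := kap n) (m := n / 4) hκ.le (by unfold kap; ring) hy
      have b1 : (‖x‖ ^ 2) ^ (-(n / 4 : ℝ)) ≤ 1 :=
        Real.rpow_le_one_of_one_le_of_nonpos hy1 (by linarith)
      have b2 : Real.exp (logStat (kap n) (‖x‖ ^ 2)) ≤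
          64 ^ kap n * (1 * (1 + ‖x‖ ^ 2) ^ (-(3 * kap n))) := b.trans (by gcongr)
      calc Real.exp (logStat (kap n) (‖x‖ ^ 2)) ^ 2 ≤
          (64 ^ kap n * (1 * (1 + ‖x‖ ^ 2) ^ (-(3 * kap n)))) ^ 2 := by gcongr
        _ = _ := by
          rw [mul_pow, one_mul, neg_zero, Real.rpow_zero, one_mul,
            ← Real.rpow_natCast ((1 + ‖x‖ ^ 2) ^ (-(3 * kap n))) 2, ← Real.rpow_mul (by positivity)]
          congr 2; push_cast; ring

/-- Rescale by `√τ`. -/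
theorem integrable_add_norm_sq {τ s : ℝ} (hτ : 0 < τ) (hs : (n : ℝ) / 2 < s) :
    Integrable (fun x : EuclideanSpace ℝ (Fin n) => (‖x‖ ^ 2 + τ) ^ (-s)) ∧
    ∫ x : EuclideanSpace ℝ (Fin n), (‖x‖ ^ 2 + τ) ^ (-s) =
      τ ^ ((n : ℝ) / 2 - s) * ∫ x : EuclideanSpace ℝ (Fin n), (1 + ‖x‖ ^ 2) ^ (-s) := by
  have h1 : Integrable (fun x : EuclideanSpace ℝ (Fin n) => (1 + ‖x‖ ^ 2) ^ (-s)) := by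
    have := integrable_rpow_neg_one_add_norm_sq (E := EuclideanSpace ℝ (Fin n)) (μ := volume)
      (r := 2 * s) (by rw [finrank_euclideanSpace_fin]; linarith)
    refine this.congr (Eventually.of_forall fun x => ?_)
    dsimp only; congr 1; ring
  have hr : 0 < √τ := Real.sqrt_pos.2 hτ
  have e : (fun x : EuclideanSpace ℝ (Fin n) => (‖x‖ ^ 2 + τ) ^ (-s)) =
      fun x => τ ^ (-s) * (1 + ‖(√τ)⁻¹ • x‖ ^ 2) ^ (-s) := by
    funext x
    rw [← Real.mul_rpow hτ.le (by positivity), norm_smul, mul_pow, norm_inv, inv_pow,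
      Real.norm_of_nonneg hr.le, Real.sq_sqrt hτ.le]
    congr 1; field_simp; ring
  rw [e]
  refine ⟨((integrable_comp_smul_iff volume _ (inv_ne_zero hr.ne')).2 h1).const_mul _, ?_⟩
  rw [integral_const_mul, Measure.integral_comp_inv_smul_of_nonneg volume
    (fun x : EuclideanSpace ℝ (Fin n) => (1 + ‖x‖ ^ 2) ^ (-s)) hr.le, finrank_euclideanSpace_fin,
    smul_eq_mul, ← mul_assoc]
  congr 1
  rw [Real.sqrt_eq_rpow, ← Real.rpow_natCast, ← Real.rpow_mul hτ.le, ← Real.rpow_add hτ]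
  congr 1; ring

end

/-! ### Radial functions against plane waves -/

section
variable {n : ℕ}

/-- The plane wave `x ↦ exp(2πi ξ·x)`. -/
noncomputable def wave (ξ x : EuclideanSpace ℝ (Fin n)) : ℂ :=
  Complex.exp ((2 * Real.pi * inner ℝ ξ x : ℝ) * Complex.I)

theorem norm_wave (ξ x : EuclideanSpace ℝ (Fin n)) : ‖wave ξ x‖ = 1 :=
  Complex.norm_exp_ofReal_mul_I _

theorem continuous_wave : Continuous
    (fun p : EuclideanSpace ℝ (Fin n) × EuclideanSpace ℝ (Fin n) => wave p.1 p.2) := by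
  unfold wave; fun_prop

theorem continuous_wave_right (ξ : EuclideanSpace ℝ (Fin n)) : Continuous (wave ξ) := by
  unfold wave; fun_prop

theorem integrable_mul_wave {f : EuclideanSpace ℝ (Fin n) → ℂ} (hf : Integrable f)
    (ξ : EuclideanSpace ℝ (Fin n)) : Integrable (fun x => f x * wave ξ x) :=
  hf.mul_bdd (c := 1) (continuous_wave_right ξ).aestronglyMeasurable
    (Eventually.of_forall fun x => (norm_wave ξ x).le)

theorem hasLineDerivAt_wave (ξ x v : EuclideanSpace ℝ (Fin n)) :
    HasLineDerivAt ℝ (wave ξ) (2 * Real.pi * inner ℝ ξ v * Complex.I * wave ξ x) x v := by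
  have h1 : HasDerivAt (fun t : ℝ => 2 * Real.pi * inner ℝ ξ (x + t • v))
      (2 * Real.pi * inner ℝ ξ v) 0 := by
    have e : (fun t : ℝ => 2 * Real.pi * inner ℝ ξ (x + t • v)) =
        fun t => 2 * Real.pi * (inner ℝ ξ x + t * inner ℝ ξ v) := by
      funext t; rw [inner_add_right, inner_smul_right]
    rw [e]
    exact HasDerivAt.congr_deriv ((((hasDerivAt_id (0 : ℝ)).mul_const (inner ℝ ξ v)).const_add
      (inner ℝ ξ x)).const_mul (2 * Real.pi)) (by simp)
  have h2 := (h1.ofReal_comp.mul_const Complex.I).cexp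
  refine HasDerivAt.congr_deriv (f := fun t : ℝ => wave ξ (x + t • v)) h2 ?_
  simp [wave]; ring

theorem hasDerivAt_norm_sq_line (x v : EuclideanSpace ℝ (Fin n)) :
    HasDerivAt (fun t : ℝ => ‖x + t • v‖ ^ 2) (2 * inner ℝ x v) 0 := by
  have e : (fun t : ℝ => ‖x + t • v‖ ^ 2) =
      fun t => ‖x‖ ^ 2 + (2 * inner ℝ x v) * t + ‖v‖ ^ 2 * t ^ 2 := by
    funext t
    rw [norm_add_sq_real, inner_smul_right, norm_smul, mul_pow, Real.norm_eq_abs, sq_abs]; ring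
  rw [e]
  refine HasDerivAt.congr_deriv ((((hasDerivAt_id (0 : ℝ)).const_mul (2 * inner ℝ x v)).const_add
    (‖x‖ ^ 2)).add ((hasDerivAt_pow 2 (0 : ℝ)).const_mul (‖v‖ ^ 2))) ?_
  simp

theorem hasLineDerivAt_radial {U : ℝ → ℂ} {U' : ℂ} (x v : EuclideanSpace ℝ (Fin n))
    (h : HasDerivAt U U' (‖x‖ ^ 2)) :
    HasLineDerivAt ℝ (fun x : EuclideanSpace ℝ (Fin n) => U (‖x‖ ^ 2))
      (2 * inner ℝ x v * U') x v := by
  unfold HasLineDerivAt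
  have h1 := hasDerivAt_norm_sq_line x v
  have h2 : HasDerivAt U U' ((fun t : ℝ => ‖x + t • v‖ ^ 2) 0) := by simpa using h
  have h3 := HasDerivAt.scomp (0 : ℝ) h2 h1
  refine HasDerivAt.congr_deriv (f := fun t : ℝ => U (‖x + t • v‖ ^ 2)) h3 ?_
  rw [Complex.real_smul]; push_cast; ring

theorem integral_lineDeriv_mul_wave {f f' : EuclideanSpace ℝ (Fin n) → ℂ}
    {v : EuclideanSpace ℝ (Fin n)} (hf : Integrable f) (hf' : Integrable f')
    (h : ∀ x, HasLineDerivAt ℝ f (f' x) x v) (ξ : EuclideanSpace ℝ (Fin n)) :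
    ∫ x, f' x * wave ξ x = -(2 * Real.pi * inner ℝ ξ v * Complex.I) * ∫ x, f x * wave ξ x := by
  have h1 := integral_bilinear_hasLineDerivAt_right_eq_neg_left_of_integrable
    (μ := (volume : Measure (EuclideanSpace ℝ (Fin n)))) (f := f) (f' := f') (g := wave ξ)
    (g' := fun x => 2 * Real.pi * inner ℝ ξ v * Complex.I * wave ξ x) (v := v)
    (B := ContinuousLinearMap.mul ℝ ℂ) ?_ ?_ ?_ (fun x _ => h x)
    (fun x _ => hasLineDerivAt_wave ξ x v)
  · simp only [ContinuousLinearMap.mul_apply'] at h1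
    have h2 : ∫ x, f' x * wave ξ x =
        - ∫ x, f x * (2 * Real.pi * inner ℝ ξ v * Complex.I * wave ξ x) := by rw [h1, neg_neg]
    rw [h2, neg_mul, ← integral_const_mul]
    congr 2; funext x; ring
  · simpa using integrable_mul_wave hf' ξ
  · have := (integrable_mul_wave hf ξ).const_mul (2 * Real.pi * inner ℝ ξ v * Complex.I)
    simp only [ContinuousLinearMap.mul_apply']
    refine this.congr (Eventually.of_forall fun x => ?_)
    dsimp only; ring
  · simpa using integrable_mul_wave hf ξ

/-- The Laplacian of a radial function `U(|x|²)` acts on plane waves as `-(2π|ξ|)²`. -/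
theorem integral_radial_laplacian_mul_wave {U U₁ U₂ : ℝ → ℂ}
    (hU : ∀ y, 0 ≤ y → HasDerivAt U (U₁ y) y) (hU₁ : ∀ y, 0 ≤ y → HasDerivAt U₁ (U₂ y) y)
    (h0 : Integrable (fun x : EuclideanSpace ℝ (Fin n) => U (‖x‖ ^ 2)))
    (h1 : Integrable (fun x : EuclideanSpace ℝ (Fin n) => U₁ (‖x‖ ^ 2)))
    (h1' : Integrable (fun x : EuclideanSpace ℝ (Fin n) => ‖x‖ * U₁ (‖x‖ ^ 2)))
    (m2 : AEStronglyMeasurable (fun x : EuclideanSpace ℝ (Fin n) => U₂ (‖x‖ ^ 2)))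
    (h2 : Integrable (fun x : EuclideanSpace ℝ (Fin n) => (‖x‖ ^ 2 : ℝ) * U₂ (‖x‖ ^ 2)))
    (ξ : EuclideanSpace ℝ (Fin n)) :
    ∫ x : EuclideanSpace ℝ (Fin n), (4 * (‖x‖ ^ 2 : ℝ) * U₂ (‖x‖ ^ 2) + 2 * n * U₁ (‖x‖ ^ 2)) *
      wave ξ x = -((2 * Real.pi * ‖ξ‖) ^ 2 : ℝ) * ∫ x, U (‖x‖ ^ 2) * wave ξ x := by
  set b := EuclideanSpace.basisFun (Fin n) ℝ with hb
  have hbn : ∀ i, ‖b i‖ = 1 := fun i => b.orthonormal.1 i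
  have hin : ∀ (x : EuclideanSpace ℝ (Fin n)) i, |inner ℝ x (b i)| ≤ ‖x‖ := fun x i => by
    have := abs_real_inner_le_norm x (b i)
    rwa [hbn, mul_one] at this
  have i1 : ∀ i, Integrable (fun x : EuclideanSpace ℝ (Fin n) =>
      2 * (inner ℝ x (b i) : ℝ) * U₁ (‖x‖ ^ 2)) := fun i => by
    refine Integrable.mono (h1'.const_mul 2) ?_ (Eventually.of_forall fun x => ?_)
    · refine AEStronglyMeasurable.mul ?_ h1.1
      exact Continuous.aestronglyMeasurable (by fun_prop)
    · simp only [norm_mul, Complex.norm_real, Real.norm_eq_abs, abs_norm, mul_assoc]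
      gcongr; exact hin x i
  have i2 : ∀ i, Integrable (fun x : EuclideanSpace ℝ (Fin n) =>
      4 * ((inner ℝ x (b i) : ℝ) ^ 2 : ℂ) * U₂ (‖x‖ ^ 2)) := fun i => by
    refine Integrable.mono (h2.const_mul 4) ?_ (Eventually.of_forall fun x => ?_)
    · refine AEStronglyMeasurable.mul ?_ m2
      exact Continuous.aestronglyMeasurable (by fun_prop)
    · simp only [norm_mul, Complex.norm_real, norm_pow, Real.norm_eq_abs, abs_norm, mul_assoc]
      gcongr; exact hin x i
  have i3 : ∀ i, Integrable (fun x : EuclideanSpace ℝ (Fin n) =>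
      2 * U₁ (‖x‖ ^ 2) + 4 * ((inner ℝ x (b i) : ℝ) ^ 2 : ℂ) * U₂ (‖x‖ ^ 2)) := fun i =>
    (h1.const_mul 2).add (i2 i)
  have d2 : ∀ i (x : EuclideanSpace ℝ (Fin n)), HasLineDerivAt ℝ
      (fun x : EuclideanSpace ℝ (Fin n) => 2 * (inner ℝ x (b i) : ℝ) * U₁ (‖x‖ ^ 2))
      (2 * U₁ (‖x‖ ^ 2) + 4 * ((inner ℝ x (b i) : ℝ) ^ 2 : ℂ) * U₂ (‖x‖ ^ 2)) x (b i) := by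
    intro i x
    have e1 : HasDerivAt (fun t : ℝ => (2 * (inner ℝ (x + t • b i) (b i) : ℝ) : ℂ)) 2 0 := by
      have e : HasDerivAt (fun t : ℝ => 2 * inner ℝ (x + t • b i) (b i)) 2 0 := by
        have e' : (fun t : ℝ => 2 * inner ℝ (x + t • b i) (b i)) =
            fun t => 2 * (inner ℝ x (b i) + t) := by
          funext t
          rw [inner_add_left, real_inner_smul_left, real_inner_self_eq_norm_sq, hbn]; ring
        rw [e']
        exact HasDerivAt.congr_deriv (((hasDerivAt_id (0 : ℝ)).const_add _).const_mul 2) (by simp)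
      have := e.ofReal_comp
      simpa using this
    have e2 := hasLineDerivAt_radial x (b i) (hU₁ _ (sq_nonneg ‖x‖))
    unfold HasLineDerivAt at e2 ⊢
    refine HasDerivAt.congr_deriv (f := fun t : ℝ => 2 * (inner ℝ (x + t • b i) (b i) : ℝ) *
      U₁ (‖x + t • b i‖ ^ 2)) (e1.mul e2) ?_
    simp; ring
  -- Two integrations by parts in the direction `b i`; summing over the basis produces the Laplacian
  -- `4yU'' + 2nU'` and the symbol.
  have key : ∀ i, ∫ x : EuclideanSpace ℝ (Fin n),
      (2 * U₁ (‖x‖ ^ 2) + 4 * ((inner ℝ x (b i) : ℝ) ^ 2 : ℂ) * U₂ (‖x‖ ^ 2)) * wave ξ x =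
      -((2 * Real.pi * inner ℝ ξ (b i)) ^ 2 : ℝ) * ∫ x, U (‖x‖ ^ 2) * wave ξ x := by
    intro i
    rw [integral_lineDeriv_mul_wave (i1 i) (i3 i) (d2 i) ξ,
      integral_lineDeriv_mul_wave h0 (i1 i)
        (fun x => hasLineDerivAt_radial x (b i) (hU _ (sq_nonneg ‖x‖))) ξ]
    rw [← mul_assoc]; congr 1
    push_cast; ring_nf; rw [Complex.I_sq]; ring
  have hsum : ∀ x : EuclideanSpace ℝ (Fin n), ∑ i, (inner ℝ x (b i)) ^ 2 = ‖x‖ ^ 2 := by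
    intro x
    have := b.sum_sq_norm_inner_left x
    simpa using this
  have e1 : ∀ x : EuclideanSpace ℝ (Fin n),
      (4 * (‖x‖ ^ 2 : ℝ) * U₂ (‖x‖ ^ 2) + 2 * n * U₁ (‖x‖ ^ 2)) * wave ξ x =
      ∑ i, (2 * U₁ (‖x‖ ^ 2) + 4 * ((inner ℝ x (b i) : ℝ) ^ 2 : ℂ) * U₂ (‖x‖ ^ 2)) *
        wave ξ x := by
    intro x
    have e : ∑ i, 4 * ((inner ℝ x (b i) : ℝ) ^ 2 : ℂ) * U₂ (‖x‖ ^ 2) =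
        4 * (∑ i, ((inner ℝ x (b i) : ℝ) ^ 2 : ℂ)) * U₂ (‖x‖ ^ 2) := by
      rw [Finset.mul_sum, Finset.sum_mul]
    rw [← Finset.sum_mul, Finset.sum_add_distrib, e, ← hsum x]
    simp only [Finset.sum_const, Finset.card_univ, Fintype.card_fin, nsmul_eq_mul]
    push_cast; ring
  simp_rw [e1]
  rw [integral_finsetSum _ fun i _ => integrable_mul_wave (i3 i) ξ]
  simp_rw [key]
  rw [← Finset.sum_mul]
  congr 1
  rw [mul_pow, ← hsum ξ, Finset.mul_sum]
  push_cast
  rw [← Finset.sum_neg_distrib]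
  refine Finset.sum_congr rfl fun i _ => ?_
  ring

end

/-! ### Duhamel's formula from the evolution of the plane wave coefficients -/

section
variable {n : ℕ}

/-- The symbol of the free evolution. -/
noncomputable def freeSymbol (t : ℝ) (ξ : EuclideanSpace ℝ (Fin n)) : ℂ :=
  Complex.exp (Complex.I * (((2 * Real.pi * ‖ξ‖) ^ 2 * t : ℝ) : ℂ))

theorem norm_freeSymbol (t : ℝ) (ξ : EuclideanSpace ℝ (Fin n)) : ‖freeSymbol t ξ‖ = 1 := by
  rw [freeSymbol, mul_comm]; exact Complex.norm_exp_ofReal_mul_I _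

theorem continuous_freeSymbol : Continuous (fun p : ℝ × EuclideanSpace ℝ (Fin n) => freeSymbol p.1 p.2) := by
  unfold freeSymbol; fun_prop

theorem hasDerivAt_freeSymbol_sub (t τ : ℝ) (ξ : EuclideanSpace ℝ (Fin n)) :
    HasDerivAt (fun τ => freeSymbol (t - τ) ξ)
      (-(Complex.I * ((2 * Real.pi * ‖ξ‖) ^ 2 : ℝ)) * freeSymbol (t - τ) ξ) τ := by
  have h1 : HasDerivAt (fun τ : ℝ => (2 * Real.pi * ‖ξ‖) ^ 2 * (t - τ))
      (-(2 * Real.pi * ‖ξ‖) ^ 2) τ :=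
    HasDerivAt.congr_deriv (((hasDerivAt_id τ).const_sub t).const_mul _) (by ring)
  refine HasDerivAt.congr_deriv (f := fun τ => freeSymbol (t - τ) ξ)
    (h1.ofReal_comp.const_mul Complex.I).cexp ?_
  unfold freeSymbol; push_cast; ring

theorem freeEvolution_eq (t : ℝ) (φ : 𝓢(EuclideanSpace ℝ (Fin n), ℂ)) (x : EuclideanSpace ℝ (Fin n)) :
    freeEvolution t φ x = ∫ ξ, wave ξ x * (freeSymbol t ξ * 𝓕 (φ : EuclideanSpace ℝ (Fin n) → ℂ) ξ) := by
  rw [freeEvolution, Real.fourierInv_eq']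
  rfl

theorem integrable_fourier_coe (φ : 𝓢(EuclideanSpace ℝ (Fin n), ℂ)) : Integrable (𝓕 (φ : EuclideanSpace ℝ (Fin n) → ℂ)) := by
  have := (𝓕 φ).integrable (μ := volume)
  rwa [SchwartzMap.fourier_coe] at this

theorem freeEvolution_zero (φ : 𝓢(EuclideanSpace ℝ (Fin n), ℂ)) : freeEvolution 0 φ = φ := by
  have h : freeEvolution 0 φ = 𝓕⁻ (𝓕 (φ : EuclideanSpace ℝ (Fin n) → ℂ)) := by
    unfold freeEvolution
    congr 1; funext ξ; simp
  rw [h, φ.continuous.fourierInv_fourier_eq φ.integrable (integrable_fourier_coe φ)]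

theorem measurable_wave_comp {α : Type*} [MeasurableSpace α] {f g : α → EuclideanSpace ℝ (Fin n)} (hf : Measurable f)
    (hg : Measurable g) : Measurable (fun a => wave (f a) (g a)) := by
  have := continuous_wave (n := n).measurable.comp (hf.prodMk hg)
  exact this

theorem measurable_freeSymbol_comp {α : Type*} [MeasurableSpace α] {f : α → ℝ} {g : α → EuclideanSpace ℝ (Fin n)}
    (hf : Measurable f) (hg : Measurable g) : Measurable (fun a => freeSymbol (f a) (g a)) := by
  have := continuous_freeSymbol (n := n).measurable.comp (hf.prodMk hg)
  exact this

/-- The hypothesis of every use of Fubini below: the oscillating factors have modulus one, so the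
integrand is no larger than a tensor product of integrable functions. -/
theorem integrable_prod_wave {α : Type*} [MeasurableSpace α] {μ : Measure α} [SFinite μ]
    {f : α → ℂ} (hf : Integrable f μ) {p : α → EuclideanSpace ℝ (Fin n)} (hp : Measurable p) {s : α → ℝ}
    (hs : Measurable s) {h : EuclideanSpace ℝ (Fin n) → ℂ} (hh : Integrable h) :
    Integrable (fun z : α × EuclideanSpace ℝ (Fin n) => f z.1 * (wave z.2 (p z.1) * (freeSymbol (s z.1) z.2 * h z.2)))
      (μ.prod volume) := by
  have h1 := (hf.mul_prod hh).mul_bdd (c := 1)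
    (g := fun z : α × EuclideanSpace ℝ (Fin n) => wave z.2 (p z.1) * freeSymbol (s z.1) z.2) ?_
    (Eventually.of_forall fun z => by simp [norm_wave, norm_freeSymbol])
  · refine h1.congr (Eventually.of_forall fun z => ?_)
    dsimp only; ring
  · refine Measurable.aestronglyMeasurable (Measurable.mul ?_ ?_)
    · exact measurable_wave_comp measurable_snd (hp.comp measurable_fst)
    · exact measurable_freeSymbol_comp (hs.comp measurable_fst) measurable_snd

theorem integral_mul_freeEvolution {f : EuclideanSpace ℝ (Fin n) → ℂ} (hf : Integrable f) (t : ℝ) (φ : 𝓢(EuclideanSpace ℝ (Fin n), ℂ)) :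
    ∫ x, f x * freeEvolution t φ x =
      ∫ ξ, (∫ x, f x * wave ξ x) * (freeSymbol t ξ * 𝓕 (φ : EuclideanSpace ℝ (Fin n) → ℂ) ξ) := by
  have h1 := integrable_prod_wave hf measurable_id (measurable_const (a := t))
    (integrable_fourier_coe φ)
  simp_rw [freeEvolution_eq, ← integral_const_mul]
  rw [integral_integral_swap h1]
  refine integral_congr_ae (Eventually.of_forall fun ξ => ?_)
  dsimp only [id]
  rw [← integral_mul_const]
  refine integral_congr_ae (Eventually.of_forall fun x => ?_)
  dsimp only; ring

theorem measurable_freeEvolution (φ : 𝓢(EuclideanSpace ℝ (Fin n), ℂ)) :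
    StronglyMeasurable (fun z : ℝ × EuclideanSpace ℝ (Fin n) => freeEvolution z.1 φ z.2) := by
  simp_rw [freeEvolution_eq]
  have h : Continuous (fun q : (ℝ × EuclideanSpace ℝ (Fin n)) × EuclideanSpace ℝ (Fin n) =>
      wave q.2 q.1.2 * (freeSymbol q.1.1 q.2 * 𝓕 (φ : EuclideanSpace ℝ (Fin n) → ℂ) q.2)) := by
    have h1 : Continuous (𝓕 (φ : EuclideanSpace ℝ (Fin n) → ℂ)) := by
      have := (𝓕 φ).continuous
      rwa [SchwartzMap.fourier_coe] at this
    exact (continuous_wave.comp (continuous_snd.prodMk (continuous_snd.comp continuous_fst))).mul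
      ((continuous_freeSymbol.comp ((continuous_fst.comp continuous_fst).prodMk
        continuous_snd)).mul (h1.comp continuous_snd))
  exact h.stronglyMeasurable.integral_prod_right'

theorem norm_freeEvolution_le (t : ℝ) (φ : 𝓢(EuclideanSpace ℝ (Fin n), ℂ)) (x : EuclideanSpace ℝ (Fin n)) :
    ‖freeEvolution t φ x‖ ≤ ∫ ξ, ‖𝓕 (φ : EuclideanSpace ℝ (Fin n) → ℂ) ξ‖ := by
  rw [freeEvolution_eq]
  refine (norm_integral_le_integral_norm _).trans (le_of_eq ?_)
  refine integral_congr_ae (Eventually.of_forall fun ξ => ?_)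
  simp [norm_wave, norm_freeSymbol]

theorem integrable_mul_wave_mul_freeSymbol {F : ℝ × EuclideanSpace ℝ (Fin n) → ℂ} {I : Set ℝ}
    (hF : Integrable F ((volume.restrict I).prod volume)) (t : ℝ) (ξ : EuclideanSpace ℝ (Fin n)) :
    Integrable (fun z : ℝ × EuclideanSpace ℝ (Fin n) => F z * (wave ξ z.2 * freeSymbol (t - z.1) ξ))
      ((volume.restrict I).prod volume) := by
  refine hF.mul_bdd (c := 1) ?_ (Eventually.of_forall fun z => by
    simp [norm_wave, norm_freeSymbol])
  exact ((measurable_wave_comp measurable_const measurable_snd).mul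
    (measurable_freeSymbol_comp (measurable_const.sub measurable_fst)
      measurable_const)).aestronglyMeasurable

theorem integral_prod_wave {F : ℝ × EuclideanSpace ℝ (Fin n) → ℂ} {I : Set ℝ}
    (hF : Integrable F ((volume.restrict I).prod volume)) (t : ℝ) (ξ : EuclideanSpace ℝ (Fin n)) (c : ℂ) :
    ∫ z : ℝ × EuclideanSpace ℝ (Fin n), F z * (wave ξ z.2 * (freeSymbol (t - z.1) ξ * c)) ∂((volume.restrict I).prod volume)
      = (∫ τ in I, (∫ x, F (τ, x) * wave ξ x) * freeSymbol (t - τ) ξ) * c := by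
  have e : ∀ z : ℝ × EuclideanSpace ℝ (Fin n), F z * (wave ξ z.2 * (freeSymbol (t - z.1) ξ * c)) =
      F z * (wave ξ z.2 * freeSymbol (t - z.1) ξ) * c := fun z => by ring
  rw [integral_congr_ae (Eventually.of_forall e), integral_mul_const,
    integral_prod _ (integrable_mul_wave_mul_freeSymbol hF t ξ)]
  congr 1
  refine integral_congr_ae (Eventually.of_forall fun τ => ?_)
  dsimp only
  rw [← integral_mul_const]
  refine integral_congr_ae (Eventually.of_forall fun x => ?_)
  dsimp only
  ring

theorem integral_mul_freeEvolution_sub {F : ℝ × EuclideanSpace ℝ (Fin n) → ℂ} {I : Set ℝ}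
    (hF : Integrable F ((volume.restrict I).prod volume)) (t : ℝ) (φ : 𝓢(EuclideanSpace ℝ (Fin n), ℂ)) :
    Integrable (fun z : ℝ × EuclideanSpace ℝ (Fin n) => F z * freeEvolution (t - z.1) φ z.2)
      ((volume.restrict I).prod volume) ∧
    Integrable (fun ξ => (∫ τ in I, (∫ x, F (τ, x) * wave ξ x) * freeSymbol (t - τ) ξ) *
      𝓕 (φ : EuclideanSpace ℝ (Fin n) → ℂ) ξ) ∧
    ∫ τ in I, ∫ x, F (τ, x) * freeEvolution (t - τ) φ x =
      ∫ ξ, (∫ τ in I, (∫ x, F (τ, x) * wave ξ x) * freeSymbol (t - τ) ξ) *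
        𝓕 (φ : EuclideanSpace ℝ (Fin n) → ℂ) ξ := by
  have hsub : Measurable (fun z : ℝ × EuclideanSpace ℝ (Fin n) => (t - z.1, z.2)) :=
    (measurable_const.sub measurable_fst).prodMk measurable_snd
  have hmeas := (measurable_freeEvolution φ).measurable.comp hsub
  have hint : Integrable (fun z : ℝ × EuclideanSpace ℝ (Fin n) => F z * freeEvolution (t - z.1) φ z.2)
      ((volume.restrict I).prod volume) :=
    hF.mul_bdd (c := ∫ ξ, ‖𝓕 (φ : EuclideanSpace ℝ (Fin n) → ℂ) ξ‖) hmeas.aestronglyMeasurable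
      (Eventually.of_forall fun z => norm_freeEvolution_le _ _ _)
  have hs : Measurable (fun z : ℝ × EuclideanSpace ℝ (Fin n) => t - z.1) := measurable_const.sub measurable_fst
  have hp := integrable_prod_wave hF measurable_snd hs (integrable_fourier_coe φ)
  refine ⟨hint, ?_, ?_⟩
  · refine hp.integral_prod_right.congr (Eventually.of_forall fun ξ => ?_)
    dsimp only
    rw [integral_prod_wave hF t ξ]
  · rw [integral_integral hint]
    simp_rw [freeEvolution_eq, ← integral_const_mul]
    rw [integral_integral_swap hp]
    refine integral_congr_ae (Eventually.of_forall fun ξ => ?_)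
    dsimp only
    rw [integral_prod_wave hF t ξ]

/-- Fubini writes all three pairings as integrals against `𝓕 φ`, so it suffices to compare the plane
wave coefficients at each `ξ`. There the claim is variation of constants for a scalar linear ODE. -/
theorem isIntegralSolution_of_wave {V : ℝ → EuclideanSpace ℝ (Fin n) → ℝ} {u : ℝ → EuclideanSpace ℝ (Fin n) → ℂ}
    (hu : ∀ t ∈ Icc (0 : ℝ) 1, Integrable (u t))
    (hVu : Integrable (fun z : ℝ × EuclideanSpace ℝ (Fin n) => (V z.1 z.2 : ℂ) * u z.1 z.2)
      ((volume.restrict (Ioo 0 1)).prod volume))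
    (hcont : ∀ ξ : EuclideanSpace ℝ (Fin n), ContinuousOn (fun τ => ∫ x, u τ x * wave ξ x) (Icc 0 1))
    (hder : ∀ ξ : EuclideanSpace ℝ (Fin n), ∀ τ ∈ Ioo (0 : ℝ) 1, HasDerivAt (fun τ => ∫ x, u τ x * wave ξ x)
      (Complex.I * ((2 * Real.pi * ‖ξ‖) ^ 2 : ℝ) * (∫ x, u τ x * wave ξ x) +
        Complex.I * ∫ x, (V τ x : ℂ) * u τ x * wave ξ x) τ) :
    IsIntegralSolution 1 V u := by
  intro t ht φ
  have hsub : Ioo (0 : ℝ) t ⊆ Ioo 0 1 := Ioo_subset_Ioo_right ht.2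
  have hVt : Integrable (fun z : ℝ × EuclideanSpace ℝ (Fin n) => (V z.1 z.2 : ℂ) * u z.1 z.2)
      ((volume.restrict (Ioo 0 t)).prod volume) :=
    hVu.mono_measure (Measure.prod_mono (Measure.restrict_mono hsub le_rfl) le_rfl)
  obtain ⟨hint, i3, e3⟩ := integral_mul_freeEvolution_sub hVt t φ
  refine ⟨hint, ?_⟩
  have h0 := hu 0 ⟨le_rfl, zero_le_one⟩
  have hut := hu t ht
  have e1 : ∫ x, u t x * φ x =
      ∫ ξ, (∫ x, u t x * wave ξ x) * (freeSymbol 0 ξ * 𝓕 (φ : EuclideanSpace ℝ (Fin n) → ℂ) ξ) := by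
    rw [← integral_mul_freeEvolution hut, freeEvolution_zero]
  have e2 := integral_mul_freeEvolution h0 t φ
  have i2 : Integrable (fun ξ => (∫ x, u 0 x * wave ξ x) *
      (freeSymbol t ξ * 𝓕 (φ : EuclideanSpace ℝ (Fin n) → ℂ) ξ)) := by
    refine (integrable_prod_wave h0 measurable_id (measurable_const (a := t))
      (integrable_fourier_coe φ)).integral_prod_right.congr (Eventually.of_forall fun ξ => ?_)
    dsimp only [id]
    rw [← integral_mul_const]
    refine integral_congr_ae (Eventually.of_forall fun x => ?_)
    dsimp only
    ring
  dsimp only at e3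
  rw [e1, e2, e3, ← integral_const_mul, ← integral_add i2 (i3.const_mul _)]
  refine integral_congr_ae (Eventually.of_forall fun ξ => ?_)
  dsimp only
  -- Multiplying by the propagator `freeSymbol (t - τ) ξ` cancels the free term of the ODE and
  -- leaves only the source. Continuity up to the endpoints and integrability of the source suffice,
  -- so the singular time `1` is allowed.
  have hftc := intervalIntegral.integral_eq_sub_of_hasDerivAt_of_le (a := 0) (b := t) ht.1
    (f := fun τ => (∫ x, u τ x * wave ξ x) * freeSymbol (t - τ) ξ)
    (f' := fun τ => Complex.I * ((∫ x, (V τ x : ℂ) * u τ x * wave ξ x) * freeSymbol (t - τ) ξ))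
    ?_ ?_ ?_
  · rw [intervalIntegral.integral_of_le ht.1, integral_Ioc_eq_integral_Ioo, integral_const_mul,
      sub_self, sub_zero, eq_sub_iff_add_eq] at hftc
    rw [← mul_assoc, ← mul_assoc, ← mul_assoc, ← add_mul, ← hftc, add_comm]
  · refine ((hcont ξ).mono (Icc_subset_Icc_right ht.2)).mul fun τ _ => ?_
    exact (hasDerivAt_freeSymbol_sub t τ ξ).continuousAt.continuousWithinAt
  · intro τ hτ
    refine HasDerivAt.congr_deriv ((hder ξ τ (hsub hτ)).mul (hasDerivAt_freeSymbol_sub t τ ξ)) ?_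
    ring
  · rw [intervalIntegrable_iff_integrableOn_Ioo_of_le ht.1]
    refine Integrable.const_mul ?_ _
    refine (integrable_mul_wave_mul_freeSymbol hVt t ξ).integral_prod_left.congr
      (Eventually.of_forall fun τ => ?_)
    dsimp only
    rw [← integral_mul_const]
    refine integral_congr_ae (Eventually.of_forall fun x => ?_)
    dsimp only
    ring

end

/-! ### Measurability -/

theorem measurable_coreE₂ : Measurable coreE₂ :=
  Measurable.ite measurableSet_Iic (by fun_prop) (by fun_prop)

theorem measurable_corePsi₂ : Measurable corePsi₂ :=
  Measurable.ite measurableSet_Iic (by fun_prop) (by fun_prop)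

theorem measurable_farP₂ : Measurable farP₂ :=
  Measurable.ite measurableSet_Iic (by fun_prop) (by fun_prop)

theorem measurable_scale : Measurable scale := continuous_scale.measurable

theorem measurable_scale₁ : Measurable scale₁ := by unfold scale₁; fun_prop

theorem measurable_scale₂ : Measurable scale₂ := by unfold scale₂; fun_prop

section
variable (κ : ℝ)

theorem measurable_denQ : Measurable (fun p : ℝ × ℝ => denQ p.1 p.2) := by
  have h1 := continuous_corePsi.measurable
  have h2 := continuous_farP.measurable
  unfold denQ; fun_prop

theorem measurable_denQ₁ : Measurable (fun p : ℝ × ℝ => denQ₁ p.1 p.2) := by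
  have h1 := continuous_corePsi₁.measurable
  have h2 := continuous_farP₁.measurable
  unfold denQ₁; fun_prop

theorem measurable_denQ₂ : Measurable (fun p : ℝ × ℝ => denQ₂ p.1 p.2) := by
  have h1 := measurable_corePsi₂
  have h2 := measurable_farP₂
  unfold denQ₂; fun_prop

theorem measurable_logAmp : Measurable (fun p : ℝ × ℝ => logAmp κ p.1 p.2) := by
  have h1 := continuous_coreE.measurable
  have h2 := measurable_denQ
  unfold logAmp; fun_prop

theorem measurable_logAmp₁ : Measurable (fun p : ℝ × ℝ => logAmp₁ κ p.1 p.2) := by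
  have h1 := continuous_coreE.measurable
  have h3 := continuous_coreE₁.measurable
  have h2 := measurable_denQ
  have h4 := measurable_denQ₁
  unfold logAmp₁; fun_prop

theorem measurable_logAmp₂ : Measurable (fun p : ℝ × ℝ => logAmp₂ κ p.1 p.2) := by
  have h1 := continuous_coreE.measurable
  have h3 := continuous_coreE₁.measurable
  have h5 := measurable_coreE₂
  have h2 := measurable_denQ
  have h4 := measurable_denQ₁
  have h6 := measurable_denQ₂
  unfold logAmp₂; fun_prop

end

theorem measurable_flowB₂ : Measurable flowB₂ := by
  have h1 := continuous_coreE.measurable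
  have h3 := continuous_coreE₁.measurable
  unfold flowB₂; fun_prop

section
variable {n : ℕ}

theorem measurable_scale_pair : Measurable (fun p : ℝ × ℝ => (scale p.1, p.2)) :=
  (measurable_scale.comp measurable_fst).prodMk measurable_snd

theorem measurable_solRad : Measurable (fun p : ℝ × ℝ => solRad n p.1 p.2) := by
  have h1 := (measurable_logAmp (kap n)).comp measurable_scale_pair
  have h2 := continuous_flowB.measurable
  have h3 := measurable_scale
  have h4 := measurable_scale₁
  have h5 := measurable_logStat (kap n)
  unfold solRad phase
  refine Measurable.ite (measurableSet_lt measurable_fst measurable_const) ?_ (by fun_prop)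
  refine Complex.measurable_exp.comp ((Complex.measurable_ofReal.comp h1).add ?_)
  fun_prop

theorem measurable_solLog₁ : Measurable (fun p : ℝ × ℝ => solLog₁ n p.1 p.2) := by
  have h1 := (measurable_logAmp₁ (kap n)).comp measurable_scale_pair
  have h2 := continuous_flowB₁.measurable
  have h3 := measurable_scale
  have h4 := measurable_scale₁
  unfold solLog₁ phase₁
  refine (Complex.measurable_ofReal.comp h1).add ?_
  fun_prop

theorem measurable_solLog₂ : Measurable (fun p : ℝ × ℝ => solLog₂ n p.1 p.2) := by
  have h1 := (measurable_logAmp₂ (kap n)).comp measurable_scale_pair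
  have h2 := measurable_flowB₂
  have h3 := measurable_scale
  have h4 := measurable_scale₁
  unfold solLog₂ phase₂
  refine (Complex.measurable_ofReal.comp h1).add ?_
  fun_prop

theorem measurable_potRad : Measurable (fun p : ℝ × ℝ => potRad n p.1 p.2) := by
  have h1 := (measurable_logAmp₁ (kap n)).comp measurable_scale_pair
  have h2 := (measurable_logAmp₂ (kap n)).comp measurable_scale_pair
  have h3 := measurable_scale
  have h4 := measurable_scale₁
  have h5 := measurable_scale₂
  have h6 := continuous_flowB₁.measurable
  have h7 := continuous_flowB.measurable
  simp only [Function.comp_def] at h1 h2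
  unfold potRad radV phase₁ phaseTime
  fun_prop

/-! ### The solution and the potential -/

/-- The solution. -/
noncomputable def sol (n : ℕ) (t : ℝ) (x : EuclideanSpace ℝ (Fin n)) : ℂ := solRad n t (‖x‖ ^ 2)

/-- The potential. -/
noncomputable def pot (n : ℕ) (t : ℝ) (x : EuclideanSpace ℝ (Fin n)) : ℝ := potRad n t (‖x‖ ^ 2)

theorem measurable_sol : Measurable (Function.uncurry (sol n)) := by
  have h : Measurable (fun z : ℝ × EuclideanSpace ℝ (Fin n) => (z.1, ‖z.2‖ ^ 2)) := by fun_prop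
  exact measurable_solRad.comp h

theorem measurable_pot : Measurable (Function.uncurry (pot n)) := by
  have h : Measurable (fun z : ℝ × EuclideanSpace ℝ (Fin n) => (z.1, ‖z.2‖ ^ 2)) := by fun_prop
  exact measurable_potRad.comp h

theorem measurable_radial_slice {β : Type*} [MeasurableSpace β] {F : ℝ × ℝ → β}
    (hF : Measurable F) (t : ℝ) :
    Measurable (fun x : EuclideanSpace ℝ (Fin n) => F (t, ‖x‖ ^ 2)) := by
  have h : Measurable (fun x : EuclideanSpace ℝ (Fin n) => (t, ‖x‖ ^ 2)) := by fun_prop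
  exact hF.comp h

theorem measurable_sol_slice (t : ℝ) : Measurable (sol n t) :=
  measurable_radial_slice (F := fun p : ℝ × ℝ => solRad n p.1 p.2) measurable_solRad t

theorem measurable_pot_slice (t : ℝ) : Measurable (pot n t) :=
  measurable_radial_slice (F := fun p : ℝ × ℝ => potRad n p.1 p.2) measurable_potRad t

theorem measurable_solLog₁_slice (t : ℝ) :
    Measurable (fun x : EuclideanSpace ℝ (Fin n) => solLog₁ n t (‖x‖ ^ 2)) :=
  measurable_radial_slice (F := fun p : ℝ × ℝ => solLog₁ n p.1 p.2) measurable_solLog₁ t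

theorem measurable_solLog₂_slice (t : ℝ) :
    Measurable (fun x : EuclideanSpace ℝ (Fin n) => solLog₂ n t (‖x‖ ^ 2)) :=
  measurable_radial_slice (F := fun p : ℝ × ℝ => solLog₂ n p.1 p.2) measurable_solLog₂ t

/-- An integrable majorant of all the time slices of the solution. -/
noncomputable def solBound (n : ℕ) (x : EuclideanSpace ℝ (Fin n)) : ℝ :=
  64 ^ kap n * (‖x‖ ^ (-(n / 2 : ℝ)) * (1 + ‖x‖ ^ 2) ^ (-(3 * kap n)))

theorem ae_ne_zero (hn : 2 ≤ n) : ∀ᵐ x : EuclideanSpace ℝ (Fin n), x ≠ 0 := by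
  have hnt : Nontrivial (EuclideanSpace ℝ (Fin n)) := by
    apply Module.nontrivial_of_finrank_pos (R := ℝ); rw [finrank_euclideanSpace_fin]; omega
  simp [ae_iff, measure_singleton]

theorem sq_rpow (r : ℝ) (hr : 0 ≤ r) (p : ℝ) : (r ^ 2) ^ p = r ^ (2 * p) := by
  rw [← Real.rpow_natCast, ← Real.rpow_mul hr]; norm_num

theorem norm_sol_le {t : ℝ} (h0 : 0 ≤ t) (h : t ≤ 1) {x : EuclideanSpace ℝ (Fin n)} (hx : x ≠ 0) :
    ‖sol n t x‖ ≤ solBound n x := by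
  have hx' : 0 < ‖x‖ := norm_pos_iff.2 hx
  have := norm_solRad_le' (n := n) h0 h (show 0 < ‖x‖ ^ 2 by positivity)
  rw [sq_rpow _ hx'.le] at this
  refine this.trans (le_of_eq ?_)
  rw [solBound]; congr 3; ring

theorem three_mul_kap_gt (hn : 2 ≤ n) : (n : ℝ) / 2 < 3 * kap n := by
  have hn' : (2 : ℝ) ≤ n := by exact_mod_cast hn
  unfold kap; linarith

theorem integrable_solBound (hn : 2 ≤ n) : Integrable (solBound n) := by
  have hn' : (2 : ℝ) ≤ n := by exact_mod_cast hn
  exact (integrable_norm_rpow_mul hn (by positivity) (by linarith) (three_mul_kap_gt hn)).const_mul _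

theorem integrable_sol (hn : 2 ≤ n) {t : ℝ} (ht : t ∈ Icc (0 : ℝ) 1) : Integrable (sol n t) := by
  refine (integrable_solBound hn).mono' (measurable_sol_slice t).aestronglyMeasurable ?_
  filter_upwards [ae_ne_zero hn] with x hx using norm_sol_le ht.1 ht.2 hx

/-! ### Integrability of the interaction -/

/-- Apply `log x ≤ x - 1` to `x = τ^(-δ)`. -/
theorem one_sub_log_le {τ δ : ℝ} (hτ : 0 < τ) (hδ : 0 < δ) (hδ1 : δ ≤ 1) :
    1 - Real.log τ ≤ δ⁻¹ * τ ^ (-δ) := by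
  have h1 := Real.log_le_sub_one_of_pos (Real.rpow_pos_of_pos hτ (-δ))
  rw [Real.log_rpow hτ] at h1
  have h2 : δ * (1 - Real.log τ) ≤ τ ^ (-δ) := by nlinarith
  calc 1 - Real.log τ = δ⁻¹ * (δ * (1 - Real.log τ)) := by field_simp
    _ ≤ _ := by gcongr

theorem scale_rpow {t : ℝ} (h : t < 1) (p : ℝ) : scale t ^ p = (1 - t) ^ (5 / 4 * p) := by
  rw [scale, ← Real.rpow_mul (by linarith)]

/-- The threshold `4/5` is the reciprocal of the exponent in `scale`. -/
theorem integrableOn_scale_rpow {β : ℝ} (hβ : β < 4 / 5) :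
    IntegrableOn (fun t => scale t ^ (-β)) (Ioo 0 1) := by
  have h1 : IntervalIntegrable (fun x : ℝ => x ^ (5 / 4 * -β)) volume 0 1 :=
    intervalIntegral.intervalIntegrable_rpow' (by linarith)
  have h2 := h1.comp_sub_left 1
  simp only [sub_zero, sub_self] at h2
  have h3 := (intervalIntegrable_iff_integrableOn_Ioo_of_le (zero_le_one' ℝ)).1 h2.symm
  refine h3.congr_fun (fun t ht => ?_) measurableSet_Ioo
  exact (scale_rpow ht.2 _).symm

theorem integrableOn_log_sq_mul_scale {β : ℝ} (hβ : β < 4 / 5) :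
    IntegrableOn (fun t => (1 - Real.log (scale t)) ^ 2 * scale t ^ (-β)) (Ioo 0 1) := by
  -- Each logarithm costs `τ^(-δ)`; a quarter of the available gap leaves room for two of them.
  obtain ⟨δ, hδ0, hδ1, hδ⟩ : ∃ δ : ℝ, 0 < δ ∧ δ ≤ 1 ∧ 2 * δ + β < 4 / 5 :=
    ⟨min 1 ((4 / 5 - β) / 4), by apply lt_min <;> linarith, min_le_left _ _, by
      have := min_le_right 1 ((4 / 5 - β) / 4); linarith⟩
  refine Integrable.mono' ((integrableOn_scale_rpow hδ).const_mul ((δ⁻¹) ^ 2)) ?_ ?_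
  · have := measurable_scale
    exact Measurable.aestronglyMeasurable (by fun_prop)
  · filter_upwards [ae_restrict_mem measurableSet_Ioo] with t ht
    have hτ := scale_pos ht.2
    have hL := one_le_one_sub_log hτ (scale_le_one ht.1.le ht.2)
    rw [Real.norm_of_nonneg (by positivity)]
    calc (1 - Real.log (scale t)) ^ 2 * scale t ^ (-β) ≤
        (δ⁻¹ * scale t ^ (-δ)) ^ 2 * scale t ^ (-β) := by
          gcongr; exact one_sub_log_le hτ hδ0 hδ1
      _ = (δ⁻¹) ^ 2 * (scale t ^ (-(2 * δ)) * scale t ^ (-β)) := by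
          rw [mul_pow, ← Real.rpow_natCast (scale t ^ (-δ)) 2, ← Real.rpow_mul hτ.le, mul_assoc]
          congr 3; push_cast; ring
      _ = _ := by rw [← Real.rpow_add hτ]; congr 2; ring

/-- The weights balance two singularities of the interaction: `τ^(-3/4)` is integrable in time since
`3/4 < 4/5`, with room for logarithms, and the extra `|x|^(-1/2)` on top of `|x|^(-n/2)` is
integrable in space since `n ≥ 2`. -/
theorem inv_add_le {τ y : ℝ} (hτ : 0 < τ) (hy : 0 < y) :
    (y + τ)⁻¹ ≤ τ ^ (-(3 / 4) : ℝ) * y ^ (-(1 / 4) : ℝ) := by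
  have h1 : τ ^ (3 / 4 : ℝ) * y ^ (1 / 4 : ℝ) ≤ y + τ := by
    calc τ ^ (3 / 4 : ℝ) * y ^ (1 / 4 : ℝ) ≤ (y + τ) ^ (3 / 4 : ℝ) * (y + τ) ^ (1 / 4 : ℝ) := by
          gcongr <;> linarith
      _ = y + τ := by rw [← Real.rpow_add (by linarith)]; norm_num
  rw [Real.rpow_neg hτ.le, Real.rpow_neg hy.le, ← mul_inv]
  gcongr

theorem integrable_pot_mul_sol (hn : 2 ≤ n) :
    Integrable (fun z : ℝ × EuclideanSpace ℝ (Fin n) => (pot n z.1 z.2 : ℂ) * sol n z.1 z.2)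
      ((volume.restrict (Ioo 0 1)).prod volume) := by
  have hn' : (2 : ℝ) ≤ n := by exact_mod_cast hn
  obtain ⟨C, hC, hpot⟩ := abs_potRad_le (n := n)
  have i1 : Integrable (fun t => C * ((1 - Real.log (scale t)) ^ 2 * scale t ^ (-(3 / 4) : ℝ)))
      (volume.restrict (Ioo 0 1)) := (integrableOn_log_sq_mul_scale (by norm_num)).const_mul C
  have i2 : Integrable (fun x : EuclideanSpace ℝ (Fin n) =>
      64 ^ kap n * (‖x‖ ^ (-(n / 2 + 1 / 2) : ℝ) * (1 + ‖x‖ ^ 2) ^ (-(3 * kap n)))) :=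
    (integrable_norm_rpow_mul hn (by positivity) (by linarith) (three_mul_kap_gt hn)).const_mul _
  refine Integrable.mono' (i1.mul_prod i2) ?_ ?_
  · have h1 := measurable_sol (n := n)
    have h2 := measurable_pot (n := n)
    exact ((Complex.measurable_ofReal.comp h2).mul h1).aestronglyMeasurable
  · have hae : ∀ᵐ z : ℝ × EuclideanSpace ℝ (Fin n)
        ∂((volume.restrict (Ioo 0 1)).prod volume), z.1 ∈ Ioo (0 : ℝ) 1 :=
      Measure.quasiMeasurePreserving_fst.ae (ae_restrict_mem measurableSet_Ioo)
    have hae2 : ∀ᵐ z : ℝ × EuclideanSpace ℝ (Fin n)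
        ∂((volume.restrict (Ioo 0 1)).prod volume), z.2 ≠ 0 :=
      Measure.quasiMeasurePreserving_snd.ae (ae_ne_zero hn)
    filter_upwards [hae, hae2] with z hz hx
    obtain ⟨t, x⟩ := z
    dsimp only at hz hx ⊢
    have hx' : 0 < ‖x‖ := norm_pos_iff.2 hx
    have hτ := scale_pos hz.2
    have b1 := hpot t (‖x‖ ^ 2) hz.1.le hz.2 (by positivity)
    have b2 := norm_sol_le hz.1.le hz.2.le hx
    have b3 := inv_add_le hτ (show 0 < ‖x‖ ^ 2 by positivity)
    rw [sq_rpow _ hx'.le] at b3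
    rw [norm_mul, Complex.norm_real, Real.norm_eq_abs]
    have e : ‖x‖ ^ (-(n / 2 + 1 / 2) : ℝ) = ‖x‖ ^ (2 * -(1 / 4) : ℝ) * ‖x‖ ^ (-(n / 2 : ℝ)) := by
      rw [← Real.rpow_add hx']; congr 1; ring
    calc |pot n t x| * ‖sol n t x‖ ≤
        (C * (1 - Real.log (scale t)) ^ 2 *
          (scale t ^ (-(3 / 4) : ℝ) * ‖x‖ ^ (2 * -(1 / 4) : ℝ))) * solBound n x := by
          refine mul_le_mul (b1.trans ?_) b2 (norm_nonneg _) (by positivity)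
          rw [div_eq_mul_inv]; gcongr
      _ = _ := by rw [solBound, e]; ring

/-! ### The coefficients of the solution along plane waves -/

/-- At a fixed `y > 0` the solution is constant in time once `scale t < y`, so continuity at `t = 1`
is immediate. -/
theorem continuousOn_solRad_time {y : ℝ} (hy : 0 < y) :
    ContinuousOn (fun t => solRad n t y) (Icc 0 1) := by
  intro t ht
  rcases ht.2.lt_or_eq with h | rfl
  · exact (hasDerivAt_solRad_time ht.1 h hy.le).continuousAt.continuousWithinAt
  · have h0 : scale 1 = 0 := by simp [scale]
    have h1 : ∀ᶠ t in 𝓝 (1 : ℝ), scale t < y :=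
      continuous_scale.continuousAt.eventually (gt_mem_nhds (by rw [h0]; exact hy))
    have h2 : (fun t => solRad n t y) =ᶠ[𝓝 1] fun _ => Complex.exp (logStat (kap n) y : ℂ) := by
      filter_upwards [h1] with t ht
      by_cases h : t < 1
      · exact solRad_of_scale_le h ht.le
      · rw [solRad, if_neg h]
    exact (continuousAt_const.congr h2.symm).continuousWithinAt

theorem continuousOn_integral_sol_mul_wave (hn : 2 ≤ n) (ξ : EuclideanSpace ℝ (Fin n)) :
    ContinuousOn (fun t => ∫ x, sol n t x * wave ξ x) (Icc 0 1) := by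
  refine continuousOn_of_dominated (bound := solBound n) ?_ ?_ (integrable_solBound hn) ?_
  · intro t ht
    exact ((measurable_sol_slice t).mul (continuous_wave_right ξ).measurable).aestronglyMeasurable
  · intro t ht
    filter_upwards [ae_ne_zero hn] with x hx
    rw [norm_mul, norm_wave, mul_one]
    exact norm_sol_le ht.1 ht.2 hx
  · filter_upwards [ae_ne_zero hn] with x hx
    have hx' : 0 < ‖x‖ := norm_pos_iff.2 hx
    exact (continuousOn_solRad_time (by positivity)).mul continuousOn_const

theorem integrable_mul_sol (hn : 2 ≤ n) {t C : ℝ} (ht : t ∈ Icc (0 : ℝ) 1)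
    {f : EuclideanSpace ℝ (Fin n) → ℂ} (hf : Measurable f) (hC : ∀ x, ‖f x‖ ≤ C) :
    Integrable (fun x => f x * sol n t x) :=
  (integrable_sol hn ht).bdd_mul (c := C) hf.aestronglyMeasurable (Eventually.of_forall hC)

theorem integral_laplacian_sol_mul_wave (hn : 2 ≤ n) {t : ℝ} (h0 : 0 ≤ t) (h : t < 1)
    (ξ : EuclideanSpace ℝ (Fin n)) :
    Integrable (fun x : EuclideanSpace ℝ (Fin n) =>
      (4 * (‖x‖ ^ 2 : ℝ) * (solLog₂ n t (‖x‖ ^ 2) + solLog₁ n t (‖x‖ ^ 2) ^ 2) +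
        2 * n * solLog₁ n t (‖x‖ ^ 2)) * sol n t x * wave ξ x) ∧
    ∫ x : EuclideanSpace ℝ (Fin n),
      (4 * (‖x‖ ^ 2 : ℝ) * (solLog₂ n t (‖x‖ ^ 2) + solLog₁ n t (‖x‖ ^ 2) ^ 2) +
        2 * n * solLog₁ n t (‖x‖ ^ 2)) * sol n t x * wave ξ x =
      -((2 * Real.pi * ‖ξ‖) ^ 2 : ℝ) * ∫ x, sol n t x * wave ξ x := by
  obtain ⟨C₁, hC₁, b₁⟩ := norm_solLog₁_le (n := n)
  obtain ⟨C₂, hC₂, b₂⟩ := norm_solLog₂_le (n := n)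
  have ht : t ∈ Icc (0 : ℝ) 1 := ⟨h0, h.le⟩
  have hτ := scale_pos h
  have hτ1 := scale_le_one h0 h
  have hL := one_le_one_sub_log hτ hτ1
  have m1 := measurable_solLog₁_slice (n := n) t
  have m2 := measurable_solLog₂_slice (n := n) t
  have c1 : ∀ x : EuclideanSpace ℝ (Fin n),
      ‖solLog₁ n t (‖x‖ ^ 2)‖ ≤ C₁ * (1 - Real.log (scale t)) / scale t := fun x => by
    refine (b₁ t _ h0 h (sq_nonneg _)).trans ?_
    gcongr; linarith [sq_nonneg ‖x‖]
  have c1' : ∀ x : EuclideanSpace ℝ (Fin n),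
      ‖(‖x‖ : ℂ) * solLog₁ n t (‖x‖ ^ 2)‖ ≤ C₁ * (1 - Real.log (scale t)) / scale t := fun x => by
    rw [norm_mul, Complex.norm_real, norm_norm]
    calc ‖x‖ * ‖solLog₁ n t (‖x‖ ^ 2)‖ ≤
        ‖x‖ * (C₁ * (1 - Real.log (scale t)) / (‖x‖ ^ 2 + scale t)) := by
          gcongr; exact b₁ t _ h0 h (sq_nonneg _)
      _ = C₁ * (1 - Real.log (scale t)) * (‖x‖ / (‖x‖ ^ 2 + scale t)) := by ring
      _ ≤ C₁ * (1 - Real.log (scale t)) * (1 / scale t) := by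
          refine mul_le_mul_of_nonneg_left ?_ (by positivity)
          rw [div_le_div_iff₀ (by positivity) hτ]
          -- From `2‖x‖ ≤ 1 + ‖x‖²` and `τ ≤ 1`.
          nlinarith [mul_nonneg hτ.le (sq_nonneg (‖x‖ - 1)),
            mul_nonneg (sub_nonneg.2 hτ1) (sq_nonneg ‖x‖), sq_nonneg ‖x‖]
      _ = _ := by ring
  have c2 : ∀ x : EuclideanSpace ℝ (Fin n),
      ‖((‖x‖ ^ 2 : ℝ) : ℂ) * (solLog₂ n t (‖x‖ ^ 2) + solLog₁ n t (‖x‖ ^ 2) ^ 2)‖ ≤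
        (C₂ * (1 - Real.log (scale t)) ^ 2 + (C₁ * (1 - Real.log (scale t))) ^ 2) / scale t :=
      fun x => by
    have hS : 0 < ‖x‖ ^ 2 + scale t := by positivity
    rw [norm_mul, Complex.norm_real, Real.norm_of_nonneg (sq_nonneg _)]
    calc ‖x‖ ^ 2 * ‖solLog₂ n t (‖x‖ ^ 2) + solLog₁ n t (‖x‖ ^ 2) ^ 2‖ ≤
        (‖x‖ ^ 2 + scale t) * (C₂ * (1 - Real.log (scale t)) ^ 2 / (‖x‖ ^ 2 + scale t) ^ 2 +
          (C₁ * (1 - Real.log (scale t)) / (‖x‖ ^ 2 + scale t)) ^ 2) := by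
          gcongr
          · linarith
          · refine (norm_add_le _ _).trans (add_le_add (b₂ t _ h0 h (sq_nonneg _)) ?_)
            rw [norm_pow]; gcongr; exact b₁ t _ h0 h (sq_nonneg _)
      _ = (C₂ * (1 - Real.log (scale t)) ^ 2 + (C₁ * (1 - Real.log (scale t))) ^ 2) /
          (‖x‖ ^ 2 + scale t) := by field_simp
      _ ≤ _ := by gcongr; linarith [sq_nonneg ‖x‖]
  have i1 := integrable_mul_sol hn ht m1 c1
  have i2 := integrable_mul_sol hn ht (f := fun x : EuclideanSpace ℝ (Fin n) =>
    ((‖x‖ ^ 2 : ℝ) : ℂ) * (solLog₂ n t (‖x‖ ^ 2) + solLog₁ n t (‖x‖ ^ 2) ^ 2)) (by fun_prop) c2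
  refine ⟨?_, ?_⟩
  · refine integrable_mul_wave (((i2.const_mul 4).add (i1.const_mul (2 * n))).congr
      (Eventually.of_forall fun x => ?_)) ξ
    simp only [Pi.add_apply]; ring
  · have hk := integral_radial_laplacian_mul_wave (n := n)
      (fun y hy => hasDerivAt_solRad (n := n) h0 h hy)
      (fun y hy => hasDerivAt_solRad₁ (n := n) h0 h hy) (integrable_sol hn ht) i1
      ((integrable_mul_sol hn ht (f := fun x : EuclideanSpace ℝ (Fin n) =>
        (‖x‖ : ℂ) * solLog₁ n t (‖x‖ ^ 2)) (by fun_prop) c1').congr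
        (Eventually.of_forall fun x => by dsimp only [sol]; ring))
      (((m2.add (m1.pow_const 2)).mul (measurable_sol_slice t)).aestronglyMeasurable)
      (i2.congr (Eventually.of_forall fun x => by dsimp only [sol]; ring)) ξ
    rw [← show (∫ x : EuclideanSpace ℝ (Fin n), solRad n t (‖x‖ ^ 2) * wave ξ x) =
      ∫ x, sol n t x * wave ξ x from rfl, ← hk]
    refine integral_congr_ae (Eventually.of_forall fun x => ?_)
    dsimp only [sol]; ring

theorem hasDerivAt_integral_sol_mul_wave (hn : 2 ≤ n) (ξ : EuclideanSpace ℝ (Fin n)) {t : ℝ}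
    (ht : t ∈ Ioo (0 : ℝ) 1) :
    HasDerivAt (fun t => ∫ x, sol n t x * wave ξ x)
      (Complex.I * ((2 * Real.pi * ‖ξ‖) ^ 2 : ℝ) * (∫ x, sol n t x * wave ξ x) +
        Complex.I * ∫ x, (pot n t x : ℂ) * sol n t x * wave ξ x) t := by
  obtain ⟨C, hC, hb⟩ := norm_solLogTime_le (n := n)
  obtain ⟨Cp, hCp, hpot⟩ := abs_potRad_le (n := n)
  -- Staying before `T < 1` makes the bound on the logarithmic time derivative uniform.
  set T := (1 + t) / 2 with hT
  have htT : t < T := by rw [hT]; linarith [ht.2]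
  have hT1 : T < 1 := by rw [hT]; linarith [ht.2]
  have hT0 : 0 < T := ht.1.trans htT
  have hτT := scale_pos hT1
  have hLT := one_le_one_sub_log hτT (scale_le_one hT0.le hT1)
  have hkey := hasDerivAt_integral_of_dominated_loc_of_deriv_le
    (μ := (volume : Measure (EuclideanSpace ℝ (Fin n))))
    (F := fun t x => sol n t x * wave ξ x)
    (F' := fun t x => solLogTime n t (‖x‖ ^ 2) * sol n t x * wave ξ x) (x₀ := t)
    (s := Ioo 0 T) (bound := fun x => C * (1 - Real.log (scale T)) ^ 2 / scale T * solBound n x)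
    (Ioo_mem_nhds ht.1 htT) ?_ ?_ ?_ ?_ ?_ ?_
  · have hmain := hkey.2
    obtain ⟨li, le⟩ := integral_laplacian_sol_mul_wave hn ht.1.le ht.2 ξ
    have hτ := scale_pos ht.2
    have ip : Integrable (fun x => (pot n t x : ℂ) * sol n t x * wave ξ x) := by
      refine integrable_mul_wave (integrable_mul_sol hn ⟨ht.1.le, ht.2.le⟩
        (C := Cp * (1 - Real.log (scale t)) ^ 2 / scale t) ?_ fun x => ?_) ξ
      · exact Complex.measurable_ofReal.comp (measurable_pot_slice t)
      · rw [Complex.norm_real, Real.norm_eq_abs]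
        refine (hpot t _ ht.1.le ht.2 (sq_nonneg _)).trans ?_
        gcongr; linarith [sq_nonneg ‖x‖]
    refine HasDerivAt.congr_deriv hmain ?_
    have e : ∀ x : EuclideanSpace ℝ (Fin n), solLogTime n t (‖x‖ ^ 2) * sol n t x * wave ξ x =
        -Complex.I * ((4 * (‖x‖ ^ 2 : ℝ) * (solLog₂ n t (‖x‖ ^ 2) + solLog₁ n t (‖x‖ ^ 2) ^ 2) +
        2 * n * solLog₁ n t (‖x‖ ^ 2)) * sol n t x * wave ξ x) +
        Complex.I * ((pot n t x : ℂ) * sol n t x * wave ξ x) := fun x => by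
      rw [solLogTime_eq ht.1.le ht.2 (sq_nonneg _), pot]; ring
    rw [integral_congr_ae (Eventually.of_forall e), integral_add (li.const_mul _) (ip.const_mul _),
      integral_const_mul, integral_const_mul, le]
    ring
  · exact Eventually.of_forall fun s =>
      ((measurable_sol_slice s).mul (continuous_wave_right ξ).measurable).aestronglyMeasurable
  · exact integrable_mul_wave (integrable_sol hn ⟨ht.1.le, ht.2.le⟩) ξ
  · have m : Measurable (fun x : EuclideanSpace ℝ (Fin n) => solLogTime n t (‖x‖ ^ 2)) := by
      have m1 := measurable_solLog₁_slice (n := n) t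
      have m2 := measurable_solLog₂_slice (n := n) t
      have m3 : Measurable (fun x : EuclideanSpace ℝ (Fin n) => potRad n t (‖x‖ ^ 2)) :=
        measurable_pot_slice t
      have e : (fun x : EuclideanSpace ℝ (Fin n) => solLogTime n t (‖x‖ ^ 2)) = fun x => _ :=
        funext fun x => solLogTime_eq ht.1.le ht.2 (sq_nonneg ‖x‖)
      rw [e]; fun_prop
    exact ((m.mul (measurable_sol_slice t)).mul
      (continuous_wave_right ξ).measurable).aestronglyMeasurable
  · filter_upwards [ae_ne_zero hn] with x hx s hs
    have hs1 : s < 1 := hs.2.trans hT1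
    have hτ := scale_pos hs1
    have hle := scale_anti hs.2.le hT1
    have hL := one_le_one_sub_log hτ (scale_le_one hs.1.le hs1)
    rw [norm_mul, norm_mul, norm_wave, mul_one]
    refine mul_le_mul ((hb s _ hs.1.le hs1 (sq_nonneg _)).trans ?_)
      (norm_sol_le hs.1.le hs1.le hx) (norm_nonneg _) (by positivity)
    have hlog : Real.log (scale T) ≤ Real.log (scale s) := Real.log_le_log hτT hle
    gcongr
    linarith [sq_nonneg ‖x‖]
  · exact (integrable_solBound hn).const_mul _
  · filter_upwards with x s hs
    exact (hasDerivAt_solRad_time hs.1.le (hs.2.trans hT1) (sq_nonneg _)).mul_const _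

theorem isIntegralSolution_sol (hn : 2 ≤ n) : IsIntegralSolution 1 (pot n) (sol n) :=
  isIntegralSolution_of_wave (fun _ ht => integrable_sol hn ht) (integrable_pot_mul_sol hn)
    (continuousOn_integral_sol_mul_wave hn)
    fun ξ _ hτ => hasDerivAt_integral_sol_mul_wave hn ξ hτ

end

/-! ### The potential belongs to the mixed space -/

section
variable {n : ℕ}

/-- The pointwise bound by `1/(|x|² + τ)` lies in `L^s` because `2s > n`, and scaling gives the
power of `τ`. -/
theorem eLpNorm_pot_le (n : ℕ) {s : ℝ} (hs0 : 0 < s) (hs : (n : ℝ) / 2 < s) :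
    ∃ C : ℝ, 0 ≤ C ∧ ∀ t ∈ Ioo (0 : ℝ) 1, eLpNorm (pot n t) (ENNReal.ofReal s) volume ≤
      ENNReal.ofReal (C * ((1 - Real.log (scale t)) ^ 2 * scale t ^ (n / (2 * s) - 1))) := by
  obtain ⟨C, hC, hV⟩ := abs_potRad_le (n := n)
  have hK : 0 ≤ ∫ x : EuclideanSpace ℝ (Fin n), (1 + ‖x‖ ^ 2) ^ (-s) :=
    integral_nonneg fun x => by positivity
  set K := ∫ x : EuclideanSpace ℝ (Fin n), (1 + ‖x‖ ^ 2) ^ (-s) with hKdef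
  refine ⟨C * K ^ (1 / s), by positivity, fun t ht => ?_⟩
  have hτ := scale_pos ht.2
  set τ := scale t
  set M := C * (1 - Real.log τ) ^ 2 with hM
  have hM0 : 0 ≤ M := by positivity
  obtain ⟨hi, he⟩ := integrable_add_norm_sq (n := n) hτ hs
  have step : eLpNorm (pot n t) (ENNReal.ofReal s) volume ≤
      eLpNorm (fun x : EuclideanSpace ℝ (Fin n) => M * (‖x‖ ^ 2 + τ)⁻¹)
        (ENNReal.ofReal s) volume := by
    refine eLpNorm_mono_ae_real (Eventually.of_forall fun x => ?_)
    have := hV t (‖x‖ ^ 2) ht.1.le ht.2 (by positivity)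
    rw [div_eq_mul_inv] at this
    exact this
  refine step.trans (le_of_eq ?_)
  rw [eLpNorm_eq_lintegral_rpow_enorm_toReal (by simpa using hs0) ENNReal.ofReal_ne_top,
    ENNReal.toReal_ofReal hs0.le]
  have e1 : ∀ x : EuclideanSpace ℝ (Fin n), ‖M * (‖x‖ ^ 2 + τ)⁻¹‖ₑ ^ s =
      ENNReal.ofReal (M ^ s * (‖x‖ ^ 2 + τ) ^ (-s)) := fun x => by
    have hp : 0 < ‖x‖ ^ 2 + τ := by positivity
    rw [Real.enorm_of_nonneg (by positivity), ENNReal.ofReal_rpow_of_nonneg (by positivity) hs0.le,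
      Real.mul_rpow hM0 (by positivity), Real.inv_rpow hp.le, Real.rpow_neg hp.le]
  simp_rw [e1]
  rw [← ofReal_integral_eq_lintegral_ofReal (hi.const_mul _)
    (Eventually.of_forall fun x => by positivity), integral_const_mul, he,
    ENNReal.ofReal_rpow_of_nonneg (by positivity) (by positivity)]
  congr 1
  rw [Real.mul_rpow (x := M ^ s) (by positivity) (by positivity),
    Real.mul_rpow (x := τ ^ ((n : ℝ) / 2 - s)) (by positivity) hK,
    ← Real.rpow_mul hM0, ← Real.rpow_mul hτ.le, mul_one_div_cancel hs0.ne', Real.rpow_one,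
    show ((n : ℝ) / 2 - s) * (1 / s) = n / (2 * s) - 1 by field_simp, hM]
  ring

theorem memMixed_pot (hn : 2 ≤ n) {r s : ℝ} (hr : 1 ≤ r) (hs₁ : (n : ℝ) / 2 < s)
    (hrs : 1 / (2 * r) + n / (2 * s) > 1) :
    MemMixed (Ioo 0 1) (ENNReal.ofReal r) (ENNReal.ofReal s) (pot n) := by
  refine ⟨measurable_pot.aestronglyMeasurable, ?_⟩
  have hr0 : 0 < r := by linarith
  have hn' : (2 : ℝ) ≤ n := by exact_mod_cast hn
  have hs0 : 0 < s := by linarith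
  obtain ⟨C, hC, hV⟩ := eLpNorm_pot_le n hs0 hs₁
  unfold mixedNorm
  rw [eLpNorm_eq_lintegral_rpow_enorm_toReal (by simpa using hr0) ENNReal.ofReal_ne_top,
    ENNReal.toReal_ofReal hr0.le]
  refine ENNReal.rpow_lt_top_of_nonneg (by positivity) (ne_of_lt ?_)
  -- The two logarithms cost `2δr ≤ 1/10` in the exponent and the scaling less than `1/2`; the total
  -- is below the threshold `4/5`.
  set δ : ℝ := min 1 (1 / (20 * r)) with hδ
  have hδ0 : 0 < δ := lt_min one_pos (by positivity)
  have hδ1 : δ ≤ 1 := min_le_left _ _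
  have hδr : δ * r ≤ 1 / 20 := by
    calc δ * r ≤ 1 / (20 * r) * r := by gcongr; exact min_le_right _ _
      _ = 1 / 20 := by field_simp
  set θ : ℝ := n / (2 * s) - 1 with hθ
  have hθr : -(θ * r) < 1 / 2 := by
    have h1 : -θ < 1 / (2 * r) := by rw [hθ]; linarith
    calc -(θ * r) = -θ * r := by ring
      _ < 1 / (2 * r) * r := by gcongr
      _ = 1 / 2 := by field_simp
  have hint : IntegrableOn (fun t => (C * (δ⁻¹) ^ 2) ^ r * scale t ^ (-(2 * (δ * r) - θ * r)))
      (Ioo 0 1) := (integrableOn_scale_rpow (by linarith)).const_mul _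
  refine lt_of_le_of_lt (setLIntegral_mono' measurableSet_Ioo fun t ht => ?_)
    hint.lintegral_lt_top
  have hτ := scale_pos ht.2
  have hL := one_le_one_sub_log hτ (scale_le_one ht.1.le ht.2)
  have hLδ := one_sub_log_le hτ hδ0 hδ1
  rw [enorm_eq_self]
  calc eLpNorm (pot n t) (ENNReal.ofReal s) volume ^ r
      ≤ ENNReal.ofReal (C * ((1 - Real.log (scale t)) ^ 2 * scale t ^ θ)) ^ r :=
        ENNReal.rpow_le_rpow (hV t ht) hr0.le
    _ = ENNReal.ofReal ((C * ((1 - Real.log (scale t)) ^ 2 * scale t ^ θ)) ^ r) :=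
        ENNReal.ofReal_rpow_of_nonneg (by positivity) hr0.le
    _ ≤ _ := by
      apply ENNReal.ofReal_le_ofReal
      have h2 : (1 - Real.log (scale t)) ^ 2 ≤ (δ⁻¹ * scale t ^ (-δ)) ^ 2 :=
        pow_le_pow_left₀ (by linarith) hLδ 2
      have h3 : C * ((1 - Real.log (scale t)) ^ 2 * scale t ^ θ) ≤
          (C * (δ⁻¹) ^ 2) * scale t ^ (-(2 * δ - θ)) := by
        have h4 : scale t ^ (-(2 * δ - θ)) = (scale t ^ (-δ)) ^ 2 * scale t ^ θ := by
          rw [← Real.rpow_natCast, ← Real.rpow_mul hτ.le, ← Real.rpow_add hτ]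
          congr 1; push_cast; ring
        rw [h4]
        calc _ ≤ C * ((δ⁻¹ * scale t ^ (-δ)) ^ 2 * scale t ^ θ) :=
              mul_le_mul_of_nonneg_left (mul_le_mul_of_nonneg_right h2 (by positivity)) hC
          _ = _ := by ring
      refine (Real.rpow_le_rpow (by positivity) h3 hr0.le).trans (le_of_eq ?_)
      rw [Real.mul_rpow (by positivity) (by positivity), ← Real.rpow_mul hτ.le]
      congr 2; ring

/-! ### Strichartz norms away from the final time -/

theorem eLpNorm_majorant_lt_top (hn : 2 ≤ n) {q : ℝ≥0∞} (hq : 1 ≤ q) (hq' : q ≠ ∞) (c : ℝ) :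
    eLpNorm (fun x : EuclideanSpace ℝ (Fin n) => c * (1 + ‖x‖ ^ 2) ^ (-(3 * kap n))) q volume
      < ∞ := by
  have hq0 : q ≠ 0 := (lt_of_lt_of_le one_pos hq).ne'
  have hqr : 1 ≤ q.toReal := by simpa using ENNReal.toReal_mono hq' hq
  have hk := three_mul_kap_gt hn
  have hk0 := kap_pos (n := n)
  rw [eLpNorm_eq_lintegral_rpow_enorm_toReal hq0 hq']
  refine ENNReal.rpow_lt_top_of_nonneg (by positivity) (ne_of_lt ?_)
  have hi := (integrable_norm_rpow_mul (n := n) hn le_rfl (by positivity)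
    (b := 3 * kap n * q.toReal) (hk.trans_le (le_mul_of_one_le_right (by positivity) hqr))).const_mul
    (|c| ^ q.toReal)
  refine lt_of_le_of_lt (lintegral_mono fun x => ?_) hi.lintegral_lt_top
  rw [← ofReal_norm, norm_mul, Real.norm_eq_abs, Real.norm_of_nonneg (by positivity),
    ENNReal.ofReal_rpow_of_nonneg (by positivity) (by positivity),
    Real.mul_rpow (by positivity) (by positivity), ← Real.rpow_mul (by positivity)]
  simp

theorem norm_sol_le_of_le {t T : ℝ} (h0 : 0 ≤ t) (h : t ≤ T) (hT : T < 1)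
    (x : EuclideanSpace ℝ (Fin n)) :
    ‖sol n t x‖ ≤ 64 ^ kap n * scale T ^ (-(n / 4 : ℝ)) * (1 + ‖x‖ ^ 2) ^ (-(3 * kap n)) := by
  have h1 := norm_solRad_le (n := n) h0 (h.trans_lt hT) (y := ‖x‖ ^ 2) (by positivity)
  have h2 : scale t ^ (-(n / 4 : ℝ)) ≤ scale T ^ (-(n / 4 : ℝ)) :=
    Real.rpow_le_rpow_of_nonpos (scale_pos hT) (scale_anti h hT)
      (by have : (0 : ℝ) ≤ n := Nat.cast_nonneg n
          linarith)
  refine h1.trans ?_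
  rw [mul_assoc]
  refine mul_le_mul_of_nonneg_left ?_ (by positivity)
  exact mul_le_mul_of_nonneg_right h2 (by positivity)

theorem memMixed_sol (hn : 2 ≤ n) {p q : ℝ≥0∞} (hp : p ≠ 0) (hp' : p ≠ ∞) (hq : 1 ≤ q)
    (hq' : q ≠ ∞) {T : ℝ} (hT : T < 1) : MemMixed (Ioo 0 T) p q (sol n) := by
  refine ⟨measurable_sol.aestronglyMeasurable, ?_⟩
  unfold mixedNorm
  set M := eLpNorm (fun x : EuclideanSpace ℝ (Fin n) =>
    64 ^ kap n * scale T ^ (-(n / 4 : ℝ)) * (1 + ‖x‖ ^ 2) ^ (-(3 * kap n))) q volume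
  have hM : M < ∞ := eLpNorm_majorant_lt_top hn hq hq' _
  rw [eLpNorm_eq_lintegral_rpow_enorm_toReal hp hp']
  refine ENNReal.rpow_lt_top_of_nonneg (by positivity) (ne_of_lt ?_)
  have h : ∀ t ∈ Ioo 0 T, ‖eLpNorm (sol n t) q volume‖ₑ ^ p.toReal ≤ M ^ p.toReal :=
    fun t ht => by
      rw [enorm_eq_self]
      refine ENNReal.rpow_le_rpow ?_ (by positivity)
      exact eLpNorm_mono_ae_real (Eventually.of_forall (norm_sol_le_of_le ht.1.le ht.2.le hT))
  refine lt_of_le_of_lt (setLIntegral_mono' measurableSet_Ioo h) ?_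
  rw [setLIntegral_const]
  exact ENNReal.mul_lt_top (ENNReal.rpow_lt_top_of_nonneg (by positivity) hM.ne) (by simp)

/-! ### Blow-up of the Strichartz norms -/

theorem lintegral_const_div_one_sub {c : ℝ} (hc : 0 < c) :
    ∫⁻ t in Ioo (0 : ℝ) 1, ENNReal.ofReal (c * (1 - t)⁻¹) = ∞ := by
  by_contra hne
  have h1 : IntegrableOn (fun t : ℝ => c * (1 - t)⁻¹) (Ioo 0 1) := by
    refine ⟨by apply Measurable.aestronglyMeasurable; fun_prop, ?_⟩
    rw [hasFiniteIntegral_iff_ofReal]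
    · exact lt_top_iff_ne_top.2 hne
    · refine (ae_restrict_iff' measurableSet_Ioo).2 (Eventually.of_forall fun t ht => ?_)
      have : 0 < 1 - t := by linarith [ht.2]
      simp only [Pi.zero_apply]; positivity
  have h2 : IntervalIntegrable (fun t : ℝ => (t - 1)⁻¹) volume 0 1 := by
    rw [intervalIntegrable_iff_integrableOn_Ioo_of_le zero_le_one]
    have h3 : IntegrableOn (fun t : ℝ => -c⁻¹ * (c * (1 - t)⁻¹)) (Ioo 0 1) := h1.const_mul _
    refine h3.congr_fun (fun t ht => ?_) measurableSet_Ioo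
    have : 1 - t ≠ 0 := by linarith [ht.2]
    have : t - 1 ≠ 0 := by linarith [ht.2]
    have : (t - 1)⁻¹ = -(1 - t)⁻¹ := by rw [← inv_neg]; ring_nf
    rw [this]; field_simp
  rw [intervalIntegrable_sub_inv_iff] at h2
  simp at h2

theorem volume_ball_sqrt (hn : 2 ≤ n) {τ : ℝ} (hτ : 0 ≤ τ) :
    volume (Metric.ball (0 : EuclideanSpace ℝ (Fin n)) (√τ)) =
      ENNReal.ofReal (τ ^ ((n : ℝ) / 2)) * volume (Metric.ball (0 : EuclideanSpace ℝ (Fin n)) 1) := by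
  have : Nontrivial (EuclideanSpace ℝ (Fin n)) := by
    apply Module.nontrivial_of_finrank_pos (R := ℝ); rw [finrank_euclideanSpace_fin]; omega
  rw [Measure.addHaar_ball _ _ (Real.sqrt_nonneg _), finrank_euclideanSpace_fin]
  congr 2
  rw [Real.sqrt_eq_rpow, ← Real.rpow_natCast, ← Real.rpow_mul hτ]
  congr 1; ring

theorem norm_sq_le_of_mem_ball {τ : ℝ} {x : EuclideanSpace ℝ (Fin n)} (hτ : 0 ≤ τ)
    (hx : x ∈ Metric.ball 0 (√τ)) : ‖x‖ ^ 2 ≤ τ := by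
  rw [mem_ball_zero_iff] at hx
  calc ‖x‖ ^ 2 ≤ √τ ^ 2 := pow_le_pow_left₀ (norm_nonneg _) hx.le 2
    _ = τ := Real.sq_sqrt hτ

theorem kap_sub_half (n : ℕ) : (n / 4 : ℝ) = kap n - 1 / 2 := by unfold kap; ring

/-- Only the core ball is used: the lower bound on the amplitude there is constant, and the ball has
volume proportional to `τ^(n/2)`. -/
theorem le_eLpNorm_sol (hn : 2 ≤ n) {q : ℝ≥0∞} (hq : q ≠ 0) (hq' : q ≠ ∞) :
    ∃ c : ℝ, 0 < c ∧ ∀ t ∈ Ioo (0 : ℝ) 1,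
      ENNReal.ofReal (c * (scale t ^ (-(n / 4 - n / 2 / q.toReal)) *
        (1 - Real.log (scale t)) ^ (-kap n))) ≤ eLpNorm (sol n t) q volume := by
  have hqr : 0 < q.toReal := ENNReal.toReal_pos hq hq'
  have hω : 0 < volume.real (Metric.ball (0 : EuclideanSpace ℝ (Fin n)) 1) := by
    exact ENNReal.toReal_pos (Metric.measure_ball_pos volume _ one_pos).ne' measure_ball_lt_top.ne
  set ω := volume.real (Metric.ball (0 : EuclideanSpace ℝ (Fin n)) 1)
  refine ⟨(3 / 16) ^ (1 / 2 : ℝ) * 2 ^ (-kap n) * ω ^ (1 / q.toReal), by positivity, fun t ht => ?_⟩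
  have hτ := scale_pos ht.2
  have hτ1 := scale_le_one ht.1.le ht.2
  have hL := one_le_one_sub_log hτ hτ1
  set τ := scale t
  set A : ℝ := (3 / 16) ^ (1 / 2 : ℝ) * 2 ^ (-kap n) *
    (τ ^ (-(n / 4 : ℝ)) * (1 - Real.log τ) ^ (-kap n)) with hA
  have hA0 : 0 ≤ A := by
    have : 0 ≤ 1 - Real.log τ := by linarith
    positivity
  have h1 : eLpNorm (fun _ : EuclideanSpace ℝ (Fin n) => A) q
      (volume.restrict (Metric.ball 0 (√τ))) ≤ eLpNorm (sol n t) q volume := by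
    refine le_trans ?_ 
      (eLpNorm_mono_measure _ (Measure.restrict_le_self (s := Metric.ball 0 (√τ))))
    refine eLpNorm_mono_ae ((ae_restrict_iff' measurableSet_ball).2
      (Eventually.of_forall fun x hx => ?_))
    rw [Real.norm_of_nonneg hA0]
    have := exp_logAmp_ge_inner (kap_pos (n := n)).le (kap_sub_half n) hτ hτ1 (y := ‖x‖ ^ 2)
      (by positivity) (norm_sq_le_of_mem_ball hτ.le hx)
    rw [← norm_solRad ht.2] at this
    exact this
  refine le_trans (le_of_eq ?_) h1
  rw [eLpNorm_const' _ hq hq', Measure.restrict_apply_univ, volume_ball_sqrt hn hτ.le,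
    Real.enorm_of_nonneg hA0, ← ofReal_measureReal measure_ball_lt_top.ne,
    ← ENNReal.ofReal_mul (by positivity), ENNReal.ofReal_rpow_of_nonneg (by positivity) (by positivity),
    ← ENNReal.ofReal_mul hA0]
  congr 1
  have e : τ ^ (-((n : ℝ) / 4 - n / 2 / q.toReal)) =
      τ ^ (-(n / 4 : ℝ)) * (τ ^ ((n : ℝ) / 2)) ^ (1 / q.toReal) := by
    rw [← Real.rpow_mul hτ.le, ← Real.rpow_add hτ]
    congr 1; ring
  rw [Real.mul_rpow (by positivity) hω.le, e, hA]
  ring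

theorem not_memMixed_sol (hn : 2 ≤ n) {p q : ℝ≥0∞} (hp : p ≠ 0) (hp' : p ≠ ∞) (hq : q ≠ 0)
    (hq' : q ≠ ∞) (h : (p.toReal)⁻¹ = n / 4 - n / 2 / q.toReal) :
    ¬ MemMixed (Ioo 0 1) p q (sol n) := by
  rintro ⟨-, hfin⟩
  obtain ⟨c, hc, hle⟩ := le_eLpNorm_sol hn hq hq'
  have hpr : 0 < p.toReal := ENNReal.toReal_pos hp hp'
  set P := p.toReal
  unfold mixedNorm at hfin
  rw [eLpNorm_eq_lintegral_rpow_enorm_toReal hp hp'] at hfin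
  have hfin' := ((ENNReal.rpow_lt_top_iff_of_pos (by positivity)).1 hfin)
  have hk := kap_pos (n := n)
  -- The logarithmic factor raised to the power `P` costs at most `τ^(1/5)`, leaving `τ^(-4/5) = (1
  -- - t)⁻¹`, which just fails to be integrable.
  set δ : ℝ := min 1 (1 / (5 * (kap n * P))) with hδ
  have hδ0 : 0 < δ := lt_min one_pos (by positivity)
  have hδ1 : δ ≤ 1 := min_le_left _ _
  have hδk : δ * (kap n * P) ≤ 1 / 5 := by
    calc δ * (kap n * P) ≤ 1 / (5 * (kap n * P)) * (kap n * P) := by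
          gcongr; exact min_le_right _ _
      _ = 1 / 5 := by field_simp
  have hc' : 0 < (c * δ ^ kap n) ^ P := by positivity
  refine absurd (lintegral_const_div_one_sub hc') (ne_of_lt (lt_of_le_of_lt ?_ hfin'))
  refine setLIntegral_mono' measurableSet_Ioo fun t ht => ?_
  have hτ := scale_pos ht.2
  have hτ1 := scale_le_one ht.1.le ht.2
  have hL := one_le_one_sub_log hτ hτ1
  have hLδ := one_sub_log_le hτ hδ0 hδ1
  rw [enorm_eq_self]
  refine le_trans ?_ (ENNReal.rpow_le_rpow (hle t ht) hpr.le)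
  have hL0 : 0 ≤ 1 - Real.log (scale t) := by linarith
  rw [ENNReal.ofReal_rpow_of_nonneg (by positivity) hpr.le]
  apply ENNReal.ofReal_le_ofReal
  have h1 : (δ⁻¹ * scale t ^ (-δ)) ^ (-kap n) ≤ (1 - Real.log (scale t)) ^ (-kap n) :=
    Real.rpow_le_rpow_of_nonpos (by linarith) hLδ (by linarith)
  have h2 : (δ⁻¹ * scale t ^ (-δ)) ^ (-kap n) = δ ^ kap n * scale t ^ (δ * kap n) := by
    rw [Real.mul_rpow (by positivity) (by positivity), ← Real.rpow_mul hτ.le,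
      Real.inv_rpow hδ0.le, Real.rpow_neg hδ0.le, inv_inv]
    congr 2; ring
  rw [h2] at h1
  have h3 : (c * δ ^ kap n) * scale t ^ (-(P⁻¹) + δ * kap n) ≤
      c * (scale t ^ (-(n / 4 - n / 2 / q.toReal)) * (1 - Real.log (scale t)) ^ (-kap n)) := by
    rw [← h, Real.rpow_add hτ]
    calc _ = c * (scale t ^ (-P⁻¹) * (δ ^ kap n * scale t ^ (δ * kap n))) := by ring
      _ ≤ _ := mul_le_mul_of_nonneg_left (mul_le_mul_of_nonneg_left h1 (by positivity)) hc.le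
  refine le_trans ?_ (Real.rpow_le_rpow (by positivity) h3 hpr.le)
  rw [Real.mul_rpow (x := c * δ ^ kap n) (by positivity) (by positivity), ← Real.rpow_mul hτ.le]
  refine mul_le_mul_of_nonneg_left ?_ (by positivity)
  have e : (-P⁻¹ + δ * kap n) * P = -1 + δ * (kap n * P) := by field_simp
  have h4 : (1 - t)⁻¹ = scale t ^ (-(4 / 5) : ℝ) := by
    rw [scale_rpow ht.2, ← Real.rpow_neg_one]; norm_num
  rw [e, h4]
  exact Real.rpow_le_rpow_of_exponent_ge hτ hτ1 (by linarith)

/-- If `q = ∞` then `1/p = n/4 ≤ 1/2`, which forces `n = 2` and `p = 2`, the excluded endpoint. -/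
theorem SchrodingerAdmissible.ne_top {p q : ℝ≥0∞} (hn : 2 ≤ n) (h : SchrodingerAdmissible n p q) :
    q ≠ ∞ := by
  rintro rfl
  obtain ⟨h1, h2, -, h4⟩ := h
  have hn' : (2 : ℝ) ≤ n := by exact_mod_cast hn
  rw [ENNReal.inv_top, mul_zero, add_zero] at h1
  have h5 : p⁻¹ ≤ 2⁻¹ := ENNReal.inv_le_inv.2 h2
  have h6 := congrArg ENNReal.toReal h1
  have h7 := ENNReal.toReal_mono (by simp) h5
  rw [h6] at h7
  simp only [ENNReal.toReal_div, ENNReal.toReal_natCast, ENNReal.toReal_ofNat,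
    ENNReal.toReal_inv] at h7
  have h8 : (n : ℝ) = 2 := by linarith
  have h9 : n = 2 := by exact_mod_cast h8
  subst h9
  refine h4 ⟨rfl, ?_, rfl⟩
  rw [← inv_inj, h1]
  rw [← ENNReal.toReal_eq_toReal_iff' (by simp [ENNReal.div_eq_top]) (by simp)]
  norm_num

theorem SchrodingerAdmissible.inv_toReal {p q : ℝ≥0∞} (h : SchrodingerAdmissible n p q) :
    (p.toReal)⁻¹ = n / 4 - n / 2 / q.toReal := by
  obtain ⟨h1, h2, h3, -⟩ := h
  have hp : p ≠ 0 := (lt_of_lt_of_le two_pos h2).ne'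
  have hq : q ≠ 0 := (lt_of_lt_of_le two_pos h3).ne'
  have h6 := congrArg ENNReal.toReal h1
  rw [ENNReal.toReal_add (by simpa using hp)
    (ENNReal.mul_ne_top (by simp [ENNReal.div_eq_top]) (by simpa using hq))] at h6
  simp only [ENNReal.toReal_div, ENNReal.toReal_natCast, ENNReal.toReal_ofNat,
    ENNReal.toReal_inv, ENNReal.toReal_mul] at h6
  rw [div_eq_mul_inv _ q.toReal]
  linarith

end

/-! ### Continuity in `L²` -/

section
variable {n : ℕ}

theorem tendsto_eLpNorm_two_zero {ι α : Type*} [MeasurableSpace α] {l : Filter ι}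
    {F : ι → α → ℂ} {μ : ι → Measure α}
    (h : Tendsto (fun i => ∫⁻ x, ‖F i x‖ₑ ^ (2 : ℝ) ∂μ i) l (𝓝 0)) :
    Tendsto (fun i => eLpNorm (F i) 2 (μ i)) l (𝓝 0) := by
  have h1 := (ENNReal.continuous_rpow_const (y := 1 / 2)).tendsto 0 |>.comp h
  rw [ENNReal.zero_rpow_of_pos (by norm_num)] at h1
  refine h1.congr fun i => ?_
  rw [eLpNorm_eq_lintegral_rpow_enorm_toReal two_ne_zero ENNReal.ofNat_ne_top]
  simp

theorem memLp_sol (hn : 2 ≤ n) {t : ℝ} (ht : t ∈ Icc (0 : ℝ) 1) : MemLp (sol n t) 2 volume := by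
  refine ⟨(measurable_sol_slice t).aestronglyMeasurable, ?_⟩
  rcases ht.2.lt_or_eq with h | rfl
  · exact lt_of_le_of_lt
      (eLpNorm_mono_ae_real (Eventually.of_forall (norm_sol_le_of_le ht.1 le_rfl h)))
      (eLpNorm_majorant_lt_top hn one_le_two ENNReal.ofNat_ne_top _)
  · have h1 : MemLp (sol n 1) 2 volume := by
      rw [memLp_two_iff_integrable_sq_norm (measurable_sol_slice 1).aestronglyMeasurable]
      refine (integrable_exp_logStat_sq hn).congr (Eventually.of_forall fun x => ?_)
      simp only [sol]
      rw [solRad_one, Complex.norm_exp, Complex.ofReal_re]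
    exact h1.2

theorem norm_sq_sol_le {t : ℝ} (h0 : 0 ≤ t) (h : t < 1) {x : EuclideanSpace ℝ (Fin n)}
    (hx : ‖x‖ ^ 2 ≤ scale t) :
    ‖sol n t x‖ ^ (2 : ℝ) ≤ (8 / 3) ^ (2 * kap n) * scale t ^ (-(n / 2 : ℝ)) *
      (1 + (1 - Real.log (scale t)) * (‖x‖ ^ 2 / scale t))⁻¹ := by
  have hτ := scale_pos h
  have hτ1 := scale_le_one h0 h
  have hL := one_le_one_sub_log hτ hτ1
  have h1 := exp_logAmp_le_inner (kap_pos (n := n)).le (kap_sub_half n) hτ hτ1 (y := ‖x‖ ^ 2)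
    (by positivity) hx
  rw [← norm_solRad h] at h1
  have hL0 : 0 ≤ 1 - Real.log (scale t) := by linarith
  set D := 1 + (1 - Real.log (scale t)) * (‖x‖ ^ 2 / scale t) with hD
  have hD1 : 1 ≤ D := by
    have : 0 ≤ (1 - Real.log (scale t)) * (‖x‖ ^ 2 / scale t) := by positivity
    linarith
  refine (Real.rpow_le_rpow (norm_nonneg _) h1 two_pos.le).trans ?_
  rw [Real.mul_rpow (by positivity) (by positivity), Real.mul_rpow (by positivity) (by positivity),
    ← Real.rpow_mul (by positivity), ← Real.rpow_mul hτ.le, ← Real.rpow_mul (by positivity),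
    mul_comm (kap n) 2, show -(n / 4 : ℝ) * 2 = -(n / 2 : ℝ) by ring, ← mul_assoc,
    ← Real.rpow_neg_one D]
  refine mul_le_mul_of_nonneg_left ?_ (by positivity)
  -- The base is at least `1` and `2κ ≥ 1`, so the decay may be weakened to a single inverse power.
  refine Real.rpow_le_rpow_of_exponent_le hD1 ?_
  have : (0 : ℝ) ≤ n := Nat.cast_nonneg n
  unfold kap; linarith

/-- Split the core at `|x|² = δτ`. The inner ball has relative volume `δ^(n/2) ≤ δ`, and on the rest
the density gains the factor `1/(Lδ)`. The choice `δ = L^(-1/2)` balances the two. -/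
theorem lintegral_sq_sol_le (hn : 2 ≤ n) {t : ℝ} (h0 : 0 ≤ t) (h : t < 1) :
    ∫⁻ x in Metric.ball 0 (√(scale t)), ‖sol n t x‖ₑ ^ (2 : ℝ) ≤
      ENNReal.ofReal (2 * (8 / 3) ^ (2 * kap n) * (1 - Real.log (scale t)) ^ (-(1 / 2) : ℝ)) *
        volume (Metric.ball (0 : EuclideanSpace ℝ (Fin n)) 1) := by
  have hτ := scale_pos h
  have hτ1 := scale_le_one h0 h
  have hL := one_le_one_sub_log hτ hτ1
  have hN := fun (x : EuclideanSpace ℝ (Fin n)) hx => norm_sq_sol_le (n := n) h0 h (x := x) hx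
  set τ := scale t
  set L := 1 - Real.log τ
  have hL0 : 0 < L := by linarith
  set δ : ℝ := L ^ (-(1 / 2) : ℝ) with hδ
  have hδ0 : 0 < δ := by positivity
  have hδ1 : δ ≤ 1 := Real.rpow_le_one_of_one_le_of_nonpos hL (by norm_num)
  have hδL : (L * δ)⁻¹ = δ := by
    rw [hδ, mul_inv, ← Real.rpow_neg hL0.le, ← Real.rpow_neg_one, ← Real.rpow_add hL0]
    norm_num
  set B : ℝ := (8 / 3) ^ (2 * kap n) * τ ^ (-(n / 2 : ℝ)) with hB
  have hB0 : 0 ≤ B := by positivity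
  have key : ∀ x ∈ Metric.ball (0 : EuclideanSpace ℝ (Fin n)) (√τ), ‖sol n t x‖ₑ ^ (2 : ℝ) ≤
      (Metric.ball (0 : EuclideanSpace ℝ (Fin n)) (√(δ * τ))).indicator
        (fun _ => ENNReal.ofReal B) x + ENNReal.ofReal (B * δ) := by
    intro x hx
    have h1 := hN x (norm_sq_le_of_mem_ball hτ.le hx)
    rw [← ofReal_norm, ENNReal.ofReal_rpow_of_nonneg (norm_nonneg _) two_pos.le]
    by_cases hx2 : x ∈ Metric.ball (0 : EuclideanSpace ℝ (Fin n)) (√(δ * τ))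
    · rw [indicator_of_mem hx2]
      refine le_add_right (ENNReal.ofReal_le_ofReal (h1.trans ?_))
      refine mul_le_of_le_one_right hB0 (inv_le_one_of_one_le₀ ?_)
      have : 0 ≤ L * (‖x‖ ^ 2 / τ) := by positivity
      linarith
    · rw [indicator_of_notMem hx2, zero_add]
      refine ENNReal.ofReal_le_ofReal (h1.trans (mul_le_mul_of_nonneg_left ?_ hB0))
      rw [mem_ball_zero_iff, not_lt, Real.sqrt_le_left (norm_nonneg _)] at hx2
      have h2 : δ ≤ ‖x‖ ^ 2 / τ := (le_div_iff₀ hτ).2 hx2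
      have h3 : L * δ ≤ L * (‖x‖ ^ 2 / τ) := mul_le_mul_of_nonneg_left h2 hL0.le
      rw [← hδL]
      exact inv_anti₀ (by positivity) (by linarith)
  refine (setLIntegral_mono' measurableSet_ball key).trans ?_
  rw [lintegral_add_right _ measurable_const, lintegral_indicator measurableSet_ball,
    setLIntegral_const, setLIntegral_const, Measure.restrict_apply measurableSet_ball]
  refine (add_le_add_left (mul_le_mul_right (measure_mono inter_subset_left) _) _).trans ?_
  rw [volume_ball_sqrt hn (by positivity), volume_ball_sqrt hn hτ.le, ← mul_assoc, ← mul_assoc,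
    ← add_mul, ← ENNReal.ofReal_mul hB0, ← ENNReal.ofReal_mul (by positivity),
    ← ENNReal.ofReal_add (by positivity) (by positivity)]
  refine mul_le_mul_left (ENNReal.ofReal_le_ofReal ?_) _
  have h4 : τ ^ (-(n / 2 : ℝ)) * τ ^ ((n : ℝ) / 2) = 1 := by
    rw [← Real.rpow_add hτ]; simp
  have h5 : δ ^ ((n : ℝ) / 2) ≤ δ := by
    have hn' : (2 : ℝ) ≤ n := by exact_mod_cast hn
    simpa using Real.rpow_le_rpow_of_exponent_ge hδ0 hδ1 (by linarith : (1 : ℝ) ≤ n / 2)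
  rw [Real.mul_rpow hδ0.le hτ.le]
  calc B * (δ ^ ((n : ℝ) / 2) * τ ^ ((n : ℝ) / 2)) + B * δ * τ ^ ((n : ℝ) / 2)
      = (8 / 3) ^ (2 * kap n) * (τ ^ (-(n / 2 : ℝ)) * τ ^ ((n : ℝ) / 2)) *
          (δ ^ ((n : ℝ) / 2) + δ) := by rw [hB]; ring
    _ = (8 / 3) ^ (2 * kap n) * (δ ^ ((n : ℝ) / 2) + δ) := by rw [h4, mul_one]
    _ ≤ (8 / 3) ^ (2 * kap n) * (δ + δ) := by gcongr
    _ = _ := by ring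

theorem tendsto_scale : Tendsto scale (𝓝[Ico 0 1] 1) (𝓝[>] 0) := by
  refine tendsto_nhdsWithin_iff.2 ⟨?_, ?_⟩
  · have h1 := continuous_scale.tendsto 1
    have h2 : scale 1 = 0 := by unfold scale; norm_num
    rw [h2] at h1
    exact h1.mono_left nhdsWithin_le_nhds
  · exact eventually_nhdsWithin_of_forall fun t ht => scale_pos ht.2

/-- Dominated convergence, with the square-integrable majorant valid up to a time `T` strictly
between `t₀` and `1`. -/
theorem tendsto_eLpNorm_sol_sub_of_lt (hn : 2 ≤ n) {t₀ : ℝ} (h0 : 0 ≤ t₀) (h : t₀ < 1) :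
    Tendsto (fun t => eLpNorm (sol n t - sol n t₀) 2 volume) (𝓝[Icc 0 1] t₀) (𝓝 0) := by
  refine tendsto_eLpNorm_two_zero (μ := fun _ => volume) ?_
  set T := (1 + t₀) / 2
  have hT1 : T < 1 := by simp only [T]; linarith
  have hT0 : t₀ < T := by simp only [T]; linarith
  set c : ℝ := 2 * (64 ^ kap n * scale T ^ (-(n / 4 : ℝ)))
  have hfin := eLpNorm_majorant_lt_top hn one_le_two ENNReal.ofNat_ne_top c
  have hfin' := lintegral_rpow_enorm_lt_top_of_eLpNorm_lt_top two_ne_zero ENNReal.ofNat_ne_top hfin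
  rw [ENNReal.toReal_ofNat] at hfin'
  have hlim : Tendsto (fun t => ∫⁻ x, ‖(sol n t - sol n t₀) x‖ₑ ^ (2 : ℝ)) (𝓝[Icc 0 1] t₀)
      (𝓝 (∫⁻ x : EuclideanSpace ℝ (Fin n), 0)) := by
    refine tendsto_lintegral_filter_of_dominated_convergence _ ?_ ?_ hfin'.ne ?_
    · exact Eventually.of_forall fun t =>
        ((measurable_sol_slice t).sub (measurable_sol_slice t₀)).enorm.pow_const _
    · filter_upwards [self_mem_nhdsWithin, mem_nhdsWithin_of_mem_nhds (Iio_mem_nhds hT0)]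
        with t ht htT
      refine Eventually.of_forall fun x => ENNReal.rpow_le_rpow ?_ two_pos.le
      refine enorm_le_iff_norm_le.2 ?_
      have h1 := norm_sol_le_of_le (n := n) ht.1 (le_of_lt htT) hT1 x
      have h2 := norm_sol_le_of_le (n := n) h0 hT0.le hT1 x
      refine (norm_sub_le _ _).trans ((add_le_add h1 h2).trans (le_trans (le_of_eq ?_)
        (le_abs_self _)))
      simp only [c]; ring
    · filter_upwards [ae_ne_zero hn] with x hx
      have h1 : Tendsto (fun t => sol n t x) (𝓝[Icc 0 1] t₀) (𝓝 (sol n t₀ x)) :=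
        continuousOn_solRad_time (n := n) (y := ‖x‖ ^ 2) (by positivity) t₀ ⟨h0, h.le⟩
      have h2 := (h1.sub_const (sol n t₀ x)).enorm
      rw [sub_self, enorm_zero] at h2
      have h3 := ((ENNReal.continuous_rpow_const (y := 2)).tendsto 0).comp h2
      rw [ENNReal.zero_rpow_of_pos two_pos] at h3
      exact h3
  rwa [lintegral_zero] at hlim

/-- Dominated convergence with `solBound` is not available, as `|x|^(-n/2)` is not square integrable
at the origin. Instead, `sol n t` and `sol n 1` differ only on the shrinking core: the first has
vanishing mass there by `lintegral_sq_sol_le`, the second by absolute continuity of the integral. -/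
theorem tendsto_eLpNorm_sol_sub_one (hn : 2 ≤ n) :
    Tendsto (fun t => eLpNorm (sol n t - sol n 1) 2 volume) (𝓝[Ico 0 1] 1) (𝓝 0) := by
  have hω : volume (Metric.ball (0 : EuclideanSpace ℝ (Fin n)) 1) ≠ ∞ := measure_ball_lt_top.ne
  have h1 : Tendsto (fun t => eLpNorm (sol n t) 2
      (volume.restrict (Metric.ball 0 (√(scale t))))) (𝓝[Ico 0 1] 1) (𝓝 0) := by
    refine tendsto_eLpNorm_two_zero ?_
    have hL : Tendsto (fun t => 1 - Real.log (scale t)) (𝓝[Ico 0 1] 1) atTop := by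
      have := tendsto_neg_atBot_atTop.comp (Real.tendsto_log_nhdsGT_zero.comp tendsto_scale)
      exact tendsto_atTop_add_const_left _ 1 this
    have hL2 := ((tendsto_rpow_neg_atTop (by norm_num : (0 : ℝ) < 1 / 2)).comp hL).const_mul
      (2 * (8 / 3) ^ (2 * kap n))
    rw [mul_zero] at hL2
    have hL3 := ENNReal.Tendsto.mul_const (ENNReal.tendsto_ofReal hL2) (Or.inr hω)
    rw [ENNReal.ofReal_zero, zero_mul] at hL3
    refine tendsto_of_tendsto_of_tendsto_of_le_of_le' tendsto_const_nhds hL3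
      (Eventually.of_forall fun _ => zero_le) ?_
    exact eventually_nhdsWithin_of_forall fun t ht => lintegral_sq_sol_le hn ht.1 ht.2
  have h2 : Tendsto (fun t => eLpNorm (sol n 1) 2
      (volume.restrict (Metric.ball 0 (√(scale t))))) (𝓝[Ico 0 1] 1) (𝓝 0) := by
    refine tendsto_eLpNorm_two_zero (F := fun _ => sol n 1) ?_
    have hfin := lintegral_rpow_enorm_lt_top_of_eLpNorm_lt_top two_ne_zero ENNReal.ofNat_ne_top
      (memLp_sol hn (right_mem_Icc.2 zero_le_one)).2
    rw [ENNReal.toReal_ofNat] at hfin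
    refine tendsto_setLIntegral_zero hfin.ne ?_
    have h3 : Tendsto (fun t => scale t ^ ((n : ℝ) / 2)) (𝓝[Ico 0 1] 1) (𝓝 0) := by
      have h4 := (tendsto_nhdsWithin_iff.1 tendsto_scale).1
      have hn' : (0 : ℝ) < n / 2 := by
        have : (2 : ℝ) ≤ n := by exact_mod_cast hn
        linarith
      have h5 := h4.rpow_const (p := (n : ℝ) / 2) (Or.inr hn'.le)
      rwa [Real.zero_rpow hn'.ne'] at h5
    have h6 := ENNReal.Tendsto.mul_const (ENNReal.tendsto_ofReal h3) (Or.inr hω)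
    rw [ENNReal.ofReal_zero, zero_mul] at h6
    refine h6.congr' (eventually_nhdsWithin_of_forall fun t ht => ?_)
    exact (volume_ball_sqrt hn (scale_pos ht.2).le).symm
  have h3 := h1.add h2
  rw [add_zero] at h3
  refine tendsto_of_tendsto_of_tendsto_of_le_of_le' tendsto_const_nhds h3
    (Eventually.of_forall fun _ => zero_le) ?_
  refine eventually_nhdsWithin_of_forall fun t ht => ?_
  have hsupp : Function.support (sol n t - sol n 1) ⊆ Metric.ball 0 (√(scale t)) := by
    intro x hx
    by_contra hx2
    rw [mem_ball_zero_iff, not_lt, Real.sqrt_le_left (norm_nonneg _)] at hx2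
    refine hx ?_
    simp only [Pi.sub_apply, sol]
    rw [solRad_of_scale_le ht.2 hx2, solRad_one, sub_self]
  rw [← eLpNorm_restrict_eq_of_support_subset hsupp]
  exact eLpNorm_sub_le (measurable_sol_slice t).aestronglyMeasurable
    (measurable_sol_slice 1).aestronglyMeasurable one_le_two

theorem tendsto_eLpNorm_sol_sub (hn : 2 ≤ n) {t₀ : ℝ} (ht : t₀ ∈ Icc (0 : ℝ) 1) :
    Tendsto (fun t => eLpNorm (sol n t - sol n t₀) 2 volume) (𝓝[Icc 0 1] t₀) (𝓝 0) := by
  rcases ht.2.lt_or_eq with h | rfl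
  · exact tendsto_eLpNorm_sol_sub_of_lt hn ht.1 h
  · have e : Icc (0 : ℝ) 1 = insert 1 (Ico 0 1) := (Ico_insert_right zero_le_one).symm
    rw [e, nhdsWithin_insert]
    refine Tendsto.sup ?_ (tendsto_eLpNorm_sol_sub_one hn)
    rw [tendsto_pure_left]
    intro s hs
    simpa using mem_of_mem_nhds hs

theorem memContL2_sol (hn : 2 ≤ n) : MemContL2 (Icc 0 1) (sol n) := by
  classical
  refine ⟨measurable_sol.aestronglyMeasurable,
    fun t => if h : t ∈ Icc (0 : ℝ) 1 then (memLp_sol hn h).toLp _ else 0, ?_, ?_⟩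
  · intro t₀ ht₀
    rw [ContinuousWithinAt, Lp.tendsto_Lp_iff_tendsto_eLpNorm']
    refine (tendsto_eLpNorm_sol_sub hn ht₀).congr' ?_
    refine eventually_nhdsWithin_of_forall fun t ht => ?_
    beta_reduce
    rw [dif_pos ht, dif_pos ht₀]
    exact eLpNorm_congr_ae (((memLp_sol hn ht).coeFn_toLp).sub
      ((memLp_sol hn ht₀).coeFn_toLp)).symm
  · intro t ht
    beta_reduce
    rw [dif_pos ht]
    exact (memLp_sol hn ht).coeFn_toLp

end

/-! ### The counterexample assembled -/

theorem proposition1p4 (n : ℕ) (hn : 2 ≤ n) (r s : ℝ) (hr : 1 ≤ r)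
    (hs₁ : (n : ℝ) / 2 < s) (hs₂ : s < n) (hrs : 1 / (2 * r) + n / (2 * s) > 1) :
    ∃ (V : ℝ → EuclideanSpace ℝ (Fin n) → ℝ) (u : ℝ → EuclideanSpace ℝ (Fin n) → ℂ),
      MemMixed (Ioo 0 1) (ENNReal.ofReal r) (ENNReal.ofReal s) V ∧
      MemContL2 (Icc 0 1) u ∧
      IsIntegralSolution 1 V u ∧
      ∀ p q : ℝ≥0∞, SchrodingerAdmissible n p q → p < ∞ →
        (∀ T : ℝ, 0 < T → T < 1 → MemMixed (Ioo 0 T) p q u) ∧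
        ¬ MemMixed (Ioo 0 1) p q u := by
  refine ⟨pot n, sol n, memMixed_pot hn hr hs₁ hrs, memContL2_sol hn, isIntegralSolution_sol hn,
    fun p q h hp => ?_⟩
  have hp0 : p ≠ 0 := (lt_of_lt_of_le two_pos h.2.1).ne'
  have hq : 1 ≤ q := one_le_two.trans h.2.2.1
  have hq' := h.ne_top hn
  exact ⟨fun T _ hT => memMixed_sol hn hp0 hp.ne hq hq' hT,
    not_memMixed_sol hn hp0 hp.ne (lt_of_lt_of_le one_pos hq).ne' hq' h.inv_toReal⟩
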